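/- Let $G$ be a finite connected simple graph and let $s\in V(G)$. A broadcasting protocol from $s$ in $G$ is a spanning tree $T$ of $G$ rooted at $s$ together with an ordering of the children of every vertex: the source has the message at round $0$, and a vertex that gets the message in round $r$ sends it to its first, second, third, ... child in rounds $r+1, r+2, r+3, \ldots$. The broadcast time $b(G,s)$ is the minimum integer $t\ge 0$ for which some protocol informs all vertices within $t$ rounds. The cyclomatic number of $G$ is the minimum size of a set of edges whose deletion leaves an acyclic graph. Theorem. There is an algorithm that, given a connected graph $G$ on $n$ vertices, a source $s\in V(G)$ and an integer $t\ge 0$, decides whether $b(G,s)\le t$, and whose running time is $2^{O(k\log k)}\cdot n^{O(1)}$ for every $k$ such that the cyclomatic number of $G$ is at most $k$. (Time is the number of steps of a random access machine with addition and subtraction in which each integer, in particular $t$, occupies one cell.) -/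

import Mathlib

/-! ### Broadcasting in the telephone model -/

/-- A broadcasting protocol in `G` from the source `s`: a spanning tree `T` of `G`, rooted at `s`,
together with an ordering `C v` of the set of children of every vertex `v`. -/
structure BroadcastProtocol {V : Type*} (G : SimpleGraph V) (s : V) where
  /-- the spanning tree -/
  T : SimpleGraph V
  T_le : T ≤ G
  isTree : T.IsTree
  /-- the ordered set of children of each vertex -/
  C : V → List V
  nodup : ∀ v, (C v).Nodup
  /-- `u` is a child of `v` in the tree rooted at `s`: it is a neighbour of `v` in `T`
  that is one step further away from `s` -/
  mem_iff : ∀ v u, u ∈ C v ↔ T.Adj v u ∧ T.dist s u = T.dist s v + 1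

/-- `P.Receives v r`: under the protocol `P`, the vertex `v` gets the message in round `r`
(round `0` for the source). A vertex that gets the message in round `r` sends it to the first child
of its list in round `r + 1`, to the second one in round `r + 2`, and so on. -/
inductive BroadcastProtocol.Receives {V : Type*} {G : SimpleGraph V} {s : V}
    (P : BroadcastProtocol G s) : V → ℕ → Prop
  | source : P.Receives s 0
  | send {v u : V} {r i : ℕ} : P.Receives v r → (P.C v)[i]? = some u → P.Receives u (r + i + 1)

/-- Every vertex has got the message after `t` rounds. -/
def BroadcastProtocol.CompletesIn {V : Type*} {G : SimpleGraph V} {s : V}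
    (P : BroadcastProtocol G s) (t : ℕ) : Prop :=
  ∀ v, ∃ r ≤ t, P.Receives v r

/-- The broadcast time `b(G, s)`: the least `t` such that some broadcasting protocol from `s`
informs every vertex within `t` rounds (`⊤` if there is none). -/
noncomputable def broadcastTime {V : Type*} (G : SimpleGraph V) (s : V) : ℕ∞ :=
  ⨅ (t : ℕ) (_ : ∃ P : BroadcastProtocol G s, P.CompletesIn t), (t : ℕ∞)

/-! ### Cyclomatic number -/

/-- `S` is a feedback edge set of `G`: a set of edges whose deletion leaves no cycle. -/
def IsFeedbackEdgeSet {V : Type*} (G : SimpleGraph V) (S : Set (Sym2 V)) : Prop :=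
  S ⊆ G.edgeSet ∧ (G.deleteEdges S).IsAcyclic

/-- The cyclomatic number of `G`: the least size of a feedback edge set. -/
noncomputable def cyclomaticNumber {V : Type*} (G : SimpleGraph V) : ℕ∞ :=
  ⨅ (S : Set (Sym2 V)) (_ : IsFeedbackEdgeSet G S), S.encard

/-! ### Random access machine -/

namespace RAM

/-- The memory of the machine: integer variables (registers) and integer arrays, both indexed
by natural numbers. -/
structure State where
  var : ℕ → ℕ
  arr : ℕ → ℕ → ℕ

/-- Assign the value `c` to the variable `x`. -/
def State.setVar (σ : State) (x c : ℕ) : State :=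
  { σ with var := Function.update σ.var x c }

/-- Assign the value `c` to the cell `i` of the array `a`. -/
def State.setArr (σ : State) (a i c : ℕ) : State :=
  { σ with arr := Function.update σ.arr a (Function.update (σ.arr a) i c) }

/-- Programs of a random access machine with addition and truncated subtraction.
In the constructors `x`, `y`, `z`, `i` name variables, `a` names an array, `c` is a literal. -/
inductive Prog where
  /-- do nothing -/
  | skip : Prog
  /-- `x := c` -/
  | const (x c : ℕ) : Prog
  /-- `x := y + z` -/
  | add (x y z : ℕ) : Prog
  /-- `x := max (y - z) 0` -/
  | sub (x y z : ℕ) : Prog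
  /-- `x := a[i]` -/
  | load (x a i : ℕ) : Prog
  /-- `a[i] := y` -/
  | store (a i y : ℕ) : Prog
  /-- sequential composition -/
  | seq (p q : Prog) : Prog
  /-- if `x ≠ 0` then `p` else `q` -/
  | ite (x : ℕ) (p q : Prog) : Prog
  /-- while `x ≠ 0` do `p` -/
  | loop (x : ℕ) (p : Prog) : Prog

/-- `Exec p σ τ σ'`: started in the state `σ`, the program `p` halts in the state `σ'` after exactly
`τ` steps. Every elementary instruction and every test of a conditional or of a loop is a step. -/
inductive Exec : Prog → State → ℕ → State → Prop
  | skip {σ : State} : Exec .skip σ 1 σ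
  | const {σ : State} {x c : ℕ} : Exec (.const x c) σ 1 (σ.setVar x c)
  | add {σ : State} {x y z : ℕ} : Exec (.add x y z) σ 1 (σ.setVar x (σ.var y + σ.var z))
  | sub {σ : State} {x y z : ℕ} : Exec (.sub x y z) σ 1 (σ.setVar x (σ.var y - σ.var z))
  | load {σ : State} {x a i : ℕ} : Exec (.load x a i) σ 1 (σ.setVar x (σ.arr a (σ.var i)))
  | store {σ : State} {a i y : ℕ} : Exec (.store a i y) σ 1 (σ.setArr a (σ.var i) (σ.var y))
  | seq {σ σ' σ'' : State} {p q : Prog} {τ τ' : ℕ} :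
      Exec p σ τ σ' → Exec q σ' τ' σ'' → Exec (.seq p q) σ (τ + τ') σ''
  | ite_true {σ σ' : State} {x : ℕ} {p q : Prog} {τ : ℕ} :
      σ.var x ≠ 0 → Exec p σ τ σ' → Exec (.ite x p q) σ (τ + 1) σ'
  | ite_false {σ σ' : State} {x : ℕ} {p q : Prog} {τ : ℕ} :
      σ.var x = 0 → Exec q σ τ σ' → Exec (.ite x p q) σ (τ + 1) σ'
  | loop_done {σ : State} {x : ℕ} {p : Prog} : σ.var x = 0 → Exec (.loop x p) σ 1 σ
  | loop_step {σ σ' σ'' : State} {x : ℕ} {p : Prog} {τ τ' : ℕ} :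
      σ.var x ≠ 0 → Exec p σ τ σ' → Exec (.loop x p) σ' τ' σ'' →
      Exec (.loop x p) σ (τ + 1 + τ') σ''

/-- The machine is deterministic: the final state and the number of steps are determined by the
program and the initial state. -/
theorem Exec.deterministic {p : Prog} {σ σ₁ σ₂ : State} {τ₁ τ₂ : ℕ}
    (h₁ : Exec p σ τ₁ σ₁) (h₂ : Exec p σ τ₂ σ₂) : τ₁ = τ₂ ∧ σ₁ = σ₂ := by
  induction h₁ generalizing σ₂ τ₂ with
  | skip | const | add | sub | load | store => cases h₂; exact ⟨rfl, rfl⟩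
  | seq _ _ ih ih' =>
    cases h₂ with
    | seq k k' =>
      obtain ⟨rfl, rfl⟩ := ih k
      obtain ⟨rfl, rfl⟩ := ih' k'
      exact ⟨rfl, rfl⟩
  | ite_true hx _ ih =>
    cases h₂ with
    | ite_true _ k => obtain ⟨rfl, rfl⟩ := ih k; exact ⟨rfl, rfl⟩
    | ite_false hx' _ => exact absurd hx' hx
  | ite_false hx _ ih =>
    cases h₂ with
    | ite_true hx' _ => exact absurd hx hx'
    | ite_false _ k => obtain ⟨rfl, rfl⟩ := ih k; exact ⟨rfl, rfl⟩
  | loop_done hx =>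
    cases h₂ with
    | loop_done _ => exact ⟨rfl, rfl⟩
    | loop_step hx' _ _ => exact absurd hx hx'
  | loop_step hx _ _ ih ih' =>
    cases h₂ with
    | loop_done hx' => exact absurd hx' hx
    | loop_step _ k k' =>
      obtain ⟨rfl, rfl⟩ := ih k
      obtain ⟨rfl, rfl⟩ := ih' k'
      exact ⟨rfl, rfl⟩

open Classical in
/-- The initial state for the instance `(G, s, t)`: the variables `0`, `1`, `2` hold the number `n`
of vertices, the source `s` and the deadline `t`; the array `0` holds the adjacency matrix of `G`,
row by row (the entry for `i`, `j` is in the cell `i * n + j`); all the rest is `0`. -/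
noncomputable def broadcastInput {n : ℕ} (G : SimpleGraph (Fin n)) (s : Fin n) (t : ℕ) : State where
  var x := if x = 0 then n else if x = 1 then s else if x = 2 then t else 0
  arr a c := if a = 0 ∧ ∃ i j : Fin n, G.Adj i j ∧ c = i * n + j then 1 else 0

end RAM

/-!
Protocols that inform every vertex by round `t` correspond to schedules (`IsSchedule`), in which a
vertex may pause between two calls: removing the pauses makes nobody later (`exists_protocol`).
Deadlines `t > n` are no restriction for a connected graph, so `t` is replaced by `min t n`.

Leaves other than `s` are peeled off one after another. What remains is the core, and at each vertex
`v` hang some trees. For a tree hanging at `v` all that matters is its broadcast time `b c`, where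
`c` is its root, and the hanging children of `v` have to be called in the order of decreasing `b`.
So if `v` gets the message at time `r`, then the number `delay` of hanging children that must
precede the `i`-th call of `v` to the core is a function of `r + i`, and this call cannot take place
before time `r + i + delay` (`IsSchedule.add_delay_le`). Conversely, if all calls to the core take
place at these times, then by Hall's theorem the remaining time slots suffice for the hanging trees,
as long as each vertex is informed early enough to serve its hanging children alone
(`exists_slots`, `IsPeeling.exists_schedule`).

Hence only the position of every call to the core among those of its caller has to be guessed: given
these, the broadcast in the core can be simulated greedily, and no schedule with the same positions
is faster at any core vertex (`IsSchedule.simulation_le`). A core vertex other than `s` of core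
degree `2` has only one neighbour to call, and this call is the first one. So positions are guessed
only at branch vertices, which are `s` and the vertices of core degree at least `3`. As the core has
at most `k - 1` more edges than vertices and all its degrees except that of `s` are at least `2`,
the number `M` of guessed positions is at most `6 * k` (`rank_le_of_cyclomaticNumber_le`). All of
them can be taken to be less than `M`, and `M ^ M = 2 ^ O(k log k)` (`pow_self_add_one_le`).

The algorithm is written in a small language whose only loop is over the vertices. Its programs are
compiled to the random access machine and run in polynomial time (`Ex.exec_compile`,
`St.exec_compile`). The only other loop counts through the `M ^ M` guesses, as an odometer with
`M` digits in base `M` (`exec_search`).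
-/


/-! ### A structured language on top of the machine -/

namespace RAM

/-- Expressions: literals, variables, sum, truncated difference, array access, conditional, and sum
and maximum over all values `< n` of a bound variable, where `n` is the content of variable `0`. -/
inductive Ex where
  | lit (c : ℕ) : Ex
  | var (x : ℕ) : Ex
  | add (a b : Ex) : Ex
  | sub (a b : Ex) : Ex
  | ld (a : ℕ) (e : Ex) : Ex
  | cond (c a b : Ex) : Ex
  | sum (x : ℕ) (e : Ex) : Ex
  | mx (x : ℕ) (e : Ex) : Ex

/-- The value of an expression. -/
def Ex.eval : Ex → State → ℕ
  | .lit c, _ => c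
  | .var x, S => S.var x
  | .add a b, S => a.eval S + b.eval S
  | .sub a b, S => a.eval S - b.eval S
  | .ld a e, S => S.arr a (e.eval S)
  | .cond c a b, S => if c.eval S ≠ 0 then a.eval S else b.eval S
  | .sum x e, S => ∑ j ∈ Finset.range (S.var 0), e.eval (S.setVar x j)
  | .mx x e, S => (Finset.range (S.var 0)).sup fun j => e.eval (S.setVar x j)

/-- All variables of the expression are below `D`, and no bound variable is variable `0`. -/
def Ex.ok (D : ℕ) : Ex → Bool
  | .lit _ => true
  | .var x => decide (x < D)
  | .add a b => a.ok D && b.ok D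
  | .sub a b => a.ok D && b.ok D
  | .ld _ e => e.ok D
  | .cond c a b => c.ok D && (a.ok D && b.ok D)
  | .sum x e => decide (0 < x) && (decide (x < D) && e.ok D)
  | .mx x e => decide (0 < x) && (decide (x < D) && e.ok D)

/-- Code that puts the value of the expression into variable `d` and leaves all variables below `d`
as they were. -/
def Ex.compile : Ex → ℕ → Prog
  | .lit c, d => .const d c
  | .var x, d => .seq (.const d 0) (.add d x d)
  | .add a b, d => .seq (a.compile d) (.seq (b.compile (d + 1)) (.add d d (d + 1)))
  | .sub a b, d => .seq (a.compile d) (.seq (b.compile (d + 1)) (.sub d d (d + 1)))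
  | .ld a e, d => .seq (e.compile d) (.load d a d)
  | .cond c a b, d => .seq (c.compile d) (.ite d (a.compile d) (b.compile d))
  | .sum x e, d =>
    .seq (.seq (.const d 0) (.seq (.add (d + 1) x d) (.seq (.const x 0) (.add (d + 2) 0 d))))
      (.seq (.loop (d + 2) (.seq (e.compile (d + 3))
          (.seq (.add d d (d + 3)) (.seq (.const (d + 3) 1)
            (.seq (.add x x (d + 3)) (.sub (d + 2) (d + 2) (d + 3)))))))
        (.seq (.const (d + 2) 0) (.add x (d + 1) (d + 2))))
  | .mx x e, d =>
    .seq (.seq (.const d 0) (.seq (.add (d + 1) x d) (.seq (.const x 0) (.add (d + 2) 0 d))))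
      (.seq (.loop (d + 2) (.seq (e.compile (d + 3))
          (.seq (.seq (.sub (d + 3) (d + 3) d) (.add d d (d + 3))) (.seq (.const (d + 3) 1)
            (.seq (.add x x (d + 3)) (.sub (d + 2) (d + 2) (d + 3)))))))
        (.seq (.const (d + 2) 0) (.add x (d + 1) (d + 2))))

/-- A loop whose control variable `y` counts down from `N`. -/
theorem exec_countdown {p : Prog} {y N K : ℕ} (I : ℕ → State → Prop)
    (step : ∀ j σ, j < N → I j σ → σ.var y = N - j →
      ∃ τ σ', Exec p σ τ σ' ∧ τ ≤ K ∧ I (j + 1) σ' ∧ σ'.var y = N - (j + 1))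
    {σ : State} (h0 : I 0 σ) (hy : σ.var y = N) :
    ∃ τ σ', Exec (.loop y p) σ τ σ' ∧ τ ≤ N * (K + 1) + 1 ∧ I N σ' ∧ σ'.var y = 0 := by
  suffices h : ∀ m j σ, j + m = N → I j σ → σ.var y = N - j →
      ∃ τ σ', Exec (.loop y p) σ τ σ' ∧ τ ≤ m * (K + 1) + 1 ∧ I N σ' ∧ σ'.var y = 0 by
    exact h N 0 σ (by omega) h0 (by omega)
  intro m
  induction m with
  | zero =>
    intro j σ hj hI hy
    have : σ.var y = 0 := by omega
    obtain rfl : j = N := by omega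
    exact ⟨1, σ, .loop_done this, by omega, hI, this⟩
  | succ m ih =>
    intro j σ hj hI hy
    obtain ⟨τ, σ', h1, h2, h3, h4⟩ := step j σ (by omega) hI hy
    obtain ⟨τ', σ'', k1, k2, k3, k4⟩ := ih (j + 1) σ' (by omega) h3 h4
    refine ⟨_, σ'', .loop_step (by omega) h1 k1, ?_, k3, k4⟩
    rw [Nat.succ_mul]; omega

@[simp] theorem State.setVar_arr (S : State) (x c : ℕ) : (S.setVar x c).arr = S.arr := rfl

@[simp] theorem State.setVar_var (S : State) (x c y : ℕ) :
    (S.setVar x c).var y = if y = x then c else S.var y := by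
  simp [State.setVar, Function.update_apply]

@[simp] theorem State.setArr_var (S : State) (a i c : ℕ) : (S.setArr a i c).var = S.var := rfl

@[simp] theorem State.setArr_arr (S : State) (a i c b : ℕ) :
    (S.setArr a i c).arr b = if b = a then Function.update (S.arr a) i c else S.arr b := by
  simp only [State.setArr, Function.update_apply]

theorem exists_poly_bound (C₁ k₁ C₂ k₂ : ℕ) :
    ∃ C k, ∀ n, C₁ * (n + 1) ^ k₁ + C₂ * (n + 1) ^ k₂ ≤ C * (n + 1) ^ k := by
  refine ⟨C₁ + C₂, k₁ + k₂, fun n => ?_⟩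
  rw [Nat.add_mul]
  have h1 : (n + 1) ^ k₁ ≤ (n + 1) ^ (k₁ + k₂) := Nat.pow_le_pow_right (by omega) (by omega)
  have h2 : (n + 1) ^ k₂ ≤ (n + 1) ^ (k₁ + k₂) := Nat.pow_le_pow_right (by omega) (by omega)
  gcongr

theorem exists_poly_bound_add_const (C₁ k₁ c : ℕ) :
    ∃ C k, ∀ n, C₁ * (n + 1) ^ k₁ + c ≤ C * (n + 1) ^ k := by
  simpa using exists_poly_bound C₁ k₁ c 0

/-- Correctness of the compiled loop that implements `Ex.sum` and `Ex.mx`; `q` is the code that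
combines the accumulator in `d` with the new value in `d + 3`. -/
theorem exec_fold {D x d K n Kq : ℕ} {p q : Prog} {op : ℕ → ℕ → ℕ} {f : ℕ → ℕ} {S σ : State}
    (hD : D ≤ d) (hx0 : 0 < x) (hxD : x < D) (hn : S.var 0 = n)
    (hp : ∀ j σ, (∀ y < D, σ.var y = (S.setVar x j).var y) → σ.arr = S.arr →
      ∃ τ σ', Exec p σ τ σ' ∧ τ ≤ K ∧ σ'.var (d + 3) = f j ∧ (∀ y < d + 3, σ'.var y = σ.var y) ∧
        σ'.arr = σ.arr)
    (hq : ∀ σ, ∃ σ' : State, Exec q σ Kq σ' ∧ σ'.var d = op (σ.var d) (σ.var (d + 3)) ∧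
      (∀ y < d + 3, y ≠ d → σ'.var y = σ.var y) ∧ σ'.arr = σ.arr)
    (hσ : ∀ y < D, σ.var y = S.var y) (hσ' : σ.arr = S.arr) :
    ∃ τ σ', Exec (.seq
      (.seq (.const d 0) (.seq (.add (d + 1) x d) (.seq (.const x 0) (.add (d + 2) 0 d))))
      (.seq (.loop (d + 2) (.seq p (.seq q (.seq (.const (d + 3) 1)
            (.seq (.add x x (d + 3)) (.sub (d + 2) (d + 2) (d + 3)))))))
        (.seq (.const (d + 2) 0) (.add x (d + 1) (d + 2))))) σ τ σ' ∧
      τ ≤ n * (K + Kq + 4) + 7 ∧ σ'.var d = Nat.rec 0 (fun j r => op r (f j)) n ∧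
      (∀ y < d, σ'.var y = σ.var y) ∧ σ'.arr = σ.arr := by
  have e1 : Exec (.seq (.const d 0) (.seq (.add (d + 1) x d) (.seq (.const x 0) (.add (d + 2) 0 d))))
      σ (1 + (1 + (1 + 1))) _ := .seq .const (.seq .add (.seq .const .add))
  set σ₁ := ((((σ.setVar d 0).setVar (d + 1) _).setVar x 0).setVar (d + 2) _) with h₁
  obtain ⟨τ, σ₂, e2, t2, ⟨i1, i2, i3, i4, i5⟩, -⟩ := exec_countdown (p := .seq p (.seq q
      (.seq (.const (d + 3) 1) (.seq (.add x x (d + 3)) (.sub (d + 2) (d + 2) (d + 3))))))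
    (y := d + 2) (N := n) (K := K + Kq + 3)
    (fun j σ' => σ'.var x = j ∧ σ'.var d = Nat.rec 0 (fun j r => op r (f j)) j ∧
      σ'.var (d + 1) = σ.var x ∧ (∀ y < d, y ≠ x → σ'.var y = σ.var y) ∧ σ'.arr = σ.arr)
    (by
      rintro j σ' hj ⟨i1, i2, i3, i4, i5⟩ hy
      obtain ⟨τ, σ₂, e, t, a1, a2, a3⟩ := hp j σ' (by
        intro y hy
        by_cases h : y = x
        · subst h; simp [i1]
        · simp [h, i4 y (by omega) h, hσ y hy]) (by rw [i5, hσ'])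
      obtain ⟨σ₃, e', b1, b2, b3⟩ := hq σ₂
      refine ⟨_, _, .seq e (.seq e' (.seq .const (.seq .add .sub))), by omega, ⟨?_, ?_, ?_, ?_, ?_⟩, ?_⟩
      · simp [show x ≠ d + 3 by omega, show x ≠ d + 2 by omega, b2 x (by omega) (by omega),
          a2 x (by omega), i1]
      · simp [show d ≠ x by omega, b1, a1, a2 d (by omega), i2]
      · simp [show d + 1 ≠ x by omega, b2, a2, i3]
      · intro y hy hyx
        simp [hyx, show y ≠ d + 2 by omega, show y ≠ d + 3 by omega, b2 y (by omega) (by omega),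
          a2 y (by omega), i4 y hy hyx]
      · simp [b3, a3, i5]
      · simp [show d + 2 ≠ x by omega, show d + 3 ≠ x by omega, b2 (d + 2) (by omega) (by omega),
          a2 (d + 2) (by omega), hy]
        omega) (σ := σ₁)
    (by
      refine ⟨by simp [h₁, show x ≠ d + 2 by omega], by simp [h₁, show d ≠ x by omega],
        by simp [h₁, show d + 1 ≠ x by omega, show x ≠ d by omega], ?_, by simp [h₁]⟩
      intro y hy hyx
      simp [h₁, hyx, show y ≠ d + 2 by omega, show y ≠ d + 1 by omega, show y ≠ d by omega])
    (by simp [h₁, show 0 ≠ x by omega, show 0 ≠ d by omega, show d ≠ x by omega, hσ 0 (by omega), hn])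
  refine ⟨_, _, .seq e1 (.seq e2 (.seq .const .add)), ?_, ?_, ?_, ?_⟩
  · have : n * (K + Kq + 3 + 1) = n * (K + Kq + 4) := by ring
    omega
  · simp [show d ≠ x by omega, i2]
  · intro y hy
    by_cases h : y = x
    · subst h; simp [i3]
    · simp [h, show y ≠ d + 2 by omega, i4 y hy h]
  · simp [i5]

/-- The compiled code of an expression computes its value, in time polynomial in `n`. -/
theorem Ex.exec_compile {D : ℕ} (e : Ex) (he : e.ok D) :
    ∃ C k, ∀ d ≥ D, ∀ S σ : State, (∀ y < D, σ.var y = S.var y) → σ.arr = S.arr →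
      ∃ τ σ', Exec (e.compile d) σ τ σ' ∧ τ ≤ C * (S.var 0 + 1) ^ k ∧ σ'.var d = e.eval S ∧
        (∀ y < d, σ'.var y = σ.var y) ∧ σ'.arr = σ.arr := by
  have fold_bound : ∀ C k Kq : ℕ, ∀ n, n * (C * (n + 1) ^ k + Kq + 4) + 7 ≤
      (C + Kq + 11) * (n + 1) ^ (k + 1) := by
    intro C k Kq n
    have h1 : 1 ≤ (n + 1) ^ k := Nat.one_le_pow _ _ (by omega)
    rw [pow_succ]
    nlinarith [Nat.zero_le (C * (n + 1) ^ k), Nat.zero_le (n * ((n + 1) ^ k - 1)),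
      Nat.mul_le_mul_left (n * (Kq + 4)) h1, Nat.mul_le_mul_left (Kq + 4) h1,
      Nat.mul_le_mul_left n h1]
  have op_rec_sum : ∀ f : ℕ → ℕ, ∀ n, (Nat.rec 0 (fun j r => r + f j) n : ℕ) =
      ∑ j ∈ Finset.range n, f j := by
    intro f n
    induction n with
    | zero => rfl
    | succ n ih => rw [Finset.sum_range_succ, ← ih]
  have op_rec_sup : ∀ f : ℕ → ℕ, ∀ n, (Nat.rec 0 (fun j r => r + (f j - r)) n : ℕ) =
      (Finset.range n).sup f := by
    intro f n
    induction n with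
    | zero => rfl
    | succ n ih =>
      rw [Finset.range_add_one, Finset.sup_insert, ← ih]
      change _ + (_ - _) = max _ _
      omega
  induction e with
  | lit c => exact ⟨1, 0, fun d hd S σ h h' => ⟨_, _, .const, by simp, by simp [Ex.eval],
      fun y hy => by simp [hy.ne], rfl⟩⟩
  | var x =>
    simp only [Ex.ok, decide_eq_true_eq] at he
    exact ⟨2, 0, fun d hd S σ h h' => ⟨_, _, .seq .const .add, by simp,
      by simp [Ex.eval, h x he, show x ≠ d by omega], fun y hy => by simp [hy.ne], rfl⟩⟩
  | add a b iha ihb =>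
    simp only [Ex.ok, Bool.and_eq_true] at he
    obtain ⟨C₁, k₁, h₁⟩ := iha he.1
    obtain ⟨C₂, k₂, h₂⟩ := ihb he.2
    obtain ⟨C₃, k₃, h₃⟩ := exists_poly_bound C₁ k₁ C₂ k₂
    obtain ⟨C₄, k₄, h₄⟩ := exists_poly_bound_add_const C₃ k₃ 1
    refine ⟨C₄, k₄, fun d hd S σ h h' => ?_⟩
    obtain ⟨τ₁, σ₁, e₁, t₁, r₁, v₁, a₁⟩ := h₁ d hd S σ h h'
    obtain ⟨τ₂, σ₂, e₂, t₂, r₂, v₂, a₂⟩ := h₂ (d + 1) (by omega) S σ₁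
      (fun y hy => by rw [v₁ y (by omega), h y hy]) (by rw [a₁, h'])
    refine ⟨_, _, .seq e₁ (.seq e₂ .add), ?_, ?_, ?_, ?_⟩
    · have := h₃ (S.var 0); have := h₄ (S.var 0); omega
    · simp [Ex.eval, r₂, v₂, r₁]
    · intro y hy
      simp [hy.ne, v₂ y (by omega), v₁ y hy]
    · simp [a₂, a₁]
  | sub a b iha ihb =>
    simp only [Ex.ok, Bool.and_eq_true] at he
    obtain ⟨C₁, k₁, h₁⟩ := iha he.1
    obtain ⟨C₂, k₂, h₂⟩ := ihb he.2
    obtain ⟨C₃, k₃, h₃⟩ := exists_poly_bound C₁ k₁ C₂ k₂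
    obtain ⟨C₄, k₄, h₄⟩ := exists_poly_bound_add_const C₃ k₃ 1
    refine ⟨C₄, k₄, fun d hd S σ h h' => ?_⟩
    obtain ⟨τ₁, σ₁, e₁, t₁, r₁, v₁, a₁⟩ := h₁ d hd S σ h h'
    obtain ⟨τ₂, σ₂, e₂, t₂, r₂, v₂, a₂⟩ := h₂ (d + 1) (by omega) S σ₁
      (fun y hy => by rw [v₁ y (by omega), h y hy]) (by rw [a₁, h'])
    refine ⟨_, _, .seq e₁ (.seq e₂ .sub), ?_, ?_, ?_, ?_⟩
    · have := h₃ (S.var 0); have := h₄ (S.var 0); omega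
    · simp [Ex.eval, r₂, v₂, r₁]
    · intro y hy
      simp [hy.ne, v₂ y (by omega), v₁ y hy]
    · simp [a₂, a₁]
  | ld a e ih =>
    obtain ⟨C₁, k₁, h₁⟩ := ih he
    obtain ⟨C₄, k₄, h₄⟩ := exists_poly_bound_add_const C₁ k₁ 1
    refine ⟨C₄, k₄, fun d hd S σ h h' => ?_⟩
    obtain ⟨τ₁, σ₁, e₁, t₁, r₁, v₁, a₁⟩ := h₁ d hd S σ h h'
    refine ⟨_, _, .seq e₁ .load, ?_, ?_, ?_, ?_⟩
    · have := h₄ (S.var 0); omega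
    · simp [Ex.eval, r₁, a₁, h']
    · intro y hy
      simp [hy.ne, v₁ y hy]
    · simp [a₁]
  | cond c a b ihc iha ihb =>
    simp only [Ex.ok, Bool.and_eq_true] at he
    obtain ⟨C₀, k₀, h₀⟩ := ihc he.1
    obtain ⟨C₁, k₁, h₁⟩ := iha he.2.1
    obtain ⟨C₂, k₂, h₂⟩ := ihb he.2.2
    obtain ⟨C₃, k₃, h₃⟩ := exists_poly_bound C₁ k₁ C₂ k₂
    obtain ⟨C₄, k₄, h₄⟩ := exists_poly_bound C₃ k₃ C₀ k₀
    obtain ⟨C₅, k₅, h₅⟩ := exists_poly_bound_add_const C₄ k₄ 1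
    refine ⟨C₅, k₅, fun d hd S σ h h' => ?_⟩
    have := h₃ (S.var 0); have := h₄ (S.var 0); have := h₅ (S.var 0)
    obtain ⟨τ₀, σ₀, e₀, t₀, r₀, v₀, a₀⟩ := h₀ d hd S σ h h'
    by_cases hc : c.eval S = 0
    · obtain ⟨τ₂, σ₂, e₂, t₂, r₂, v₂, a₂⟩ := h₂ d hd S σ₀
        (fun y hy => by rw [v₀ y (by omega), h y hy]) (by rw [a₀, h'])
      refine ⟨_, _, .seq e₀ (.ite_false (by rw [r₀, hc]) e₂), by omega, ?_, ?_, ?_⟩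
      · simp [Ex.eval, r₂, hc]
      · intro y hy; rw [v₂ y hy, v₀ y hy]
      · rw [a₂, a₀]
    · obtain ⟨τ₂, σ₂, e₂, t₂, r₂, v₂, a₂⟩ := h₁ d hd S σ₀
        (fun y hy => by rw [v₀ y (by omega), h y hy]) (by rw [a₀, h'])
      refine ⟨_, _, .seq e₀ (.ite_true (by rwa [r₀]) e₂), by omega, ?_, ?_, ?_⟩
      · simp [Ex.eval, r₂, hc]
      · intro y hy; rw [v₂ y hy, v₀ y hy]
      · rw [a₂, a₀]
  | sum x e ih =>
    simp only [Ex.ok, Bool.and_eq_true, decide_eq_true_eq] at he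
    obtain ⟨C, k, h₁⟩ := ih he.2.2
    refine ⟨C + 1 + 11, k + 1, fun d hd S σ h h' => ?_⟩
    obtain ⟨τ, σ', e1, t, r, v, a⟩ := exec_fold (D := D) (x := x) (d := d) (p := e.compile (d + 3))
      (q := .add d d (d + 3)) (op := fun r c => r + c) (f := fun j => e.eval (S.setVar x j))
      (S := S) (σ := σ) (K := C * (S.var 0 + 1) ^ k) (Kq := 1) hd he.1 he.2.1 rfl
      (fun j σ g g' => by
        obtain ⟨τ, σ', e1, t, r, v, a⟩ := h₁ (d + 3) (by omega) (S.setVar x j) σ g g'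
        exact ⟨τ, σ', e1, by simpa [show 0 ≠ x by omega] using t, r, v, a⟩)
      (fun σ => ⟨_, .add, by simp, fun y _ hy => by simp [hy], rfl⟩) h h'
    refine ⟨τ, σ', e1, t.trans (fold_bound _ _ _ _), ?_, v, a⟩
    rw [r]; exact op_rec_sum _ _
  | mx x e ih =>
    simp only [Ex.ok, Bool.and_eq_true, decide_eq_true_eq] at he
    obtain ⟨C, k, h₁⟩ := ih he.2.2
    refine ⟨C + 2 + 11, k + 1, fun d hd S σ h h' => ?_⟩
    obtain ⟨τ, σ', e1, t, r, v, a⟩ := exec_fold (D := D) (x := x) (d := d) (p := e.compile (d + 3))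
      (q := .seq (.sub (d + 3) (d + 3) d) (.add d d (d + 3))) (op := fun r c => r + (c - r))
      (f := fun j => e.eval (S.setVar x j))
      (S := S) (σ := σ) (K := C * (S.var 0 + 1) ^ k) (Kq := 2) hd he.1 he.2.1 rfl
      (fun j σ g g' => by
        obtain ⟨τ, σ', e1, t, r, v, a⟩ := h₁ (d + 3) (by omega) (S.setVar x j) σ g g'
        exact ⟨τ, σ', e1, by simpa [show 0 ≠ x by omega] using t, r, v, a⟩)
      (fun σ => ⟨_, .seq .sub .add, by simp, fun y hy hy' => by simp [hy', hy.ne], rfl⟩) h h'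
    refine ⟨τ, σ', e1, t.trans (fold_bound _ _ _ _), ?_, v, a⟩
    rw [r]; exact op_rec_sup _ _

/-- Statements: assignment to a variable and to an array cell, sequential composition, conditional,
and `each x s`, which repeats `s` for all `x < n`, where `n` is the content of variable `0`. -/
inductive St where
  | assign (x : ℕ) (e : Ex) : St
  | store (a : ℕ) (i e : Ex) : St
  | seq (s s' : St) : St
  | ite (c : Ex) (s : St) : St
  | each (x : ℕ) (s : St) : St

/-- Iterate `f 0`, `f 1`, ..., `f (m - 1)`. -/
def iter (f : ℕ → State → State) : ℕ → State → State
  | 0, S => S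
  | j + 1, S => f j (iter f j S)

/-- The effect of a statement on the memory. -/
def St.run : St → State → State
  | .assign x e, S => S.setVar x (e.eval S)
  | .store a i e, S => S.setArr a (i.eval S) (e.eval S)
  | .seq s s', S => s'.run (s.run S)
  | .ite c s, S => if c.eval S ≠ 0 then s.run S else S
  | .each x s, S => iter (fun j S => s.run (S.setVar x j)) (S.var 0) S

/-- All variables of the statement are below `D`, and variable `0` is not assigned to. -/
def St.ok (D : ℕ) : St → Bool
  | .assign x e => decide (0 < x) && (decide (x < D) && e.ok D)
  | .store _ i e => i.ok D && e.ok D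
  | .seq s s' => s.ok D && s'.ok D
  | .ite c s => c.ok D && s.ok D
  | .each x s => decide (0 < x) && (decide (x < D) && s.ok D)

/-- The machine code of a statement; it uses variables from `d` on for intermediate results. -/
def St.compile : St → ℕ → Prog
  | .assign x e, d => .seq (e.compile d) (.seq (.const (d + 1) 0) (.add x d (d + 1)))
  | .store a i e, d => .seq (i.compile d) (.seq (e.compile (d + 1)) (.store a d (d + 1)))
  | .seq s s', d => .seq (s.compile d) (s'.compile d)
  | .ite c s, d => .seq (c.compile d) (.ite d (s.compile d) .skip)
  | .each x s, d =>
    .seq (.seq (.const d 0) (.add (d + 1) 0 d))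
      (.loop (d + 1) (.seq (.seq (.const (d + 2) 0) (.add x d (d + 2))) (.seq (s.compile (d + 2))
        (.seq (.const (d + 2) 1) (.seq (.add d d (d + 2)) (.sub (d + 1) (d + 1) (d + 2)))))))

/-- The variables a statement may change. -/
def St.vars : St → List ℕ
  | .assign x _ => [x]
  | .store _ _ _ => []
  | .seq s s' => s.vars ++ s'.vars
  | .ite _ s => s.vars
  | .each x s => x :: s.vars

/-- The arrays a statement may change. -/
def St.arrs : St → List ℕ
  | .assign _ _ => []
  | .store a _ _ => [a]
  | .seq s s' => s.arrs ++ s'.arrs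
  | .ite _ s => s.arrs
  | .each _ s => s.arrs

theorem iter_inv {f : ℕ → State → State} {m : ℕ} {S : State} (I : ℕ → State → Prop) (h0 : I 0 S)
    (step : ∀ j S, j < m → I j S → I (j + 1) (f j S)) : I m (iter f m S) := by
  suffices h : ∀ j ≤ m, I j (iter f j S) from h m le_rfl
  intro j
  induction j with
  | zero => exact fun _ => h0
  | succ j ih => exact fun hj => step j _ hj (ih (by omega))

theorem St.run_var {s : St} {x : ℕ} (hx : x ∉ s.vars) (S : State) :
    (s.run S).var x = S.var x := by
  induction s generalizing S with
  | assign y e => simp_all [St.vars, St.run]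
  | store a i e => rfl
  | seq s s' ih ih' =>
    simp only [St.vars, List.mem_append, not_or] at hx
    simp [St.run, ih hx.1, ih' hx.2]
  | ite c s ih =>
    simp only [St.run]
    split
    · exact ih hx S
    · rfl
  | each y s ih =>
    simp only [St.vars, List.mem_cons, not_or] at hx
    refine iter_inv (fun _ S' => S'.var x = S.var x) rfl fun j S' _ h => ?_
    rw [ih hx.2, State.setVar_var, if_neg hx.1, h]

theorem St.run_arr {s : St} {a : ℕ} (ha : a ∉ s.arrs) (S : State) :
    (s.run S).arr a = S.arr a := by
  induction s generalizing S with
  | assign y e => rfl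
  | store b i e => simp_all [St.arrs, St.run]
  | seq s s' ih ih' =>
    simp only [St.arrs, List.mem_append, not_or] at ha
    simp [St.run, ih ha.1, ih' ha.2]
  | ite c s ih =>
    simp only [St.run]
    split
    · exact ih ha S
    · rfl
  | each y s ih =>
    refine iter_inv (fun _ S' => S'.arr a = S.arr a) rfl fun j S' _ h => ?_
    rw [ih ha, State.setVar_arr, h]

theorem St.zero_notMem_vars {s : St} {D : ℕ} (hs : s.ok D) : 0 ∉ s.vars := by
  induction s with
  | assign y e => simp [St.ok, St.vars] at *; omega
  | store a i e => simp [St.vars]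
  | seq s s' ih ih' => simp_all [St.ok, St.vars]
  | ite c s ih => simp_all [St.ok, St.vars]
  | each y s ih =>
    simp only [St.ok, Bool.and_eq_true, decide_eq_true_eq] at hs
    simp only [St.vars, List.mem_cons, not_or]
    exact ⟨by omega, ih hs.2.2⟩

/-- The compiled code of a statement has the effect of the statement, and runs in time polynomial
in `n`. -/
theorem St.exec_compile {D : ℕ} (s : St) (hs : s.ok D) :
    ∃ C k, ∀ d ≥ D, ∀ S σ : State, (∀ y < D, σ.var y = S.var y) → σ.arr = S.arr →
      ∃ τ σ', Exec (s.compile d) σ τ σ' ∧ τ ≤ C * (S.var 0 + 1) ^ k ∧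
        (∀ y < D, σ'.var y = (s.run S).var y) ∧ (∀ y, D ≤ y → y < d → σ'.var y = σ.var y) ∧
        σ'.arr = (s.run S).arr := by
  induction s with
  | assign x e =>
    simp only [St.ok, Bool.and_eq_true, decide_eq_true_eq] at hs
    obtain ⟨C₁, k₁, h₁⟩ := e.exec_compile hs.2.2
    obtain ⟨C₄, k₄, h₄⟩ := exists_poly_bound_add_const C₁ k₁ 2
    refine ⟨C₄, k₄, fun d hd S σ h h' => ?_⟩
    obtain ⟨τ₁, σ₁, e₁, t₁, r₁, v₁, a₁⟩ := h₁ d hd S σ h h'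
    refine ⟨_, _, .seq e₁ (.seq .const .add), ?_, ?_, ?_, ?_⟩
    · have := h₄ (S.var 0); omega
    · intro y hy
      simp [St.run, r₁, show y ≠ d + 1 by omega, v₁ y (by omega), h y hy]
    · intro y hy hyd
      simp [show y ≠ d + 1 by omega, show y ≠ x by omega, v₁ y hyd]
    · simp [a₁, St.run, h']
  | store a i e =>
    simp only [St.ok, Bool.and_eq_true] at hs
    obtain ⟨C₁, k₁, h₁⟩ := i.exec_compile hs.1
    obtain ⟨C₂, k₂, h₂⟩ := e.exec_compile hs.2
    obtain ⟨C₃, k₃, h₃⟩ := exists_poly_bound C₁ k₁ C₂ k₂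
    obtain ⟨C₄, k₄, h₄⟩ := exists_poly_bound_add_const C₃ k₃ 1
    refine ⟨C₄, k₄, fun d hd S σ h h' => ?_⟩
    obtain ⟨τ₁, σ₁, e₁, t₁, r₁, v₁, a₁⟩ := h₁ d hd S σ h h'
    obtain ⟨τ₂, σ₂, e₂, t₂, r₂, v₂, a₂⟩ := h₂ (d + 1) (by omega) S σ₁
      (fun y hy => by rw [v₁ y (by omega), h y hy]) (by rw [a₁, h'])
    refine ⟨_, _, .seq e₁ (.seq e₂ .store), ?_, ?_, ?_, ?_⟩
    · have := h₃ (S.var 0); have := h₄ (S.var 0); omega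
    · intro y hy
      simp [St.run, v₂ y (by omega), v₁ y (by omega), h y hy]
    · intro y hy hyd
      simp [v₂ y (by omega), v₁ y (by omega)]
    · simp [State.setArr, St.run, a₂, a₁, h', v₂ d (by omega), r₁, r₂]
  | seq s s' ih ih' =>
    simp only [St.ok, Bool.and_eq_true] at hs
    obtain ⟨C₁, k₁, h₁⟩ := ih hs.1
    obtain ⟨C₂, k₂, h₂⟩ := ih' hs.2
    obtain ⟨C₃, k₃, h₃⟩ := exists_poly_bound C₁ k₁ C₂ k₂
    refine ⟨C₃, k₃, fun d hd S σ h h' => ?_⟩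
    obtain ⟨τ₁, σ₁, e₁, t₁, v₁, w₁, a₁⟩ := h₁ d hd S σ h h'
    obtain ⟨τ₂, σ₂, e₂, t₂, v₂, w₂, a₂⟩ := h₂ d hd (s.run S) σ₁ v₁ a₁
    rw [St.run_var (St.zero_notMem_vars hs.1)] at t₂
    refine ⟨_, _, .seq e₁ e₂, ?_, v₂, ?_, a₂⟩
    · have := h₃ (S.var 0); omega
    · intro y hy hyd
      rw [w₂ y hy hyd, w₁ y hy hyd]
  | ite c s ih =>
    simp only [St.ok, Bool.and_eq_true] at hs
    obtain ⟨C₁, k₁, h₁⟩ := c.exec_compile hs.1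
    obtain ⟨C₂, k₂, h₂⟩ := ih hs.2
    obtain ⟨C₃, k₃, h₃⟩ := exists_poly_bound C₁ k₁ C₂ k₂
    obtain ⟨C₄, k₄, h₄⟩ := exists_poly_bound_add_const C₃ k₃ 2
    refine ⟨C₄, k₄, fun d hd S σ h h' => ?_⟩
    have := h₃ (S.var 0); have := h₄ (S.var 0)
    obtain ⟨τ₁, σ₁, e₁, t₁, r₁, v₁, a₁⟩ := h₁ d hd S σ h h'
    by_cases hc : c.eval S = 0
    · refine ⟨_, _, .seq e₁ (.ite_false (by rw [r₁, hc]) .skip), by omega, ?_, ?_, ?_⟩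
      · intro y hy; simp [St.run, hc, v₁ y (by omega), h y hy]
      · intro y hy hyd; rw [v₁ y hyd]
      · simp [St.run, hc, a₁, h']
    · obtain ⟨τ₂, σ₂, e₂, t₂, v₂, w₂, a₂⟩ := h₂ d hd S σ₁
        (fun y hy => by rw [v₁ y (by omega), h y hy]) (by rw [a₁, h'])
      refine ⟨_, _, .seq e₁ (.ite_true (by rwa [r₁]) e₂), by omega, ?_, ?_, ?_⟩
      · intro y hy; simp [St.run, hc, v₂ y hy]
      · intro y hy hyd; rw [w₂ y hy hyd, v₁ y hyd]
      · simp [St.run, hc, a₂]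
  | each x s ih =>
    simp only [St.ok, Bool.and_eq_true, decide_eq_true_eq] at hs
    obtain ⟨hx0, hxD, hs⟩ := hs
    obtain ⟨C, k, h₁⟩ := ih hs
    refine ⟨C + 10, k + 1, fun d hd S σ h h' => ?_⟩
    have e1 : Exec (.seq (.const d 0) (.add (d + 1) 0 d)) σ (1 + 1) _ := .seq .const .add
    set f : ℕ → State → State := fun j S => s.run (S.setVar x j) with hf
    have hv0 : ∀ j, (iter f j S).var 0 = S.var 0 := fun j =>
      iter_inv (fun _ S' => S'.var 0 = S.var 0) rfl fun j S' _ h => by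
        rw [hf]
        simp only
        rw [St.run_var (St.zero_notMem_vars hs), State.setVar_var, if_neg (by omega), h]
    obtain ⟨τ, σ₂, e2, t2, ⟨i1, i2, i3, i4⟩, -⟩ := exec_countdown (y := d + 1)
      (p := .seq (.seq (.const (d + 2) 0) (.add x d (d + 2))) (.seq (s.compile (d + 2))
        (.seq (.const (d + 2) 1) (.seq (.add d d (d + 2)) (.sub (d + 1) (d + 1) (d + 2))))))
      (N := S.var 0) (K := C * (S.var 0 + 1) ^ k + 5)
      (fun j σ' => σ'.var d = j ∧ (∀ y < D, σ'.var y = (iter f j S).var y) ∧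
        (∀ y, D ≤ y → y < d → σ'.var y = σ.var y) ∧ σ'.arr = (iter f j S).arr)
      (by
        rintro j σ' hj ⟨i1, i2, i3, i4⟩ hy
        obtain ⟨τ, σ₂, e, t, a1, a2, a3⟩ := h₁ (d + 2) (by omega) ((iter f j S).setVar x j)
          ((σ'.setVar (d + 2) 0).setVar x j) (by
            intro y hy
            simp [show y ≠ d + 2 by omega, i2 y hy]) (by simp [i4])
        have e0 : Exec (.seq (.const (d + 2) 0) (.add x d (d + 2))) σ' (1 + 1)
            ((σ'.setVar (d + 2) 0).setVar x j) := by
          convert Exec.seq Exec.const Exec.add using 2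
          simp [i1]
        rw [State.setVar_var, if_neg (by omega), hv0] at t
        refine ⟨_, _, .seq e0 (.seq e (.seq .const (.seq .add .sub))), by omega,
          ⟨?_, ?_, ?_, ?_⟩, ?_⟩
        · simp [a2 d (by omega) (by omega), i1, show d ≠ x by omega]
        · intro y hy
          simp [show y ≠ d by omega, show y ≠ d + 1 by omega, show y ≠ d + 2 by omega, a1 y hy,
            iter, hf]
        · intro y hy hyd
          simp [show y ≠ d by omega, show y ≠ d + 1 by omega, show y ≠ d + 2 by omega,
            a2 y (by omega) (by omega), show y ≠ x by omega, i3 y hy hyd]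
        · simp [a3, iter, hf]
        · simp [a2 (d + 1) (by omega) (by omega), show d + 1 ≠ x by omega, hy]
          omega)
      (σ := (σ.setVar d 0).setVar (d + 1) (S.var 0)) (by
        refine ⟨by simp, ?_, ?_, by simp [iter, h']⟩
        · intro y hy
          simp [show y ≠ d by omega, show y ≠ d + 1 by omega, iter, h y hy]
        · intro y hy hyd
          simp [show y ≠ d by omega, show y ≠ d + 1 by omega])
      (by simp)
    rw [show ((σ.setVar d 0).var 0 + (σ.setVar d 0).var d) = S.var 0 by
      simp [show 0 ≠ d by omega, h 0 (by omega)]] at e1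
    refine ⟨_, _, .seq e1 e2, ?_, i2, i3, i4⟩
    have h1 : 1 ≤ (S.var 0 + 1) ^ k := Nat.one_le_pow _ _ (by omega)
    rw [pow_succ]
    generalize S.var 0 = n at *
    nlinarith [Nat.zero_le (C * (n + 1) ^ k), Nat.mul_le_mul_left n h1]

end RAM

/-! ### Schedules and the peeling of hanging trees -/

/-- A schedule that informs the vertices `0, ..., n - 1` by time `t`: the vertex `v` is informed
at time `τ v` by its parent `π v`, and two children of the same vertex are informed at different
times. In contrast to a protocol, a vertex may pause between two calls. -/
structure IsSchedule (n s t : ℕ) (adj : ℕ → ℕ → Prop) (τ π : ℕ → ℕ) : Prop where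
  adj : ∀ v < n, v ≠ s → adj (π v) v
  lt : ∀ v < n, v ≠ s → τ (π v) < τ v
  inj : ∀ u < n, ∀ v < n, u ≠ s → v ≠ s → π u = π v → τ u = τ v → u = v
  le : ∀ v < n, τ v ≤ t

/-- The hanging children of `v`: the peeled vertices (`ord c ≠ 0`) attached to `v`. -/
def kids (n : ℕ) (ord hp : ℕ → ℕ) (v : ℕ) : Finset ℕ :=
  {c ∈ Finset.range n | ord c ≠ 0 ∧ hp c = v}

/-- The number of hanging children of `v` that are at least as demanding as `c`. -/
def numAbove (n : ℕ) (ord hp b : ℕ → ℕ) (v c : ℕ) : ℕ :=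
  {c' ∈ kids n ord hp v | b c ≤ b c'}.card

/-- The time needed to inform the subtree of `c` and those of its more demanding siblings,
counted from the time when `v` gets the message. -/
def load (n : ℕ) (ord hp b : ℕ → ℕ) (v c : ℕ) : ℕ :=
  b c + numAbove n ord hp b v c

/-- The time that `v` needs to inform all its hanging trees; for a peeled `v` this is the broadcast
time of the tree hanging at `v`. -/
def need (n : ℕ) (ord hp b : ℕ → ℕ) (v : ℕ) : ℕ :=
  (kids n ord hp v).sup (load n ord hp b v)

/-- If `v` gets the message at time `r` and `x = r + i`, then this is the number of hanging
children that have to be informed before the `i`-th call of `v` to the core. -/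
def delay (n t : ℕ) (ord hp b : ℕ → ℕ) (v x : ℕ) : ℕ :=
  {c' ∈ kids n ord hp v | ∃ c ∈ kids n ord hp v, b c ≤ b c' ∧ t < load n ord hp b v c + x}.card

/-- The number of neighbours of `v` that are not peeled. -/
def coreDeg (n : ℕ) (adj : ℕ → ℕ → Prop) [DecidableRel adj] (ord : ℕ → ℕ) (v : ℕ) : ℕ :=
  {u ∈ Finset.range n | adj v u ∧ ord u = 0}.card

/-- The result of peeling: leaves other than `s` are removed one after another. `ord v` is the
number of the step in which `v` is removed (`0` if it stays in the core), `hp v` is the only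
neighbour it has at that moment, and `b v` is the broadcast time of the tree hanging at `v`. -/
structure IsPeeling (n s : ℕ) (adj : ℕ → ℕ → Prop) (ord hp b : ℕ → ℕ) : Prop where
  ord_source : ord s = 0
  ord_le : ∀ v, ord v ≤ n
  lt : ∀ v, ord v ≠ 0 → v < n
  adj_hp : ∀ v, ord v ≠ 0 → adj v (hp v)
  later : ∀ v, ord v ≠ 0 → ord (hp v) = 0 ∨ ord v < ord (hp v)
  earlier : ∀ v u, ord v ≠ 0 → adj v u → u ≠ hp v → ord u ≠ 0 ∧ ord u < ord v ∧ hp u = v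
  b_eq : ∀ v, ord v ≠ 0 → b v = need n ord hp b v

section
variable {n s t : ℕ} {adj : ℕ → ℕ → Prop} {ord hp b τ π : ℕ → ℕ}

theorem mem_kids {v c : ℕ} : c ∈ kids n ord hp v ↔ c < n ∧ ord c ≠ 0 ∧ hp c = v := by
  simp [kids]

theorem delay_mono {v x y : ℕ} (h : x ≤ y) :
    delay n t ord hp b v x ≤ delay n t ord hp b v y := by
  refine Finset.card_le_card (Finset.monotone_filter_right _ fun c' _ => ?_)
  rintro ⟨c, hc, h1, h2⟩
  exact ⟨c, hc, h1, by omega⟩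

theorem numAbove_le_delay {v c x : ℕ} (hc : c ∈ kids n ord hp v)
    (h : t < load n ord hp b v c + x) : numAbove n ord hp b v c ≤ delay n t ord hp b v x :=
  Finset.card_le_card (Finset.monotone_filter_right _ fun _ _ hc' => ⟨c, hc, hc', h⟩)

theorem one_le_numAbove {v c : ℕ} (hc : c ∈ kids n ord hp v) : 1 ≤ numAbove n ord hp b v c :=
  Finset.card_pos.2 ⟨c, by simp [hc]⟩

/-- A peeled vertex can only be informed by the vertex it hangs on. -/
theorem IsSchedule.parent_eq (hS : IsSchedule n s t adj τ π) (hP : IsPeeling n s adj ord hp b)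
    (symm : ∀ u v, adj u v → adj v u) {v : ℕ} (hv : ord v ≠ 0) : π v = hp v := by
  induction h : ord v using Nat.strong_induction_on generalizing v with
  | _ m ih =>
    have hvs : v ≠ s := fun h => hv (h ▸ hP.ord_source)
    by_contra hne
    obtain ⟨h1, h2, h3⟩ := hP.earlier v (π v) hv (symm _ _ (hS.adj v (hP.lt v hv) hvs)) hne
    have h4 : π (π v) = v := (ih _ (h ▸ h2) h1 rfl).trans h3
    have h5 := hS.lt v (hP.lt v hv) hvs
    have h6 := hS.lt (π v) (hP.lt _ h1) fun h => h1 (h ▸ hP.ord_source)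
    rw [h4] at h6
    omega

/-- The parent of a core vertex is a core vertex. -/
theorem IsSchedule.ord_parent (hS : IsSchedule n s t adj τ π) (hP : IsPeeling n s adj ord hp b)
    (symm : ∀ u v, adj u v → adj v u) {v : ℕ} (hvn : v < n) (hvs : v ≠ s) (hv : ord v = 0) :
    ord (π v) = 0 := by
  by_contra h
  have h1 : v = hp (π v) := by
    by_contra hne
    exact (hP.earlier (π v) v h (hS.adj v hvn hvs) hne).1 hv
  have h2 := hS.parent_eq hP symm h
  have h5 := hS.lt v hvn hvs
  have h6 := hS.lt (π v) (hP.lt _ h) fun h' => h (h' ▸ hP.ord_source)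
  rw [h2, ← h1] at h6
  omega

theorem IsSchedule.card_children_le (hS : IsSchedule n s t adj τ π) {v T : ℕ} {X : Finset ℕ}
    (hX : ∀ c ∈ X, c < n ∧ c ≠ s ∧ π c = v ∧ τ c ≤ T) (hT : τ v ≤ T) : τ v + X.card ≤ T := by
  have h : (X.image τ).card ≤ (Finset.Ioc (τ v) T).card := by
    refine Finset.card_le_card fun y hy => ?_
    obtain ⟨c, hc, rfl⟩ := Finset.mem_image.1 hy
    obtain ⟨h1, h2, h3, h4⟩ := hX c hc
    have := hS.lt c h1 h2
    rw [h3] at this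
    exact Finset.mem_Ioc.2 ⟨this, h4⟩
  rw [Finset.card_image_of_injOn, Nat.card_Ioc] at h
  · omega
  · intro c hc c' hc' he
    obtain ⟨h1, h2, h3, h4⟩ := hX c hc
    obtain ⟨h1', h2', h3', h4'⟩ := hX c' hc'
    exact hS.inj _ h1 _ h1' h2 h2' (h3.trans h3'.symm) he

theorem IsSchedule.kid (hS : IsSchedule n s t adj τ π) (hP : IsPeeling n s adj ord hp b)
    (symm : ∀ u v, adj u v → adj v u) {v c : ℕ} (hc : c ∈ kids n ord hp v) :
    c < n ∧ c ≠ s ∧ π c = v ∧ τ v < τ c := by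
  obtain ⟨h1, h2, h3⟩ := mem_kids.1 hc
  have h4 : c ≠ s := fun h => h2 (h ▸ hP.ord_source)
  have h5 := hS.parent_eq hP symm h2
  have h6 := hS.lt c h1 h4
  rw [h5, h3] at h6
  exact ⟨h1, h4, h5.trans h3, h6⟩

/-- Under a schedule every vertex has enough time left for its hanging trees. -/
theorem IsSchedule.need_le (hS : IsSchedule n s t adj τ π) (hP : IsPeeling n s adj ord hp b)
    (symm : ∀ u v, adj u v → adj v u) {v : ℕ} (hv : v < n) :
    τ v + need n ord hp b v ≤ t := by
  induction h : t - τ v using Nat.strong_induction_on generalizing v with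
  | _ m ih =>
    have key : ∀ c ∈ kids n ord hp v, τ c + b c ≤ t := by
      intro c hc
      obtain ⟨h1, h2, h3, h4⟩ := hS.kid hP symm hc
      rw [hP.b_eq c (mem_kids.1 hc).2.1]
      have := hS.le c h1
      exact ih _ (by omega) h1 rfl
    have h0 := hS.le v hv
    suffices hh : need n ord hp b v ≤ t - τ v by omega
    refine Finset.sup_le fun c hc => ?_
    have h1 := key c hc
    have h2 := (hS.kid hP symm hc).2.2.2
    have := hS.card_children_le (v := v) (T := t - b c) (X := {c' ∈ kids n ord hp v | b c ≤ b c'})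
      (fun c' hc' => by
        rw [Finset.mem_filter] at hc'
        obtain ⟨h1, h2, h3, h4⟩ := hS.kid hP symm hc'.1
        have := key c' hc'.1
        exact ⟨h1, h2, h3, by omega⟩) (by omega)
    have h3 := one_le_numAbove (b := b) hc
    unfold load numAbove at *
    omega

/-- The calls to the core cannot be made earlier than the hanging trees permit. -/
theorem IsSchedule.add_delay_le (hS : IsSchedule n s t adj τ π) (hP : IsPeeling n s adj ord hp b)
    (symm : ∀ u v, adj u v → adj v u) {w x : ℕ} (hwn : w < n) (hws : w ≠ s)
    (hx : x ≤ τ (π w) +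
      {u ∈ Finset.range n | ord u = 0 ∧ u ≠ s ∧ π u = π w ∧ τ u ≤ τ w}.card) :
    x + delay n t ord hp b (π w) x ≤ τ w := by
  set J := {u ∈ Finset.range n | ord u = 0 ∧ u ≠ s ∧ π u = π w ∧ τ u ≤ τ w} with hJ
  refine (Nat.add_le_add hx (delay_mono hx)).trans ?_
  set r := τ (π w)
  have hJ' : ∀ c ∈ J, c < n ∧ c ≠ s ∧ π c = π w ∧ τ c ≤ τ w := by
    intro c hc
    rw [hJ, Finset.mem_filter, Finset.mem_range] at hc
    tauto
  set Q := {c' ∈ kids n ord hp (π w) | ∃ c ∈ kids n ord hp (π w), b c ≤ b c' ∧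
    t < load n ord hp b (π w) c + (r + J.card)} with hQ
  have hdisj : ∀ K ⊆ kids n ord hp (π w), Disjoint J K := by
    intro K hK
    rw [Finset.disjoint_left]
    intro c hc hc'
    rw [hJ, Finset.mem_filter] at hc
    exact (mem_kids.1 (hK hc')).2.1 hc.2.1
  have hQ' : ∀ c ∈ Q, c < n ∧ c ≠ s ∧ π c = π w ∧ τ c ≤ τ w := by
    intro c' hc'
    rw [hQ, Finset.mem_filter] at hc'
    obtain ⟨hc', c, hc, hbc, hload⟩ := hc'
    obtain ⟨g1, g2, g3, g4⟩ := hS.kid hP symm hc'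
    refine ⟨g1, g2, g3, ?_⟩
    have key : ∀ e ∈ kids n ord hp (π w), τ e + b e ≤ t := by
      intro e he
      rw [hP.b_eq e (mem_kids.1 he).2.1]
      exact hS.need_le hP symm (mem_kids.1 he).1
    -- otherwise all of `J` and all kids above `c` are called in the interval `(r, t - b c]`,
    -- which is too short for that
    by_contra hlt
    have h1 := key c' hc'
    have h2 := hS.lt w hwn hws
    have := hS.card_children_le (v := π w) (T := t - b c)
      (X := J ∪ {e ∈ kids n ord hp (π w) | b c ≤ b e}) (fun e he => by
        rcases Finset.mem_union.1 he with he | he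
        · obtain ⟨h1, h2, h3, h4⟩ := hJ' e he
          exact ⟨h1, h2, h3, by omega⟩
        · rw [Finset.mem_filter] at he
          obtain ⟨h1, h2, h3, h4⟩ := hS.kid hP symm he.1
          have := key e he.1
          exact ⟨h1, h2, h3, by omega⟩) (by omega)
    rw [Finset.card_union_of_disjoint (hdisj _ (Finset.filter_subset _ _))] at this
    have h3 := one_le_numAbove (b := b) hc
    unfold load numAbove at *
    omega
  have := hS.card_children_le (v := π w) (T := τ w) (X := J ∪ Q) (fun c hc => by
    rcases Finset.mem_union.1 hc with hc | hc
    exacts [hJ' c hc, hQ' c hc]) (hS.lt w hwn hws).le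
  rw [Finset.card_union_of_disjoint (hdisj _ (Finset.filter_subset _ _))] at this
  exact (Nat.add_assoc _ _ _).trans_le this

/-- Jobs `c ∈ K` with deadlines `t - b c` can be executed one at a time after time `r`, avoiding the
times in `A`, if for each of them there is enough room for all jobs that are at least as urgent. -/
theorem exists_slots (K A : Finset ℕ) (b : ℕ → ℕ) (r t : ℕ)
    (h : ∀ c ∈ K, {c' ∈ K | b c ≤ b c'}.card + {a ∈ A | r < a ∧ a ≤ t - b c}.card + r ≤ t - b c) :
    ∃ f : ℕ → ℕ, Set.InjOn f K ∧ ∀ c ∈ K, r < f c ∧ f c ∉ A ∧ f c + b c ≤ t := by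
  classical
  obtain ⟨f, hf, hf'⟩ := (Finset.all_card_le_biUnion_card_iff_exists_injective
    (fun c : K => Finset.Ioc r (t - b c) \ A)).1 (by
      intro X
      rcases X.eq_empty_or_nonempty with rfl | hX
      · simp
      -- the least urgent job of `X` can use at least `|X|` slots
      obtain ⟨c, hc, hmin⟩ := Finset.exists_min_image X (fun c => b c) hX
      have h1 : X.card ≤ {c' ∈ K | b c ≤ b c'}.card := by
        rw [← Finset.card_map (Function.Embedding.subtype _) (s := X)]
        refine Finset.card_le_card fun y hy => ?_
        obtain ⟨e, he, rfl⟩ := Finset.mem_map.1 hy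
        exact Finset.mem_filter.2 ⟨e.2, hmin e he⟩
      have h2 : (Finset.Ioc r (t - b c) \ A).card ≤
          (X.biUnion fun c : K => Finset.Ioc r (t - b c) \ A).card :=
        Finset.card_le_card (Finset.subset_biUnion_of_mem (fun c : K => Finset.Ioc r (t - b c) \ A) hc)
      have h3 := Finset.card_sdiff_add_card_inter (Finset.Ioc r (t - b c)) A
      have h4 : Finset.Ioc r (t - b c) ∩ A = {a ∈ A | r < a ∧ a ≤ t - b c} := by
        ext a; simp [and_comm]
      rw [h4, Nat.card_Ioc] at h3
      have := h c c.2
      omega)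
  refine ⟨fun c => if hc : c ∈ K then f ⟨c, hc⟩ else 0, ?_, ?_⟩
  · intro c hc c' hc' he
    simp only [Finset.mem_coe] at hc hc'
    simp only [hc, hc', dif_pos] at he
    simpa using hf he
  · intro c hc
    simp only [hc, dif_pos]
    have := hf' ⟨c, hc⟩
    rw [Finset.mem_sdiff, Finset.mem_Ioc] at this
    exact ⟨this.1.1, this.2, by simp only at this; omega⟩

/-- Recursion along the map `up`, which decreases `μ` as long as `p` holds. -/
theorem exists_fix_of_measure (μ : ℕ → ℕ) (p : ℕ → Prop) [DecidablePred p] (up arr : ℕ → ℕ)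
    (F : ℕ → ℕ → ℕ) (h : ∀ c, p c → μ (up c) < μ c) :
    ∃ τ : ℕ → ℕ, ∀ c, τ c = if p c then F c (τ (up c)) else arr c := by
  let G : (c : ℕ) → ((y : ℕ) → InvImage (· < ·) μ y c → ℕ) → ℕ := fun c rec =>
    if hc : p c then F c (rec (up c) (h c hc)) else arr c
  have wf : WellFounded (InvImage (· < ·) μ) := InvImage.wf μ Nat.lt_wfRel.wf
  refine ⟨wf.fix G, fun c => ?_⟩
  rw [wf.fix_eq]
  simp only [G]
  split <;> rfl

/-- If the core can be informed in time, where each vertex `v` makes its `(i+1)`-st call to the core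
as early as its hanging trees permit, then all the graph can. -/
theorem IsPeeling.exists_schedule (hP : IsPeeling n s adj ord hp b)
    (symm : ∀ u v, adj u v → adj v u) (lt_of_adj : ∀ u v, adj u v → u < n)
    {arr cp : ℕ → ℕ} {idx : ℕ → ℕ → ℕ}
    (hle : ∀ w < n, ord w = 0 → arr w + need n ord hp b w ≤ t)
    (hord : ∀ w < n, ord w = 0 → w ≠ s → ord (cp w) = 0)
    (hadj : ∀ w < n, ord w = 0 → w ≠ s → adj (cp w) w)
    (harr : ∀ w < n, ord w = 0 → w ≠ s → arr w = arr (cp w) + idx (cp w) w + 1 +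
      delay n t ord hp b (cp w) (arr (cp w) + idx (cp w) w + 1))
    (hinj : ∀ u < n, ∀ w < n, ord u = 0 → ord w = 0 → u ≠ s → w ≠ s → cp u = cp w →
      arr u = arr w → u = w) :
    ∃ τ π, IsSchedule n s t adj τ π := by
  -- the times at which `v` calls vertices of the core
  set A : ℕ → Finset ℕ := fun v =>
    {w ∈ Finset.range n | ord w = 0 ∧ w ≠ s ∧ cp w = v}.image arr with hA
  -- the times between them at which a vertex `v` informed at time `r` can call its hanging children
  have slots : ∀ v r, ∃ f : ℕ → ℕ, r + need n ord hp b v ≤ t → (ord v = 0 → r = arr v) →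
      Set.InjOn f (kids n ord hp v) ∧
        ∀ c ∈ kids n ord hp v, r < f c ∧ f c ∉ A v ∧ f c + b c ≤ t := by
    intro v r
    by_cases h1 : r + need n ord hp b v ≤ t; swap
    · exact ⟨id, fun h => absurd h h1⟩
    by_cases h2 : ord v = 0 → r = arr v; swap
    · exact ⟨id, fun _ h => absurd h h2⟩
    obtain ⟨f, hf⟩ := exists_slots (kids n ord hp v) (A v) b r t (by
      intro c hc
      have hload : load n ord hp b v c ≤ need n ord hp b v := Finset.le_sup hc
      have hpos := one_le_numAbove (b := b) hc
      change numAbove n ord hp b v c + _ + r ≤ _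
      set W := {w ∈ Finset.range n | (ord w = 0 ∧ w ≠ s ∧ cp w = v) ∧ arr w ≤ t - b c} with hW
      have hW' : ∀ w ∈ W, (w < n ∧ ord w = 0 ∧ w ≠ s ∧ cp w = v) ∧ arr w ≤ t - b c := by
        intro w hw
        rw [hW, Finset.mem_filter, Finset.mem_range] at hw
        tauto
      have hcard : {a ∈ A v | r < a ∧ a ≤ t - b c}.card ≤ W.card := by
        refine (Finset.card_le_card fun a ha => ?_).trans (Finset.card_image_le (f := arr))
        rw [Finset.mem_filter, hA, Finset.mem_image] at ha
        obtain ⟨⟨w, hw, rfl⟩, h3, h4⟩ := ha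
        refine Finset.mem_image.2 ⟨w, ?_, rfl⟩
        rw [Finset.mem_filter] at hw
        rw [hW, Finset.mem_filter]
        exact ⟨hw.1, hw.2, h4⟩
      rcases W.eq_empty_or_nonempty with hWe | hWn
      · rw [hWe, Finset.card_empty] at hcard
        unfold load at hload
        omega
      obtain ⟨w, hw, hmax⟩ := Finset.exists_max_image W (idx v) hWn
      have hcard' : W.card ≤ idx v w + 1 := by
        rw [← Finset.card_range (idx v w + 1)]
        refine Finset.card_le_card_of_injOn (idx v)
          (fun u hu => Finset.mem_coe.2 (Finset.mem_range.2 (Nat.lt_succ_of_le (hmax u hu)))) ?_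
        intro u hu u' hu' he
        obtain ⟨⟨a1, a2, a3, a4⟩, -⟩ := hW' u hu
        obtain ⟨⟨a1', a2', a3', a4'⟩, -⟩ := hW' u' hu'
        refine hinj u a1 u' a1' a2 a2' a3 a3' (a4.trans a4'.symm) ?_
        rw [harr u a1 a2 a3, harr u' a1' a2' a3', a4, a4', he]
      obtain ⟨⟨a1, a2, a3, a4⟩, a5⟩ := hW' w hw
      have hv : ord v = 0 := a4 ▸ hord w a1 a2 a3
      have hr := h2 hv
      rw [harr w a1 a2 a3, a4, ← hr] at a5
      -- the `c`-th job cannot be postponed after the call to `w`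
      have hnot : ¬ t < load n ord hp b v c + (r + idx v w + 1) := by
        intro hlt
        have := numAbove_le_delay hc hlt
        unfold load at hlt
        omega
      unfold load at hnot
      omega)
    exact ⟨f, fun _ _ => hf⟩
  choose slot hslot using slots
  -- A hanging child is peeled before its parent, so the times are determined from the core outwards.
  have hμ : ∀ c, ord c ≠ 0 → (if ord (hp c) = 0 then 0 else n + 1 - ord (hp c)) <
      (if ord c = 0 then 0 else n + 1 - ord c) := by
    intro c hc
    have h1 := hP.ord_le c
    have h2 := hP.ord_le (hp c)
    have h3 := hP.later c hc
    rw [if_neg hc]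
    split <;> omega
  obtain ⟨τ, hτ⟩ := exists_fix_of_measure (fun c => if ord c = 0 then 0 else n + 1 - ord c)
    (fun c => ord c ≠ 0) hp arr (fun c r => slot (hp c) r c) hμ
  have hcore : ∀ c, ord c = 0 → τ c = arr c := fun c hc => by rw [hτ, if_neg (not_not.2 hc)]
  have hdead : ∀ c, ord c ≠ 0 → τ c = slot (hp c) (τ (hp c)) c := fun c hc => by
    rw [hτ, if_pos hc]
  have hneed : ∀ v < n, τ v + need n ord hp b v ≤ t := by
    intro v hv
    induction h : (if ord v = 0 then 0 else n + 1 - ord v) using Nat.strong_induction_on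
      generalizing v with
    | _ m ih =>
      by_cases hv0 : ord v = 0
      · rw [hcore v hv0]; exact hle v hv hv0
      · have h1 := ih _ (h ▸ hμ v hv0) (hp v) (lt_of_adj _ _ (symm _ _ (hP.adj_hp v hv0))) rfl
        have h2 := ((hslot (hp v) (τ (hp v))) h1 (hcore _)).2 v (mem_kids.2 ⟨hv, hv0, rfl⟩)
        rw [hdead v hv0, ← hP.b_eq v hv0]
        exact h2.2.2
  have hkid : ∀ v, v < n → ord v ≠ 0 → τ (hp v) < τ v ∧ τ v ∉ A (hp v) := by
    intro v hv hv0
    have h2 := ((hslot (hp v) (τ (hp v))) (hneed _ (lt_of_adj _ _ (symm _ _ (hP.adj_hp v hv0))))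
      (hcore _)).2 v (mem_kids.2 ⟨hv, hv0, rfl⟩)
    rw [hdead v hv0]
    exact ⟨h2.1, h2.2.1⟩
  have hmemA : ∀ w < n, ord w = 0 → w ≠ s → arr w ∈ A (cp w) := fun w h1 h2 h3 =>
    Finset.mem_image.2 ⟨w, Finset.mem_filter.2 ⟨Finset.mem_range.2 h1, h2, h3, rfl⟩, rfl⟩
  refine ⟨τ, fun v => if ord v = 0 then cp v else hp v, ?_, ?_, ?_, ?_⟩
  · intro v hv hvs
    by_cases hv0 : ord v = 0
    · simpa [hv0] using hadj v hv hv0 hvs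
    · simpa [hv0] using symm _ _ (hP.adj_hp v hv0)
  · intro v hv hvs
    by_cases hv0 : ord v = 0
    · simp only [hv0, if_true]
      rw [hcore v hv0, hcore _ (hord v hv hv0 hvs), harr v hv hv0 hvs]
      omega
    · simpa [hv0] using (hkid v hv hv0).1
  · intro u hu v hv hus hvs hpar heq
    by_cases hu0 : ord u = 0 <;> by_cases hv0 : ord v = 0
    · simp only [hu0, hv0, if_true] at hpar
      exact hinj u hu v hv hu0 hv0 hus hvs hpar (by rw [← hcore u hu0, ← hcore v hv0, heq])
    · simp only [hu0, hv0, if_true, if_false] at hpar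
      refine absurd ?_ (hkid v hv hv0).2
      rw [← hpar, ← heq, hcore u hu0]
      exact hmemA u hu hu0 hus
    · simp only [hu0, hv0, if_true, if_false] at hpar
      refine absurd ?_ (hkid u hu hu0).2
      rw [hpar, heq, hcore v hv0]
      exact hmemA v hv hv0 hvs
    · simp only [hu0, hv0, if_false] at hpar
      have h2 := ((hslot (hp u) (τ (hp u))) (hneed _ (lt_of_adj _ _ (symm _ _ (hP.adj_hp u hu0))))
        (hcore _)).1
      rw [hdead u hu0, hdead v hv0, ← hpar] at heq
      exact h2 (Finset.mem_coe.2 (mem_kids.2 ⟨hu, hu0, rfl⟩))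
        (Finset.mem_coe.2 (mem_kids.2 ⟨hv, hv0, hpar.symm⟩)) heq
  · intro v hv
    have := hneed v hv
    omega

/-- The greedy simulation informs every core vertex no later than the schedule does, if the guessed
positions `idx` of the calls to the core are those of the schedule. -/
theorem IsSchedule.simulation_le (hS : IsSchedule n s t adj τ π) (hP : IsPeeling n s adj ord hp b)
    (symm : ∀ u v, adj u v → adj v u) (lt_of_adj : ∀ u v, adj u v → u < n) (htn : t ≤ n)
    {inf arr : ℕ → ℕ} {idx : ℕ → ℕ → ℕ} (hs : inf s ≠ 0 ∧ arr s = 0)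
    (hstep : ∀ u w, w < n → inf u ≠ 0 → ord u = 0 → ord w = 0 → adj u w →
      arr u + idx u w + 1 + delay n t ord hp b u (arr u + idx u w + 1) ≤ n →
      inf w ≠ 0 ∧ arr w ≤ arr u + idx u w + 1 + delay n t ord hp b u (arr u + idx u w + 1))
    (hidx : ∀ w < n, ord w = 0 → w ≠ s → idx (π w) w + 1 ≤
      {u ∈ Finset.range n | ord u = 0 ∧ u ≠ s ∧ π u = π w ∧ τ u ≤ τ w}.card)
    {v : ℕ} (hvn : v < n) (hv : ord v = 0) : inf v ≠ 0 ∧ arr v ≤ τ v := by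
  induction h : τ v using Nat.strong_induction_on generalizing v with
  | _ m ih =>
    by_cases hvs : v = s
    · subst hvs; exact ⟨hs.1, by omega⟩
    have h1 := hS.ord_parent hP symm hvn hvs hv
    obtain ⟨i1, i2⟩ := ih _ (h ▸ hS.lt v hvn hvs) (lt_of_adj _ _ (hS.adj v hvn hvs)) h1 rfl
    have h2 := hS.add_delay_le hP symm (w := v) (x := arr (π v) + idx (π v) v + 1) hvn hvs (by
      have := hidx v hvn hv hvs
      omega)
    have h3 := hS.le v hvn
    obtain ⟨h4, h5⟩ := hstep (π v) v hvn i1 h1 hv (hS.adj v hvn hvs) (by omega)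
    exact ⟨h4, by omega⟩

/-- Positions of the calls to the core that are consistent with a given schedule. -/
theorem IsSchedule.exists_positions [DecidableRel adj] (hS : IsSchedule n s t adj τ π) (ord : ℕ → ℕ) :
    ∃ g : ℕ → ℕ → ℕ, (∀ v u, u < n → adj v u → ord u = 0 → g v u < coreDeg n adj ord v) ∧
      (∀ v, ∀ u < n, ∀ w < n, adj v u → adj v w → ord u = 0 → ord w = 0 → g v u = g v w → u = w) ∧
      ∀ w < n, ord w = 0 → w ≠ s → g (π w) w + 1 ≤
        {u ∈ Finset.range n | ord u = 0 ∧ u ≠ s ∧ π u = π w ∧ τ u ≤ τ w}.card := by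
  classical
  -- the children of `v` in their order, and then the other neighbours
  set key : ℕ → ℕ → ℕ := fun v u => if u ≠ s ∧ π u = v then τ u else t + 1 + u with hkey
  have keyinj : ∀ v, ∀ u < n, ∀ w < n, key v u = key v w → u = w := by
    intro v u hu w hw he
    simp only [hkey] at he
    have h1 := hS.le u hu
    have h2 := hS.le w hw
    split_ifs at he with h3 h4 h4
    · exact hS.inj u hu w hw h3.1 h4.1 (h3.2.trans h4.2.symm) he
    all_goals omega
  refine ⟨fun v u => {u' ∈ Finset.range n | (adj v u' ∧ ord u' = 0) ∧ key v u' < key v u}.card,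
    ?_, ?_, ?_⟩
  · intro v u hu ha ho
    refine Finset.card_lt_card ?_
    rw [Finset.ssubset_iff_of_subset]
    · exact ⟨u, by simp [hu, ha, ho], by simp⟩
    · exact Finset.monotone_filter_right _ fun x _ hx => hx.1
  · have key2 : ∀ v, ∀ u < n, ∀ w, adj v u → ord u = 0 → key v u < key v w →
        {u' ∈ Finset.range n | (adj v u' ∧ ord u' = 0) ∧ key v u' < key v u}.card <
        {u' ∈ Finset.range n | (adj v u' ∧ ord u' = 0) ∧ key v u' < key v w}.card := by
      intro v u hu w ha ho hlt
      refine Finset.card_lt_card ?_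
      rw [Finset.ssubset_iff_of_subset]
      · exact ⟨u, by simp [hu, ha, ho, hlt], by simp⟩
      · exact Finset.monotone_filter_right _ fun x _ hx => ⟨hx.1, hx.2.trans hlt⟩
    intro v u hu w hw ha ha' ho ho' he
    rcases lt_trichotomy (key v u) (key v w) with h | h | h
    · exact absurd he (key2 v u hu w ha ho h).ne
    · exact keyinj v u hu w hw h
    · exact absurd he (key2 v w hw u ha' ho' h).ne'
  · intro w hw ho hws
    simp only
    have hkw : key (π w) w = τ w := by simp [hkey, hws]
    have hwmem : w ∉ {u' ∈ Finset.range n | (adj (π w) u' ∧ ord u' = 0) ∧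
        key (π w) u' < key (π w) w} := by simp
    rw [← Finset.card_insert_of_notMem hwmem]
    refine Finset.card_le_card fun u hu => ?_
    rw [Finset.mem_insert] at hu
    rcases hu with rfl | hu
    · simp [hw, ho, hws]
    · rw [Finset.mem_filter, Finset.mem_range] at hu
      obtain ⟨h1, ⟨h2, h3⟩, h4⟩ := hu
      rw [hkw] at h4
      have := hS.le w hw
      simp only [hkey] at h4
      rw [Finset.mem_filter, Finset.mem_range]
      split_ifs at h4 with h5
      · exact ⟨h1, h3, h5.1, h5.2, h4.le⟩
      · omega

end

/-! ### One step of peeling -/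

section
variable {n s t : ℕ} {adj : ℕ → ℕ → Prop} {ord hp b : ℕ → ℕ}

theorem need_congr {ord' hp' b' : ℕ → ℕ} {w : ℕ}
    (hk : ∀ c, (ord' c ≠ 0 ∧ hp' c = w) ↔ (ord c ≠ 0 ∧ hp c = w))
    (hb : ∀ c, ord c ≠ 0 → hp c = w → b' c = b c) :
    need n ord' hp' b' w = need n ord hp b w := by
  have h1 : kids n ord' hp' w = kids n ord hp w := by
    simp only [kids, hk]
  have hb' : ∀ c ∈ kids n ord hp w, b' c = b c := fun c hc =>
    hb c (mem_kids.1 hc).2.1 (mem_kids.1 hc).2.2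
  unfold need
  rw [h1]
  refine Finset.sup_congr rfl fun c hc => ?_
  unfold load numAbove
  rw [h1, hb' c hc, Finset.filter_congr fun c' hc' => by rw [hb' c' hc']]

/-- Removing a leaf `v` of the graph that is left. -/
theorem IsPeeling.step (hP : IsPeeling n s adj ord hp b) (symm : ∀ u v, adj u v → adj v u)
    (irrefl : ∀ v, ¬ adj v v) {j v u : ℕ} (hj : j < n)
    (hle : ∀ w, ord w ≤ j) (hv : v < n) (hvs : v ≠ s) (hv0 : ord v = 0) (hu : adj v u)
    (hu0 : ord u = 0) (huniq : ∀ u', adj v u' → ord u' = 0 → u' = u) :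
    IsPeeling n s adj (Function.update ord v (j + 1)) (Function.update hp v u)
      (Function.update b v (need n ord hp b v)) := by
  have huv : u ≠ v := fun h => irrefl v (h ▸ hu)
  have hneed : ∀ w, w ≠ u → need n (Function.update ord v (j + 1)) (Function.update hp v u)
      (Function.update b v (need n ord hp b v)) w = need n ord hp b w := by
    intro w hw
    refine need_congr (fun c => ?_) (fun c hc hcw => ?_)
    · by_cases h : c = v
      · subst h; simp [hv0, hw.symm]
      · simp [h]
    · rw [Function.update_of_ne]
      rintro rfl
      exact hc hv0
  have hdead : ∀ w, Function.update ord v (j + 1) w ≠ 0 → w = v ∨ w ≠ v ∧ ord w ≠ 0 := by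
    intro w hw
    by_cases h : w = v
    · exact Or.inl h
    · rw [Function.update_of_ne h] at hw; exact Or.inr ⟨h, hw⟩
  refine ⟨?_, ?_, ?_, ?_, ?_, ?_, ?_⟩
  · rw [Function.update_of_ne hvs.symm]; exact hP.ord_source
  · intro w
    by_cases h : w = v
    · subst h; simpa using hj
    · rw [Function.update_of_ne h]; exact hP.ord_le w
  · intro w hw
    rcases hdead w hw with rfl | ⟨-, h⟩
    exacts [hv, hP.lt w h]
  · intro w hw
    rcases hdead w hw with rfl | ⟨h', h⟩
    · simpa using hu
    · rw [Function.update_of_ne h']; exact hP.adj_hp w h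
  · intro w hw
    rcases hdead w hw with rfl | ⟨h', h⟩
    · simp [huv, hu0]
    · rw [Function.update_of_ne h', Function.update_of_ne h']
      by_cases h2 : hp w = v
      · right; rw [h2, Function.update_self]; exact Nat.lt_succ_of_le (hle w)
      · rw [Function.update_of_ne h2]; exact hP.later w h
  · intro w x hw hx hne
    rcases hdead w hw with rfl | ⟨h', h⟩
    · rw [Function.update_self] at hne
      have hxw : x ≠ w := fun h => irrefl w (h ▸ hx)
      have hx0 : ord x ≠ 0 := fun h => hne (huniq x hx h)
      simp only [Function.update_of_ne hxw, Function.update_self]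
      refine ⟨hx0, Nat.lt_succ_of_le (hle x), ?_⟩
      by_contra hh
      exact (hP.earlier x w hx0 (symm _ _ hx) (Ne.symm hh)).1 hv0
    · rw [Function.update_of_ne h'] at hne
      obtain ⟨h1, h2, h3⟩ := hP.earlier w x h hx hne
      have hxv : x ≠ v := fun h => h1 (h ▸ hv0)
      simp only [Function.update_of_ne hxv, Function.update_of_ne h']
      exact ⟨h1, h2, h3⟩
  · intro w hw
    rcases hdead w hw with rfl | ⟨h', h⟩
    · rw [hneed w huv.symm, Function.update_self]
    · rw [hneed w fun h2 => h (h2 ▸ hu0), Function.update_of_ne h']; exact hP.b_eq w h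

/-! ### The greedy simulation -/

/-- The time of the call from `u` to `w` if `u` got the message at time `arr u`, and the call is the
`(g u w + 1)`-st call of `u` to the core. -/
def call (n t : ℕ) (ord hp b : ℕ → ℕ) (g : ℕ → ℕ → ℕ) (arr : ℕ → ℕ) (u w : ℕ) : ℕ :=
  arr u + g u w + 1 + delay n t ord hp b u (arr u + g u w + 1)

/-- The invariant of the simulation of the core: all calls up to time `T`, and those at time
`T + 1` between pairs from `Q`, have been taken into account. Here `inf v ≠ 0` says that `v` is
informed, `arr v` is the time, and `cp v` the vertex from which it got the message. -/
structure SimInv (n s t : ℕ) (adj : ℕ → ℕ → Prop) (ord hp b : ℕ → ℕ) (g : ℕ → ℕ → ℕ)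
    (Q : ℕ → ℕ → Prop) (T : ℕ) (inf arr cp : ℕ → ℕ) : Prop where
  source : inf s ≠ 0 ∧ arr s = 0
  info : ∀ w, inf w ≠ 0 → w < n ∧ ord w = 0 ∧ arr w ≤ T + 1
  par : ∀ w, inf w ≠ 0 → w ≠ s →
    inf (cp w) ≠ 0 ∧ adj (cp w) w ∧ arr w = call n t ord hp b g arr (cp w) w
  done : ∀ u w, inf u ≠ 0 → ord w = 0 → adj u w → (call n t ord hp b g arr u w ≤ T ∨
    call n t ord hp b g arr u w = T + 1 ∧ Q u w) →
    inf w ≠ 0 ∧ arr w ≤ call n t ord hp b g arr u w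

variable {g : ℕ → ℕ → ℕ} {Q Q' : ℕ → ℕ → Prop} {T : ℕ} {inf arr cp : ℕ → ℕ}

/-- When all pairs have been treated, the next round starts. -/
theorem SimInv.next_round (h : SimInv n s t adj ord hp b g Q T inf arr cp)
    (hQ : ∀ u w, adj u w → Q u w) (hQ' : ∀ u w, adj u w → ¬ Q' u w) :
    SimInv n s t adj ord hp b g Q' (T + 1) inf arr cp := by
  refine ⟨h.source, fun w hw => ?_, h.par, fun u w hu hw ha hc => h.done u w hu hw ha ?_⟩
  · obtain ⟨h1, h2, h3⟩ := h.info w hw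
    exact ⟨h1, h2, by omega⟩
  · rcases hc with hc | hc
    · rcases Nat.le_succ_iff.1 hc with h1 | h1
      · exact Or.inl h1
      · exact Or.inr ⟨h1, hQ u w ha⟩
    · exact absurd hc.2 (hQ' u w ha)

/-- The pair `(u₀, w₀)` is treated, and there is no call. -/
theorem SimInv.no_call (h : SimInv n s t adj ord hp b g Q T inf arr cp) {u₀ w₀ : ℕ}
    (hQ : ∀ u w, adj u w → Q' u w → Q u w ∨ u = u₀ ∧ w = w₀)
    (hno : ¬ (inf u₀ ≠ 0 ∧ inf w₀ = 0 ∧ adj u₀ w₀ ∧ ord w₀ = 0 ∧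
      call n t ord hp b g arr u₀ w₀ = T + 1)) :
    SimInv n s t adj ord hp b g Q' T inf arr cp := by
  refine ⟨h.source, h.info, h.par, fun u w hu hw ha hc => ?_⟩
  rcases hc with hc | ⟨hc, hc'⟩
  · exact h.done u w hu hw ha (Or.inl hc)
  rcases hQ u w ha hc' with h1 | ⟨rfl, rfl⟩
  · exact h.done u w hu hw ha (Or.inr ⟨hc, h1⟩)
  · have hw' : inf w ≠ 0 := fun h0 => hno ⟨hu, h0, ha, hw, hc⟩
    exact ⟨hw', hc ▸ (h.info w hw').2.2⟩

/-- The pair `(u₀, w₀)` is treated, and there is a call. -/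
theorem SimInv.do_call (h : SimInv n s t adj ord hp b g Q T inf arr cp) {u₀ w₀ : ℕ}
    (hQ : ∀ u w, adj u w → Q' u w → Q u w ∨ u = u₀ ∧ w = w₀)
    (hw₀ : w₀ < n) (hu : inf u₀ ≠ 0) (hw : inf w₀ = 0) (ha : adj u₀ w₀) (ho : ord w₀ = 0)
    (hc : call n t ord hp b g arr u₀ w₀ = T + 1) :
    SimInv n s t adj ord hp b g Q' T (Function.update inf w₀ 1) (Function.update arr w₀ (T + 1))
      (Function.update cp w₀ u₀) := by
  have hne : ∀ u, inf u ≠ 0 → u ≠ w₀ := fun u hu h0 => hu (h0 ▸ hw)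
  have hcall : ∀ u w, u ≠ w₀ → call n t ord hp b g (Function.update arr w₀ (T + 1)) u w =
      call n t ord hp b g arr u w := by
    intro u w hu
    simp only [call, Function.update_of_ne hu]
  have hinf : ∀ w, inf w ≠ 0 → Function.update inf w₀ 1 w ≠ 0 := by
    intro w hw
    rwa [Function.update_of_ne (hne w hw)]
  refine ⟨?_, ?_, ?_, ?_⟩
  · have := hne s h.source.1
    simpa only [Function.update_of_ne this] using h.source
  · intro w hw'
    by_cases hww : w = w₀
    · subst hww
      exact ⟨hw₀, ho, by simp⟩
    · rw [Function.update_of_ne hww] at hw' ⊢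
      exact h.info w hw'
  · intro w hw' hws
    by_cases hww : w = w₀
    · subst hww
      simp only [Function.update_self]
      exact ⟨hinf _ hu, ha, by rw [hcall _ _ (hne _ hu), hc]⟩
    · rw [Function.update_of_ne hww] at hw'
      rw [Function.update_of_ne hww, Function.update_of_ne hww]
      obtain ⟨h1, h2, h3⟩ := h.par w hw' hws
      exact ⟨hinf _ h1, h2, by rw [hcall _ _ (hne _ h1), h3]⟩
  · intro u w hu' how haw hcw
    by_cases huw : u = w₀
    · -- the new vertex makes no call before time `T + 2`
      subst huw
      simp only [call, Function.update_self] at hcw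
      omega
    · rw [Function.update_of_ne huw] at hu'
      rw [hcall _ _ huw] at hcw ⊢
      by_cases hww : w = w₀
      · subst hww
        rw [Function.update_self, Function.update_self]
        refine ⟨one_ne_zero, ?_⟩
        rcases hcw with hcw | hcw
        · exact absurd hw (h.done u w hu' how haw (Or.inl hcw)).1
        · omega
      · rw [Function.update_of_ne hww, Function.update_of_ne hww]
        rcases hcw with hcw | ⟨hcw, hcw'⟩
        · exact h.done u w hu' how haw (Or.inl hcw)
        rcases hQ u w haw hcw' with h1 | ⟨rfl, rfl⟩
        · exact h.done u w hu' how haw (Or.inr ⟨hcw, h1⟩)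
        · exact absurd rfl hww

/-- What the algorithm tests after the simulation: all core vertices are informed early enough,
and no vertex has called two others at the same time. -/
def Accepts (n s t : ℕ) (ord hp b : ℕ → ℕ) (inf arr cp : ℕ → ℕ) : Prop :=
  (∀ v < n, ord v = 0 → inf v ≠ 0 ∧ arr v + need n ord hp b v ≤ t) ∧
  ∀ v < n, ∀ w < n, v ≠ s → w ≠ s → ord v = 0 → ord w = 0 → cp v = cp w → arr v = arr w → v = w

/-- If the test is passed, then there is a schedule, whatever the guess was. -/
theorem SimInv.exists_schedule (h : SimInv n s t adj ord hp b g Q T inf arr cp)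
    (hP : IsPeeling n s adj ord hp b) (symm : ∀ u v, adj u v → adj v u)
    (lt_of_adj : ∀ u v, adj u v → u < n) (hacc : Accepts n s t ord hp b inf arr cp) :
    ∃ τ π, IsSchedule n s t adj τ π := by
  refine hP.exists_schedule symm lt_of_adj (arr := arr) (cp := cp) (idx := g)
    (fun w hw hw0 => (hacc.1 w hw hw0).2) ?_ ?_ ?_ ?_
  · intro w hw hw0 hws
    exact (h.info _ (h.par w (hacc.1 w hw hw0).1 hws).1).2.1
  · intro w hw hw0 hws
    exact (h.par w (hacc.1 w hw hw0).1 hws).2.1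
  · intro w hw hw0 hws
    exact (h.par w (hacc.1 w hw hw0).1 hws).2.2
  · intro u hu w hw hu0 hw0 hus hws
    exact hacc.2 u hu w hw hus hws hu0 hw0

/-- A vertex of the core that may have more than one child in the core. -/
def IsBranch (n s : ℕ) (adj : ℕ → ℕ → Prop) [DecidableRel adj] (ord : ℕ → ℕ) (v : ℕ) : Prop :=
  v = s ∨ 3 ≤ coreDeg n adj ord v

/-- The guess `g` fits the schedule `τ, π`: the position of the call from `π w` to `w` is not
larger than it is in the schedule. Two calls of a vertex of core degree at most `2`, one of whose
neighbours is its parent, need not be told apart. -/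
def Fits (n s : ℕ) (adj : ℕ → ℕ → Prop) [DecidableRel adj] (ord τ π : ℕ → ℕ) (g : ℕ → ℕ → ℕ) :
    Prop :=
  (∀ v < n, IsBranch n s adj ord v → ord v = 0 →
    ∀ u < n, ∀ w < n, adj v u → adj v w → ord u = 0 → ord w = 0 → g v u = g v w → u = w) ∧
  ∀ w < n, ord w = 0 → w ≠ s → g (π w) w + 1 ≤
    {u ∈ Finset.range n | ord u = 0 ∧ u ≠ s ∧ π u = π w ∧ τ u ≤ τ w}.card

/-- If the guess fits a schedule, then the test is passed. -/
theorem SimInv.accepts [DecidableRel adj] {τ π : ℕ → ℕ}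
    (h : SimInv n s t adj ord hp b g Q n inf arr cp)
    (hP : IsPeeling n s adj ord hp b) (symm : ∀ u v, adj u v → adj v u)
    (lt_of_adj : ∀ u v, adj u v → u < n) (htn : t ≤ n)
    (hS : IsSchedule n s t adj τ π) (hg : Fits n s adj ord τ π g) :
    Accepts n s t ord hp b inf arr cp := by
  have key : ∀ v < n, ord v = 0 → inf v ≠ 0 ∧ arr v ≤ τ v := fun v hv hv0 =>
    hS.simulation_le hP symm lt_of_adj htn h.source
      (fun u w _ hu _ ho ha hc => h.done u w hu ho ha (Or.inl hc)) hg.2 hv hv0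
  refine ⟨fun v hv hv0 => ⟨(key v hv hv0).1, ?_⟩, ?_⟩
  · have := (key v hv hv0).2
    have := hS.need_le hP symm hv
    omega
  · intro v hv w hw hvs hws hv0 hw0 hcp harr
    obtain ⟨a1, a2, a3⟩ := h.par v (key v hv hv0).1 hvs
    obtain ⟨b1, b2, b3⟩ := h.par w (key w hw hw0).1 hws
    obtain ⟨c1, c2, c3⟩ := h.info _ a1
    rw [← hcp] at b2 b3
    by_cases hbr : IsBranch n s adj ord (cp v)
    · refine hg.1 _ c1 hbr c2 v hv w hw a2 b2 hv0 hw0 ?_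
      rw [a3, b3] at harr
      unfold call at harr
      rcases lt_trichotomy (g (cp v) v) (g (cp v) w) with h1 | h1 | h1
      · have := delay_mono (n := n) (t := t) (ord := ord) (hp := hp) (b := b) (v := cp v)
          (x := arr (cp v) + g (cp v) v + 1) (y := arr (cp v) + g (cp v) w + 1) (by omega)
        omega
      · exact h1
      · have := delay_mono (n := n) (t := t) (ord := ord) (hp := hp) (b := b) (v := cp v)
          (x := arr (cp v) + g (cp v) w + 1) (y := arr (cp v) + g (cp v) v + 1) (by omega)
        omega
    · -- the parent of `cp v`, `v` and `w` are three core neighbours of `cp v`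
      unfold IsBranch at hbr
      push Not at hbr
      obtain ⟨d1, d2, d3⟩ := h.par _ a1 hbr.1
      by_contra hvw
      have hlt : arr (cp (cp v)) < arr v := by
        unfold call at a3 d3; omega
      have hlt' : arr (cp (cp v)) < arr w := by omega
      have hsub : ({cp (cp v), v, w} : Finset ℕ) ⊆
          {u ∈ Finset.range n | adj (cp v) u ∧ ord u = 0} := by
        intro x hx
        simp only [Finset.mem_insert, Finset.mem_singleton] at hx
        rw [Finset.mem_filter, Finset.mem_range]
        rcases hx with rfl | rfl | rfl
        · exact ⟨(h.info _ d1).1, symm _ _ d2, (h.info _ d1).2.1⟩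
        · exact ⟨hv, a2, hv0⟩
        · exact ⟨hw, b2, hw0⟩
      have := Finset.card_le_card hsub
      rw [Finset.card_insert_of_notMem, Finset.card_pair hvw] at this
      · unfold coreDeg at hbr; omega
      · simp only [Finset.mem_insert, Finset.mem_singleton, not_or]
        exact ⟨fun h => by rw [h] at hlt; omega, fun h => by rw [h] at hlt'; omega⟩

end

/-! ### Counting through all guesses -/

/-- The number of digit cells `q < k`; those are the cells with `d q ≠ 0`. -/
def rank (d : ℕ → ℕ) (k : ℕ) : ℕ := ∑ q ∈ Finset.range k, if d q ≠ 0 then 1 else 0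

/-- The number in base `R` whose digits are the digit cells `q < k` of the array `g`. -/
def numVal (d : ℕ → ℕ) (R : ℕ) (g : ℕ → ℕ) (k : ℕ) : ℕ :=
  ∑ q ∈ Finset.range k, if d q ≠ 0 then g q * R ^ rank d q else 0

/-- If the values of a sequence of digit arrays grow by `1` modulo `R ^ M`, where `M` is the number
of digits, then the first `R ^ M` arrays of the sequence comprise all digit arrays. -/
theorem exists_eq_of_numVal_succ {d : ℕ → ℕ} {R N : ℕ} (g : ℕ → ℕ → ℕ) (c : ℕ → ℕ)
    (hlt : ∀ i < R ^ rank d N, ∀ q < N, d q ≠ 0 → g i q < R) (h0 : numVal d R (g 0) N = 0)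
    (hsucc : ∀ i, i + 1 < R ^ rank d N →
      numVal d R (g (i + 1)) N + c i * R ^ rank d N = numVal d R (g i) N + 1)
    (f : ℕ → ℕ) (hf : ∀ q < N, d q ≠ 0 → f q < R) :
    ∃ i < R ^ rank d N, ∀ q < N, d q ≠ 0 → g i q = f q := by
  classical
  have hval : ∀ i < R ^ rank d N, numVal d R (g i) N = i := by
    intro i
    induction i with
    | zero => exact fun _ => h0
    | succ i ih =>
      intro hi
      have h1 := hsucc i hi
      rw [ih (by omega)] at h1
      rcases Nat.eq_zero_or_pos (c i) with h2 | h2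
      · rw [h2] at h1; omega
      · have := Nat.le_mul_of_pos_left (R ^ rank d N) h2
        omega
  let D : Finset ℕ := {q ∈ Finset.range N | d q ≠ 0}
  have hD : ∀ q : D, q.1 < N ∧ d q ≠ 0 := fun q => by
    have := q.2
    rwa [Finset.mem_filter, Finset.mem_range] at this
  have hcard : D.card = rank d N := Finset.card_filter _ _
  -- The arrays are pairwise distinct, and there are only `R ^ M` ways to fill the digit cells.
  let F : Fin (R ^ rank d N) → (D → Fin R) := fun i q => ⟨g i q, hlt i i.2 q (hD q).1 (hD q).2⟩
  have hF : Function.Injective F := by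
    intro i j hij
    have h1 : ∀ q < N, d q ≠ 0 → g i q = g j q := fun q hq hd => by
      have := congrFun hij ⟨q, Finset.mem_filter.2 ⟨Finset.mem_range.2 hq, hd⟩⟩
      simpa [F] using this
    have h2 : numVal d R (g i) N = numVal d R (g j) N := by
      refine Finset.sum_congr rfl fun q hq => ?_
      split_ifs with hd
      · rw [h1 q (Finset.mem_range.1 hq) hd]
      · rfl
    rw [hval i i.2, hval j j.2] at h2
    exact Fin.ext h2
  have hbij := (Fintype.bijective_iff_injective_and_card F).2 ⟨hF, by simp [hcard]⟩
  obtain ⟨i, hi⟩ := hbij.2 fun q => ⟨f q, hf q (hD q).1 (hD q).2⟩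
  refine ⟨i, i.2, fun q hq hd => ?_⟩
  have := congrFun hi ⟨q, Finset.mem_filter.2 ⟨Finset.mem_range.2 hq, hd⟩⟩
  simpa [F] using this

/-! ### The program

Layout of the memory. Variables: `0` is `n`, `1` is `s`, `2` is `t` (replaced by `min t n`), `3` is
the number `M` of digits, `4` is the number of guesses that are still to be tried, `5` is `1` as soon
as a guess has been successful, `6` is the carry of the odometer; those from `10` to `39` serve as
loop variables and for intermediate results, and those from `40` on belong to the compiled code.
Arrays: `0` is the adjacency matrix, `1`, `2`, `3` are `ord`, `hp`, `b` of `IsPeeling`, `4` marks the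
digit cells, `5` is the current guess, `6`, `7`, `8` are `inf`, `arr`, `cp` of `SimInv`. -/

namespace RAM

/-- The expression has a nonzero value. -/
abbrev Ex.holds (e : Ex) (S : State) : Prop := e.eval S ≠ 0

namespace Ex

/-- Conjunction; a condition is an expression whose value is nonzero iff it holds. -/
def and (a b : Ex) : Ex := .cond a b (.lit 0)
/-- Disjunction. -/
def or (a b : Ex) : Ex := .cond a (.lit 1) b
/-- Negation. -/
def not (a : Ex) : Ex := .cond a (.lit 0) (.lit 1)
/-- `a ≤ b`. -/
def le (a b : Ex) : Ex := (a.sub b).not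
/-- `a < b`. -/
def lt (a b : Ex) : Ex := b.sub a
/-- `a = b`. -/
def eq (a b : Ex) : Ex := (a.le b).and (b.le a)
/-- The number of values of the variable `x` for which `c` holds. -/
def cnt (x : ℕ) (c : Ex) : Ex := .sum x (.cond c (.lit 1) (.lit 0))
/-- The cell `v * n + u` for the pair of vertices `(v, u)`; the product is a sum of `n` terms `v`. -/
def cell (v u : ℕ) : Ex := (Ex.sum 39 (.var v)).add (.var u)

variable {a b : Ex} {S : State}

@[simp] theorem holds_and : (a.and b).holds S ↔ a.holds S ∧ b.holds S := by
  simp only [holds, and, eval]; split_ifs <;> simp_all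
@[simp] theorem holds_or : (a.or b).holds S ↔ a.holds S ∨ b.holds S := by
  simp only [holds, or, eval]; split_ifs <;> simp_all
@[simp] theorem holds_not : a.not.holds S ↔ ¬ a.holds S := by
  simp only [holds, not, eval]; split_ifs <;> simp_all
@[simp] theorem holds_le : (a.le b).holds S ↔ a.eval S ≤ b.eval S := by
  simp only [le, holds_not]; simp [holds, eval]; omega
@[simp] theorem holds_lt : (a.lt b).holds S ↔ a.eval S < b.eval S := by
  simp only [holds, lt, eval]; omega
@[simp] theorem holds_eq : (a.eq b).holds S ↔ a.eval S = b.eval S := by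
  simp only [eq, holds_and, holds_le]; omega
@[simp] theorem holds_ld {i : ℕ} : (Ex.ld i a).holds S ↔ S.arr i (a.eval S) ≠ 0 := Iff.rfl
@[simp] theorem holds_var {x : ℕ} : (Ex.var x).holds S ↔ S.var x ≠ 0 := Iff.rfl
theorem eval_cnt {x : ℕ} : (cnt x a).eval S =
    {j ∈ Finset.range (S.var 0) | a.holds (S.setVar x j)}.card :=
  (Finset.card_filter _ _).symm
@[simp] theorem holds_cnt {x : ℕ} : (cnt x a).holds S ↔ ∃ j < S.var 0, a.holds (S.setVar x j) := by
  rw [holds, eval_cnt, ← Nat.pos_iff_ne_zero, Finset.card_pos]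
  simp [Finset.Nonempty]
theorem eval_cell {v u : ℕ} (h : v ≠ 39) :
    (cell v u).eval S = S.var v * S.var 0 + S.var u := by
  simp [cell, eval, h, mul_comm]

/-- `c` is a hanging child of `v`. -/
def isKid (c v : ℕ) : Ex := (Ex.ld 1 (.var c)).and ((Ex.ld 2 (.var c)).eq (.var v))
/-- The expression for `_root_.load`. -/
def load (v c : ℕ) : Ex := (Ex.ld 3 (.var c)).add
  (cnt 30 ((isKid 30 v).and ((Ex.ld 3 (.var c)).le (.ld 3 (.var 30)))))
/-- The expression for `_root_.need`. -/
def need (v : ℕ) : Ex := .mx 31 (.cond (isKid 31 v) (load v 31) (.lit 0))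
/-- The expression for `_root_.delay`. -/
def delay (v x : ℕ) : Ex := cnt 32 ((isKid 32 v).and (cnt 33 ((isKid 33 v).and
  (((Ex.ld 3 (.var 33)).le (.ld 3 (.var 32))).and ((Ex.var 2).lt ((load v 33).add (.var x)))))))
/-- `v` and `u` are adjacent. -/
def adj (v u : ℕ) : Ex := .ld 0 (cell v u)
/-- The number of neighbours of `v` in the core. -/
def coreDeg (v : ℕ) : Ex := cnt 34 ((adj v 34).and (Ex.ld 1 (.var 34)).not)
/-- `v` is a leaf other than `s` of the graph that is left. -/
def isLeaf (v : ℕ) : Ex := ((Ex.var v).eq (.var 1)).not.and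
  ((Ex.ld 1 (.var v)).not.and ((coreDeg v).eq (.lit 1)))
/-- The position of the call from `v` to `u` has to be guessed. -/
def isDigit (v u : ℕ) : Ex := (adj v u).and ((Ex.ld 1 (.var v)).not.and ((Ex.ld 1 (.var u)).not.and
  (((Ex.var v).eq (.var 1)).or ((Ex.lit 3).le (coreDeg v)))))

end Ex

open Ex in
/-- Remove leaves other than `s` one after another. The maximum of `v + 1` over all leaves `v` is `0`
iff no leaf is left. -/
def peel : St := .each 10 <|
  .seq (.assign 11 (.mx 35 (.cond (isLeaf 35) ((Ex.var 35).add (.lit 1)) (.lit 0)))) <|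
  .ite (.var 11) <|
  .seq (.assign 11 ((Ex.var 11).sub (.lit 1))) <|
  .seq (.store 3 (.var 11) (need 11)) <|
  .seq (.store 2 (.var 11)
    (.mx 36 (.cond ((adj 11 36).and (Ex.ld 1 (.var 36)).not) (.var 36) (.lit 0)))) <|
  .store 1 (.var 11) ((Ex.var 10).add (.lit 1))

open Ex in
/-- Mark the digit cells in array `4`. -/
def markDigits : St := .each 12 <| .each 13 <|
  .store 4 (cell 12 13) (.cond (isDigit 12 13) (.lit 1) (.lit 0))

open Ex in
/-- Put the number `M` of digits into variable `3`, and `M ^ M` into variable `4`: for each digit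
cell, multiply variable `4` by `M`, as a sum over all digit cells. -/
def countGuesses : St :=
  .seq (.assign 3 (.sum 14 (.sum 15 (.cond (.ld 4 (cell 14 15)) (.lit 1) (.lit 0))))) <|
  .seq (.assign 4 (.lit 1)) <|
  .each 12 <| .each 13 <| .ite (.ld 4 (cell 12 13)) <|
    .assign 4 (.sum 14 (.sum 15 (.cond (.ld 4 (cell 14 15)) (.var 4) (.lit 0))))

open Ex in
/-- What is done before the search; the deadline is replaced by `min t n = t - (t - n)`, so that `n`
rounds of simulation suffice. -/
def prepare : St :=
  .seq (.assign 2 ((Ex.var 2).sub ((Ex.var 2).sub (.var 0)))) <|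
  .seq peel <| .seq markDigits countGuesses

open Ex in
/-- One round of the simulation of the core: all calls at time `T + 1`, where `T` is variable `17`.
The guess is in array `5`; see `SimInv` for the contents of the arrays `6`, `7` and `8`. -/
def round : St := .each 12 <| .each 13 <|
  .seq (.assign 18 (((Ex.ld 7 (.var 12)).add (.ld 5 (cell 12 13))).add (.lit 1))) <|
  .ite ((Ex.ld 6 (.var 12)).and ((Ex.ld 6 (.var 13)).not.and ((adj 12 13).and
    ((Ex.ld 1 (.var 13)).not.and
      (((Ex.var 18).add (delay 12 18)).eq ((Ex.var 17).add (.lit 1))))))) <|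
  .seq (.store 6 (.var 13) (.lit 1)) <|
  .seq (.store 7 (.var 13) ((Ex.var 17).add (.lit 1))) <|
  .store 8 (.var 13) (.var 12)

/-- Simulate the broadcast in the core. -/
def simulate : St :=
  .seq (.each 16 (.store 6 (.var 16) (.lit 0))) <|
  .seq (.store 6 (.var 1) (.lit 1)) <|
  .seq (.store 7 (.var 1) (.lit 0)) <|
  .each 17 round

open Ex in
/-- The simulation violates `Accepts`. -/
def rejects : Ex :=
  (cnt 19 ((Ex.ld 1 (.var 19)).not.and ((Ex.ld 6 (.var 19)).not.or
    ((Ex.var 2).lt ((Ex.ld 7 (.var 19)).add (need 19)))))).or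
  (cnt 19 (cnt 20 (((Ex.var 19).eq (.var 1)).not.and (((Ex.var 20).eq (.var 1)).not.and
    ((Ex.ld 1 (.var 19)).not.and ((Ex.ld 1 (.var 20)).not.and
    (((Ex.ld 8 (.var 19)).eq (.ld 8 (.var 20))).and (((Ex.ld 7 (.var 19)).eq (.ld 7 (.var 20))).and
    ((Ex.var 19).eq (.var 20)).not))))))))

open Ex in
/-- Increase the number whose digits are in array `5` by one. -/
def increment : St :=
  .seq (.assign 6 (.lit 1)) <|
  .each 12 <| .each 13 <|
  .ite ((Ex.var 6).and (.ld 4 (cell 12 13))) <|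
  .seq (.assign 21 ((Ex.ld 5 (cell 12 13)).add (.lit 1))) <|
  .seq (.assign 6 (.cond ((Ex.var 21).eq (.var 3)) (.lit 1) (.lit 0))) <|
  .store 5 (cell 12 13) (.cond (.var 6) (.lit 0) (.var 21))

open Ex in
/-- Try one guess and go on to the next one. -/
def tryGuess : St :=
  .seq simulate <|
  .seq (.assign 5 (.cond rejects (.var 5) (.lit 1))) <|
  .seq increment <|
  .assign 4 ((Ex.var 4).sub (.lit 1))

/-- The program: it tries all guesses, and returns whether one of them was successful. -/
def broadcastProg : Prog :=
  .seq (prepare.compile 40) <|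
  .seq (.loop 4 (tryGuess.compile 40)) <|
  .seq (.const 40 0) (.add 0 5 40)

theorem prepare_ok : prepare.ok 40 := by decide
theorem tryGuess_ok : tryGuess.ok 40 := by decide

end RAM

namespace RAM

/-! ### Evaluation of the expressions -/

/-- The memory holds the instance: the number `n` of vertices, the source `s` and the adjacency
matrix. -/
structure Env (n s : ℕ) (adj : ℕ → ℕ → Prop) (S : State) : Prop where
  n_eq : S.var 0 = n
  s_eq : S.var 1 = s
  adj_iff : ∀ i < n, ∀ j < n, S.arr 0 (i * n + j) ≠ 0 ↔ adj i j

theorem Env.congr {n s : ℕ} {adj : ℕ → ℕ → Prop} {S S' : State} (h : Env n s adj S)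
    (h0 : S'.var 0 = S.var 0) (h1 : S'.var 1 = S.var 1) (ha : S'.arr 0 = S.arr 0) :
    Env n s adj S' :=
  ⟨h0.trans h.n_eq, h1.trans h.s_eq, ha ▸ h.adj_iff⟩

theorem Env.setVar {n s : ℕ} {adj : ℕ → ℕ → Prop} {S : State} (h : Env n s adj S) {x c : ℕ}
    (h0 : 0 ≠ x) (h1 : 1 ≠ x) : Env n s adj (S.setVar x c) :=
  h.congr (by simp [h0]) (by simp [h1]) rfl

theorem sup_range_ite (m : ℕ) (p : ℕ → Prop) [DecidablePred p] (f : ℕ → ℕ) :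
    ((Finset.range m).sup fun j => if p j then f j else 0) =
      ({j ∈ Finset.range m | p j} : Finset ℕ).sup f := by
  refine le_antisymm (Finset.sup_le fun j hj => ?_) (Finset.sup_le fun j hj => ?_)
  · split_ifs with h
    · exact Finset.le_sup (f := f) (Finset.mem_filter.2 ⟨hj, h⟩)
    · exact Nat.zero_le _
  · rw [Finset.mem_filter] at hj
    have := Finset.le_sup (f := fun j => if p j then f j else 0) hj.1
    simpa [hj.2] using this

namespace Ex

variable {S : State} {n s v u c x : ℕ} {A : ℕ → ℕ → Prop}

theorem holds_isKid : (isKid c v).holds S ↔ S.arr 1 (S.var c) ≠ 0 ∧ S.arr 2 (S.var c) = S.var v := by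
  simp [isKid, eval]

theorem eval_load (hv : v ≠ 30) (hc : c ≠ 30) : (load v c).eval S =
    _root_.load (S.var 0) (S.arr 1) (S.arr 2) (S.arr 3) (S.var v) (S.var c) := by
  rw [load, eval, eval_cnt, _root_.load, numAbove, kids, Finset.filter_filter]
  refine congrArg _ (congrArg _ ?_)
  refine Finset.filter_congr fun j _ => ?_
  simp [holds_isKid, eval, hv, hc, and_assoc]

theorem eval_need (hv : v ≠ 30) (hv' : v ≠ 31) : (need v).eval S =
    _root_.need (S.var 0) (S.arr 1) (S.arr 2) (S.arr 3) (S.var v) := by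
  rw [need, _root_.need, kids, ← sup_range_ite, eval]
  refine Finset.sup_congr rfl fun j _ => ?_
  change (if (isKid 31 v).holds _ then (load v 31).eval _ else _) = _
  rw [eval_load hv (by decide)]
  simp [holds_isKid, hv', eval]

theorem eval_delay (hv : v ≠ 30) (hv' : v ≠ 32) (hv'' : v ≠ 33) (hx' : x ≠ 32)
    (hx'' : x ≠ 33) : (delay v x).eval S =
    _root_.delay (S.var 0) (S.var 2) (S.arr 1) (S.arr 2) (S.arr 3) (S.var v) (S.var x) := by
  rw [delay, eval_cnt, _root_.delay]
  refine congrArg Finset.card (Finset.ext fun j => ?_)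
  rw [Finset.mem_filter, Finset.mem_filter]
  simp only [holds_and, holds_cnt, holds_isKid, holds_le, holds_lt, mem_kids, Finset.mem_range]
  simp only [eval, eval_load hv (show 33 ≠ 30 by decide)]
  simp [hv', hv'', hx', hx'', and_assoc]

theorem holds_adj (E : Env n s A S) (hv : v ≠ 39) (hvn : S.var v < n) (hun : S.var u < n) :
    (adj v u).holds S ↔ A (S.var v) (S.var u) := by
  rw [adj, holds_ld, eval_cell hv, E.n_eq, E.adj_iff _ hvn _ hun]

theorem eval_coreDeg [DecidableRel A] (E : Env n s A S) (hv : v ≠ 39) (hv' : v ≠ 34)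
    (hvn : S.var v < n) :
    (coreDeg v).eval S = _root_.coreDeg n A (S.arr 1) (S.var v) := by
  rw [coreDeg, eval_cnt, _root_.coreDeg, E.n_eq]
  congr 1
  refine Finset.filter_congr fun j hj => ?_
  rw [holds_and, holds_adj (E.setVar (by decide) (by decide)) hv (by simpa [hv'] using hvn)
    (by simpa using hj)]
  simp [hv', eval]

theorem holds_isLeaf [DecidableRel A] (E : Env n s A S) (hv : v ≠ 39) (hv' : v ≠ 34)
    (hvn : S.var v < n) : (isLeaf v).holds S ↔ S.var v ≠ s ∧ S.arr 1 (S.var v) = 0 ∧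
      _root_.coreDeg n A (S.arr 1) (S.var v) = 1 := by
  simp only [isLeaf, holds_and, holds_not, holds_eq, holds_ld, eval_coreDeg E hv hv' hvn]
  simp [eval, E.s_eq]

/-- The condition for a digit in mathematical terms. -/
theorem holds_isDigit [DecidableRel A] (E : Env n s A S) (hv : v ≠ 39) (hv' : v ≠ 34)
    (hvn : S.var v < n) (hun : S.var u < n) : (isDigit v u).holds S ↔
      A (S.var v) (S.var u) ∧ S.arr 1 (S.var v) = 0 ∧ S.arr 1 (S.var u) = 0 ∧
        IsBranch n s A (S.arr 1) (S.var v) := by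
  simp only [isDigit, holds_and, holds_not, holds_eq, holds_ld, eval_coreDeg E hv hv' hvn,
    holds_adj E hv hvn hun, holds_or, holds_le, IsBranch]
  simp [eval, E.s_eq]

end Ex

section
variable {S : State} {x a : ℕ} {e c i : Ex} {s s' : St}

theorem St.run_seq : (St.seq s s').run S = s'.run (s.run S) := rfl
theorem St.run_assign : (St.assign x e).run S = S.setVar x (e.eval S) := rfl
theorem St.run_store : (St.store a i e).run S = S.setArr a (i.eval S) (e.eval S) := rfl
theorem St.run_ite_pos (h : c.holds S) : (St.ite c s).run S = s.run S := if_pos h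
theorem St.run_ite_neg (h : ¬ c.holds S) : (St.ite c s).run S = S := if_neg h

end

/-! ### Loops over all pairs of vertices -/

/-- The invariant rule for a double loop; after the pair `(v, u)` the invariant `I (v * n + u + 1)`
holds. -/
theorem St.run_each_each {x y n : ℕ} {s : St} {S : State} (hx : x ∉ s.vars) (hxy : x ≠ y)
    (h0 : 0 ∉ x :: y :: s.vars) (hn : S.var 0 = n) (I : ℕ → State → Prop) (hI : I 0 S)
    (hset : ∀ k S' c, I k S' → I k (S'.setVar x c) ∧ I k (S'.setVar y c))
    (step : ∀ v < n, ∀ u < n, ∀ S', I (v * n + u) S' → S'.var x = v → S'.var y = u →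
      (∀ z, z ∉ x :: y :: s.vars → S'.var z = S.var z) → (∀ a, a ∉ s.arrs → S'.arr a = S.arr a) →
      I (v * n + u + 1) (s.run S')) :
    I (n * n) ((St.each x (.each y s)).run S) := by
  simp only [List.mem_cons, not_or] at h0
  let J : ℕ → State → Prop := fun k S' => I k S' ∧
    (∀ z, z ∉ x :: y :: s.vars → S'.var z = S.var z) ∧ (∀ a, a ∉ s.arrs → S'.arr a = S.arr a)
  have hJset : ∀ k S' c, J k S' → J k (S'.setVar x c) ∧ J k (S'.setVar y c) := by
    rintro k S' c ⟨h1, h2, h3⟩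
    refine ⟨⟨(hset k S' c h1).1, fun z hz => ?_, h3⟩, ⟨(hset k S' c h1).2, fun z hz => ?_, h3⟩⟩
    all_goals
      have hz' := hz
      simp only [List.mem_cons, not_or] at hz'
      simp [hz'.1, hz'.2.1, h2 z hz]
  refine (?_ : J (n * n) _).1
  rw [St.run, hn]
  refine iter_inv (fun v S' => J (v * n) S') (by simpa [J] using hI) fun v S₁ hv h1 => ?_
  rw [St.run, State.setVar_var, if_neg h0.1,
    h1.2.1 0 (by simp only [List.mem_cons, not_or]; exact ⟨h0.1, h0.2.1, h0.2.2⟩), hn, Nat.succ_mul]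
  refine (iter_inv (fun u S' => J (v * n + u) S' ∧ S'.var x = v)
    ⟨(hJset _ _ _ h1).1, by simp⟩ fun u S₂ hu h2 => ?_).1
  obtain ⟨h2, h3⟩ := h2
  have h4 := (hJset _ _ u h2).2
  refine ⟨⟨?_, fun z hz => ?_, fun a ha => ?_⟩, ?_⟩
  · exact step v hv u hu _ h4.1 (by simp [hxy, h3]) (by simp) h4.2.1 h4.2.2
  · rw [St.run_var (fun h => hz (by simp [h])), h4.2.1 z hz]
  · rw [St.run_arr ha, h4.2.2 a ha]
  · rw [St.run_var hx]; simp [hxy, h3]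

/-! ### Peeling -/

/-- The invariant of peeling after `j` steps. Every vertex that is left, except `s`, keeps a
neighbour with smaller `δ` (the distance from `s`), so its core degree is positive. If no leaf is
left then nothing changes any more; otherwise `j` vertices have been removed. -/
structure PeelInv (n s : ℕ) (A : ℕ → ℕ → Prop) [DecidableRel A] (δ : ℕ → ℕ) (j : ℕ)
    (ord hp b : ℕ → ℕ) : Prop extends IsPeeling n s A ord hp b where
  ord_le_step : ∀ v, ord v ≤ j
  closer : ∀ v < n, v ≠ s → ord v = 0 → ∃ u, A v u ∧ ord u = 0 ∧ δ u < δ v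
  progress : (∀ v < n, ¬ (v ≠ s ∧ ord v = 0 ∧ coreDeg n A ord v = 1)) ∨
    {v ∈ Finset.range n | ord v ≠ 0}.card = j

section
variable {n s j : ℕ} {A : ℕ → ℕ → Prop} [DecidableRel A] {δ ord hp b : ℕ → ℕ}

theorem PeelInv.of_no_leaf (h : PeelInv n s A δ j ord hp b)
    (hno : ∀ v < n, ¬ (v ≠ s ∧ ord v = 0 ∧ coreDeg n A ord v = 1)) :
    PeelInv n s A δ (j + 1) ord hp b :=
  ⟨h.toIsPeeling, fun v => (h.ord_le_step v).trans (Nat.le_succ j), h.closer, Or.inl hno⟩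

theorem PeelInv.step (h : PeelInv n s A δ j ord hp b) (symm : ∀ u v, A u v → A v u)
    (irrefl : ∀ v, ¬ A v v) (hj : j < n) {v u : ℕ} (hv : v < n) (hvs : v ≠ s) (hv0 : ord v = 0)
    (hdeg : coreDeg n A ord v = 1) (hu : A v u) (hu0 : ord u = 0)
    (huniq : ∀ u', A v u' → ord u' = 0 → u' = u) :
    PeelInv n s A δ (j + 1) (Function.update ord v (j + 1)) (Function.update hp v u)
      (Function.update b v (need n ord hp b v)) := by
  refine ⟨h.toIsPeeling.step symm irrefl hj h.ord_le_step hv hvs hv0 hu hu0 huniq, ?_, ?_, ?_⟩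
  · intro w
    by_cases hw : w = v
    · subst hw; simp
    · rw [Function.update_of_ne hw]; exact (h.ord_le_step w).trans (Nat.le_succ j)
  · intro w hw hws hw0
    have hwv : w ≠ v := by rintro rfl; simp at hw0
    rw [Function.update_of_ne hwv] at hw0
    obtain ⟨x, hx, hx0, hxd⟩ := h.closer w hw hws hw0
    have hxv : x ≠ v := by
      -- otherwise `v` would have two neighbours left, `w` and one closer to `s`
      rintro rfl
      obtain ⟨y, hy, hy0, hyd⟩ := h.closer x hv hvs hv0
      have := huniq y hy hy0
      have := huniq w (symm _ _ hx) hw0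
      subst_vars
      omega
    exact ⟨x, hx, by rwa [Function.update_of_ne hxv], hxd⟩
  · rcases h.progress with hno | hc
    · exact absurd ⟨hvs, hv0, hdeg⟩ (hno v hv)
    · right
      have : {w ∈ Finset.range n | Function.update ord v (j + 1) w ≠ 0} =
          insert v {w ∈ Finset.range n | ord w ≠ 0} := by
        ext w
        by_cases hw : w = v
        · subst hw; simp [hv]
        · simp [hw]
      rw [this, Finset.card_insert_of_notMem (by simp [hv0]), hc]

/-- After `n` steps no leaf is left, since `s` is never removed. -/
theorem PeelInv.two_le_coreDeg (h : PeelInv n s A δ n ord hp b) (lt_of_adj : ∀ u v, A u v → u < n)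
    (symm : ∀ u v, A u v → A v u) (hs : s < n) :
    ∀ v < n, v ≠ s → ord v = 0 → 2 ≤ coreDeg n A ord v := by
  intro v hv hvs hv0
  have hpos : 1 ≤ coreDeg n A ord v := by
    obtain ⟨u, hu, hu0, -⟩ := h.closer v hv hvs hv0
    exact Finset.card_pos.2 ⟨u, by simp [lt_of_adj _ _ (symm _ _ hu), hu, hu0]⟩
  rcases h.progress with hno | hc
  · have := hno v hv
    have : coreDeg n A ord v ≠ 1 := fun h => this ⟨hvs, hv0, h⟩
    omega
  · have : {w ∈ Finset.range n | ord w ≠ 0} ⊂ Finset.range n := by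
      rw [Finset.ssubset_iff_of_subset (Finset.filter_subset _ _)]
      exact ⟨s, by simpa using hs, by simp [h.ord_source]⟩
    have := Finset.card_lt_card this
    rw [hc, Finset.card_range] at this
    omega

theorem sup_ite_eq_zero_or {m : ℕ} {p : ℕ → Prop} [DecidablePred p] (f : ℕ → ℕ) :
    ((Finset.range m).sup fun i => if p i then f i else 0) = 0 ∨
      ∃ i < m, p i ∧ ((Finset.range m).sup fun i => if p i then f i else 0) = f i := by
  by_cases h : ((Finset.range m).sup fun i => if p i then f i else 0) = 0
  · exact Or.inl h
  · right
    have hne : (Finset.range m).Nonempty := by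
      by_contra h'
      rw [Finset.not_nonempty_iff_eq_empty] at h'
      simp [h'] at h
    obtain ⟨i, hi, he⟩ := Finset.exists_mem_eq_sup _ hne fun i => if p i then f i else 0
    rw [he] at h ⊢
    by_cases hp : p i
    · exact ⟨i, Finset.mem_range.1 hi, hp, by simp [hp]⟩
    · simp [hp] at h

theorem run_peel {S : State} (E : Env n s A S) (hs : s < n) (lt_of_adj : ∀ u v, A u v → u < n)
    (symm : ∀ u v, A u v → A v u) (irrefl : ∀ v, ¬ A v v)
    (hδ : ∀ v < n, v ≠ s → ∃ u, A v u ∧ δ u < δ v) (h1 : ∀ v, S.arr 1 v = 0) :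
    let S' := peel.run S
    IsPeeling n s A (S'.arr 1) (S'.arr 2) (S'.arr 3) ∧
      ∀ v < n, v ≠ s → S'.arr 1 v = 0 → 2 ≤ coreDeg n A (S'.arr 1) v := by
  intro S'
  have key : PeelInv n s A δ n (S'.arr 1) (S'.arr 2) (S'.arr 3) ∧ Env n s A S' := by
    simp only [S']
    rw [peel, St.run, E.n_eq]
    refine iter_inv (fun j S' => PeelInv n s A δ j (S'.arr 1) (S'.arr 2) (S'.arr 3) ∧ Env n s A S')
      ⟨⟨⟨h1 s, ?_, ?_, ?_, ?_, ?_, ?_⟩, ?_, ?_, ?_⟩, E⟩ ?_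
    · simp [h1]
    · simp [h1]
    · simp [h1]
    · simp [h1]
    · simp [h1]
    · simp [h1]
    · simp [h1]
    · intro v hv hvs _
      obtain ⟨u, hu, hd⟩ := hδ v hv hvs
      exact ⟨u, hu, h1 u, hd⟩
    · right; simp [h1]
    · rintro j S₁ hj ⟨hI, E₁⟩
      have E₂ : Env n s A (S₁.setVar 10 j) := E₁.setVar (by decide) (by decide)
      rw [St.run_seq, St.run_assign]
      set S₂ := S₁.setVar 10 j with hS₂
      have hv2 : Ex.eval (.mx 35 (.cond (Ex.isLeaf 35) ((Ex.var 35).add (.lit 1)) (.lit 0))) S₂ =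
          (Finset.range n).sup fun i => if i ≠ s ∧ S₁.arr 1 i = 0 ∧ coreDeg n A (S₁.arr 1) i = 1
            then i + 1 else 0 := by
        rw [Ex.eval, E₂.n_eq]
        refine Finset.sup_congr rfl fun i hi => ?_
        have := Ex.holds_isLeaf (v := 35) (E₂.setVar (c := i) (x := 35) (by decide) (by decide))
          (by decide) (by decide) (by simpa using hi)
        simp only [Ex.eval]
        change (if (Ex.isLeaf 35).holds _ then _ else _) = _
        simp only [this]
        simp [hS₂]
      rw [hv2]
      have hmax := fun i (hi : i < n) (hl : i ≠ s ∧ S₁.arr 1 i = 0 ∧ coreDeg n A (S₁.arr 1) i = 1) =>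
        Finset.le_sup (f := fun i => if i ≠ s ∧ S₁.arr 1 i = 0 ∧ coreDeg n A (S₁.arr 1) i = 1
            then i + 1 else 0) (Finset.mem_range.2 hi)
      rcases sup_ite_eq_zero_or (m := n)
        (p := fun i => i ≠ s ∧ S₁.arr 1 i = 0 ∧ coreDeg n A (S₁.arr 1) i = 1) (fun i => i + 1) with
        h0 | ⟨v, hv, ⟨hvs, hv0, hdeg⟩, he⟩
      · rw [h0, St.run_ite_neg (by simp)]
        refine ⟨hI.of_no_leaf fun v hv hl => ?_, E₂.setVar (by decide) (by decide)⟩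
        have := hmax v hv hl
        rw [h0, if_pos hl] at this
        omega
      · rw [he]
        obtain ⟨u, hu⟩ := Finset.card_eq_one.1 hdeg
        have humem : ∀ x, x ∈ ({u} : Finset ℕ) ↔ x < n ∧ A v x ∧ S₁.arr 1 x = 0 := by
          intro x; rw [← hu]; simp
        obtain ⟨hun, hau, hu0⟩ := (humem u).1 (by simp)
        have huniq : ∀ u', A v u' → S₁.arr 1 u' = 0 → u' = u := fun u' h1 h2 =>
          Finset.mem_singleton.1 ((humem u').2 ⟨lt_of_adj _ _ (symm _ _ h1), h1, h2⟩)
        have hstep := hI.step symm irrefl hj hv hvs hv0 hdeg hau hu0 huniq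
        rw [St.run_ite_pos (by simp), St.run_seq, St.run_assign, St.run_seq, St.run_store]
        set S₃ := ((S₂.setVar 11 (v + 1)).setVar 11
          (((Ex.var 11).sub (Ex.lit 1)).eval (S₂.setVar 11 (v + 1)))) with hS₃
        have hS₃v : S₃.var 11 = v := by simp [hS₃, Ex.eval]
        have hS₃j : S₃.var 10 = j := by simp [hS₃, hS₂]
        have hS₃a : S₃.arr = S₁.arr := rfl
        have E₃ : Env n s A S₃ :=
          (E₂.setVar (by decide) (by decide)).setVar (by decide) (by decide)
        have hneed : (Ex.need 11).eval S₃ = need n (S₁.arr 1) (S₁.arr 2) (S₁.arr 3) v := by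
          rw [Ex.eval_need (by decide) (by decide), hS₃v, E₃.n_eq, hS₃a]
        rw [hneed, show (Ex.var 11).eval S₃ = v from hS₃v, St.run_seq]
        set S₄ := S₃.setArr 3 v (need n (S₁.arr 1) (S₁.arr 2) (S₁.arr 3) v) with hS₄
        have E₄ : Env n s A S₄ := E₃.congr rfl rfl (by simp [hS₄])
        have hu' : Ex.eval (.mx 36 (.cond ((Ex.adj 11 36).and (Ex.ld 1 (.var 36)).not)
            (.var 36) (.lit 0))) S₄ = u := by
          rw [Ex.eval, E₄.n_eq]
          have : ((Finset.range n).sup fun i => if i = u then i else 0) = u := by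
            refine le_antisymm (Finset.sup_le fun i _ => ?_) ?_
            · split_ifs <;> omega
            · have := Finset.le_sup (f := fun i => if i = u then i else 0) (Finset.mem_range.2 hun)
              simpa using this
          refine Eq.trans (Finset.sup_congr rfl fun i hi => ?_) this
          have := Ex.holds_adj (v := 11) (u := 36)
            (E₄.setVar (c := i) (x := 36) (by decide) (by decide)) (by decide)
            (by simp [hS₄, hS₃v, hv]) (by simpa using hi)
          simp only [Ex.eval]
          change (if ((Ex.adj 11 36).and (Ex.ld 1 (.var 36)).not).holds _ then _ else _) = _
          have hiff : (i = u) ↔ i < n ∧ A v i ∧ S₁.arr 1 i = 0 := by rw [← humem, Finset.mem_singleton]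
          simp only [Ex.holds_and, Ex.holds_not, this, hiff]
          simp [hS₄, hS₃v, Ex.eval, hS₃a, Finset.mem_range.1 hi]
        rw [St.run_store, St.run_store, hu']
        refine ⟨?_, E₃.congr rfl rfl (by simp [hS₄])⟩
        simpa [hS₄, hS₃a, hS₃v, hS₃j, Ex.eval] using hstep
  exact ⟨key.1.toIsPeeling, key.1.two_le_coreDeg lt_of_adj symm hs⟩

end

end RAM

namespace RAM

/-! ### Preparing the search -/

theorem sum_range_mul (F : ℕ → ℕ) (m n : ℕ) :
    ∑ v ∈ Finset.range m, ∑ u ∈ Finset.range n, F (v * n + u) = ∑ q ∈ Finset.range (m * n), F q := by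
  induction m with
  | zero => simp
  | succ m ih => rw [Finset.sum_range_succ, ih, Nat.succ_mul, Finset.sum_range_add]

theorem cell_inj {n v u v' u' : ℕ} (hu : u < n) (hu' : u' < n) (h : v * n + u = v' * n + u') :
    v = v' ∧ u = u' := by
  have h1 : (v * n + u) / n = v := by
    rw [mul_comm, Nat.mul_add_div (by omega), Nat.div_eq_of_lt hu, add_zero]
  have h2 : (v' * n + u') / n = v' := by
    rw [mul_comm, Nat.mul_add_div (by omega), Nat.div_eq_of_lt hu', add_zero]
  obtain rfl : v = v' := by rw [← h1, h, h2]
  exact ⟨rfl, by omega⟩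

theorem cell_lt {n v u : ℕ} (hv : v < n) (hu : u < n) : v * n + u < n * n := by
  have := Nat.mul_le_mul_right n (Nat.succ_le_of_lt hv)
  rw [Nat.succ_mul] at this
  omega

/-- The evaluation of a sum over all digit cells. -/
theorem eval_sum_digits {S : State} {n : ℕ} (hn : S.var 0 = n) {e : Ex} {m : ℕ}
    (he : ∀ i j, e.eval ((S.setVar 14 i).setVar 15 j) = m) :
    Ex.eval (.sum 14 (.sum 15 (.cond (.ld 4 (Ex.cell 14 15)) e (.lit 0)))) S =
      rank (S.arr 4) (n * n) * m := by
  rw [rank, Finset.sum_mul, ← sum_range_mul (fun q => (if S.arr 4 q ≠ 0 then 1 else 0) * m)]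
  simp only [Ex.eval, he, Ex.eval_cell (show 14 ≠ 39 by decide)]
  simp [hn]

section
variable {n s t : ℕ} {A : ℕ → ℕ → Prop}

theorem run_markDigits [DecidableRel A] {S : State} (E : Env n s A S) : ∀ v < n, ∀ u < n,
    (markDigits.run S).arr 4 (v * n + u) ≠ 0 ↔
      A v u ∧ S.arr 1 v = 0 ∧ S.arr 1 u = 0 ∧ IsBranch n s A (S.arr 1) v := by
  have key : ∀ v < n, ∀ u < n, v * n + u < n * n → ((markDigits.run S).arr 4 (v * n + u) ≠ 0 ↔
      A v u ∧ S.arr 1 v = 0 ∧ S.arr 1 u = 0 ∧ IsBranch n s A (S.arr 1) v) := by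
    refine St.run_each_each (S := S) (by decide) (by decide) (by decide) E.n_eq (fun k S' =>
      ∀ v < n, ∀ u < n, v * n + u < k → (S'.arr 4 (v * n + u) ≠ 0 ↔
        A v u ∧ S.arr 1 v = 0 ∧ S.arr 1 u = 0 ∧ IsBranch n s A (S.arr 1) v))
      (fun _ _ _ _ h => absurd h (Nat.not_lt_zero _)) (fun k S' c h => ⟨h, h⟩) ?_
    intro v hv u hu S' hI hx hy hvar harr v' hv' u' hu' hlt
    have E' : Env n s A S' := E.congr (hvar 0 (by decide)) (hvar 1 (by decide)) (harr 0 (by decide))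
    have hd := Ex.holds_isDigit (v := 12) (u := 13) E' (by decide) (by decide) (by rwa [hx])
      (by rwa [hy])
    rw [St.run_store, Ex.eval_cell (by decide), hx, hy, E'.n_eq]
    rw [hx, hy, harr 1 (by decide)] at hd
    by_cases hc : v' * n + u' = v * n + u
    · obtain ⟨rfl, rfl⟩ := cell_inj hu' hu hc
      rw [← hd, State.setArr_arr, if_pos rfl, Function.update_self, Ex.eval]
      split_ifs with h
      · simpa [Ex.eval] using h
      · simpa [Ex.eval] using h
    · rw [State.setArr_arr, if_pos rfl, Function.update_of_ne hc]
      exact hI v' hv' u' hu' (by omega)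
  exact fun v hv u hu => key v hv u hu (cell_lt hv hu)

theorem run_countGuesses {S : State} (hn : S.var 0 = n) :
    (countGuesses.run S).var 3 = rank (S.arr 4) (n * n) ∧
      (countGuesses.run S).var 4 = rank (S.arr 4) (n * n) ^ rank (S.arr 4) (n * n) := by
  rw [countGuesses, St.run_seq, St.run_assign, St.run_seq, St.run_assign,
    eval_sum_digits (m := 1) hn (fun _ _ => rfl), mul_one]
  set M := rank (S.arr 4) (n * n)
  set S₁ := (S.setVar 3 M).setVar 4 ((Ex.lit 1).eval (S.setVar 3 M)) with hS₁
  refine ⟨?_, ?_⟩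
  · rw [St.run_var (by decide)]
    simp [hS₁]
  · refine St.run_each_each (S := S₁) (by decide) (by decide) (by decide) (by simpa [hS₁] using hn)
      (fun k S' => S'.var 4 = M ^ rank (S.arr 4) k) (by simp [hS₁, Ex.eval, rank])
      (fun k S' c h => ⟨by simpa using h, by simpa using h⟩) ?_
    intro v hv u hu S' hI hx hy hvar harr
    have hn' : S'.var 0 = n := by rw [hvar 0 (by decide)]; simpa [hS₁] using hn
    have h4 : S'.arr 4 = S.arr 4 := by rw [harr 4 (by decide)]; simp [hS₁]
    have hc : (Ex.ld 4 (Ex.cell 12 13)).holds S' ↔ S.arr 4 (v * n + u) ≠ 0 := by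
      rw [Ex.holds_ld, Ex.eval_cell (by decide), hx, hy, hn', h4]
    rw [rank, Finset.sum_range_succ, ← rank]
    by_cases h : S.arr 4 (v * n + u) ≠ 0
    · rw [St.run_ite_pos (hc.2 h), St.run_assign,
        eval_sum_digits (m := S'.var 4) hn' (fun _ _ => by simp [Ex.eval]), if_pos h, pow_succ, hI, h4]
      simp [M, mul_comm]
    · rw [St.run_ite_neg (hc.not.2 h), if_neg h]
      exact hI

/-! ### Simulation of the core -/

theorem run_simulate {S : State} {ord hp b : ℕ → ℕ} (E : Env n s A S) (h1 : S.arr 1 = ord)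
    (h2 : S.arr 2 = hp) (h3 : S.arr 3 = b) (ht : S.var 2 = t) (hs : s < n) (hord : ord s = 0)
    (lt_of_adj : ∀ u v, A u v → u < n) (symm : ∀ u v, A u v → A v u)
    (hinf : ∀ w ≥ n, S.arr 6 w = 0) :
    SimInv n s t A ord hp b (fun v u => S.arr 5 (v * n + u)) (fun _ _ => False) n
      ((simulate.run S).arr 6) ((simulate.run S).arr 7) ((simulate.run S).arr 8) := by
  have hQlt : ∀ u w, A u w → u * n + w < n * n := fun u w h =>
    cell_lt (lt_of_adj _ _ h) (lt_of_adj _ _ (symm _ _ h))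
  set g : ℕ → ℕ → ℕ := fun v u => S.arr 5 (v * n + u) with hg
  rw [simulate, St.run_seq]
  set S₁ := (St.each 16 (.store 6 (.var 16) (.lit 0))).run S with hS₁
  have hinf₁ : ∀ w, S₁.arr 6 w = 0 := by
    have : ∀ w, (w < n ∨ n ≤ w) → S₁.arr 6 w = 0 := by
      rw [hS₁, St.run, E.n_eq]
      refine iter_inv (fun k S' => ∀ w, (w < k ∨ n ≤ w) → S'.arr 6 w = 0)
        (fun w hw => hinf w (by omega)) fun k S' hk hI w hw => ?_
      rw [St.run_store]
      by_cases h : w = k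
      · subst h; simp [Ex.eval]
      · simpa [Ex.eval, h] using hI w (by omega)
    exact fun w => this w (by omega)
  have hv₁ : ∀ z, z ≠ 16 → S₁.var z = S.var z := fun z hz =>
    St.run_var (by simpa [St.vars] using hz) S
  have ha₁ : ∀ a, a ≠ 6 → S₁.arr a = S.arr a := fun a ha =>
    St.run_arr (by simpa [St.arrs] using ha) S
  have hs₁ : S₁.var 1 = s := by rw [hv₁ 1 (by decide), E.s_eq]
  rw [St.run_seq, St.run_store, St.run_seq, St.run_store]
  simp only [Ex.eval, State.setArr_var, hs₁]
  set S₂ := (S₁.setArr 6 s 1).setArr 7 s 0 with hS₂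
  have hv₂ : ∀ z, z ≠ 16 → S₂.var z = S.var z := hv₁
  have ha₂ : ∀ a, a ≠ 6 → a ≠ 7 → S₂.arr a = S.arr a := fun a h6 h7 => by
    simp [hS₂, h6, h7, ha₁ a h6]
  -- the frame: what is not changed by the rounds
  let Fr : State → Prop := fun S' => (∀ z ∈ [0, 1, 2], S'.var z = S.var z) ∧
    (∀ a ∈ [0, 1, 2, 3, 4, 5], S'.arr a = S.arr a)
  have hfv : ∀ z ∈ [0, 1, 2], z ∉ round.vars := by decide
  have hfa : ∀ a ∈ [0, 1, 2, 3, 4, 5], a ∉ round.arrs := by decide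
  have key : SimInv n s t A ord hp b g (fun _ _ => False) n
      ((St.run (.each 17 round) S₂).arr 6) ((St.run (.each 17 round) S₂).arr 7)
      ((St.run (.each 17 round) S₂).arr 8) ∧ Fr (St.run (.each 17 round) S₂) := by
    rw [St.run, show S₂.var 0 = n by rw [hv₂ 0 (by decide), E.n_eq]]
    refine iter_inv (fun T S' => SimInv n s t A ord hp b g (fun _ _ => False) T
      (S'.arr 6) (S'.arr 7) (S'.arr 8) ∧ Fr S') ⟨⟨?_, ?_, ?_, ?_⟩, ?_, ?_⟩ ?_
    · simp [hS₂]
    · intro w hw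
      by_cases hws : w = s
      · subst hws; simp [hS₂, hs, hord]
      · simp [hS₂, hws, hinf₁] at hw
    · intro w hw hws
      simp [hS₂, hws, hinf₁] at hw
    · intro u w _ _ _ hc
      simp [call] at hc
    · intro z hz
      exact hv₂ z (by rintro rfl; simp at hz)
    · intro a ha
      exact ha₂ a (by rintro rfl; simp at ha) (by rintro rfl; simp at ha)
    rintro T S₃ hT ⟨hI, hFr⟩
    set S₄ := S₃.setVar 17 T with hS₄
    have hFr₄ : Fr S₄ := ⟨fun z hz => by
      rw [hS₄, State.setVar_var, if_neg (by rintro rfl; simp at hz), hFr.1 z hz], hFr.2⟩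
    refine ⟨?_, fun z hz => ?_, fun a ha => ?_⟩
    rotate_left
    · rw [St.run_var (hfv z hz), hFr₄.1 z hz]
    · rw [St.run_arr (hfa a ha), hFr₄.2 a ha]
    refine SimInv.next_round (Q := fun u w => u * n + w < n * n) ?_ hQlt (fun _ _ _ => id)
    refine St.run_each_each (S := S₄) (by decide) (by decide) (by decide)
      ((hFr₄.1 0 (by simp)).trans E.n_eq)
      (fun k S' => SimInv n s t A ord hp b g (fun u w => u * n + w < k) T
        (S'.arr 6) (S'.arr 7) (S'.arr 8)) ?_ (fun k S' c h => ⟨h, h⟩) ?_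
    · simpa [hS₄] using hI
    intro u hu w hw S₅ hI₅ hx hy hvar harr
    have hS₅v : ∀ z ∈ [0, 1, 2], S₅.var z = S.var z := fun z hz => by
      rw [hvar z (hfv z hz), hFr₄.1 z hz]
    have hS₅a : ∀ a ∈ [0, 1, 2, 3, 4, 5], S₅.arr a = S.arr a := fun a ha => by
      rw [harr a (hfa a ha), hFr₄.2 a ha]
    have hT₅ : S₅.var 17 = T := by rw [hvar 17 (by decide)]; simp [hS₄]
    have E₅ : Env n s A S₅ := E.congr (hS₅v 0 (by simp)) (hS₅v 1 (by simp)) (hS₅a 0 (by simp))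
    have hval : Ex.eval (((Ex.ld 7 (.var 12)).add (.ld 5 (Ex.cell 12 13))).add (.lit 1)) S₅ =
        S₅.arr 7 u + g u w + 1 := by
      simp only [Ex.eval, Ex.eval_cell (show 12 ≠ 39 by decide), hx, hy, E₅.n_eq,
        hS₅a 5 (by simp), hg]
    rw [St.run_seq, St.run_assign, hval]
    set S₆ := S₅.setVar 18 (S₅.arr 7 u + g u w + 1) with hS₆
    have hx₆ : S₆.var 12 = u := by simp [hS₆, hx]
    have hy₆ : S₆.var 13 = w := by simp [hS₆, hy]
    have hT₆ : S₆.var 17 = T := by simp [hS₆, hT₅]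
    have ha₆ : S₆.arr = S₅.arr := rfl
    have E₆ : Env n s A S₆ := E₅.setVar (by decide) (by decide)
    have hc : Ex.holds ((Ex.ld 6 (.var 12)).and ((Ex.ld 6 (.var 13)).not.and ((Ex.adj 12 13).and
        ((Ex.ld 1 (.var 13)).not.and
        (((Ex.var 18).add (Ex.delay 12 18)).eq ((Ex.var 17).add (.lit 1))))))) S₆ ↔
        (S₅.arr 6 u ≠ 0 ∧ S₅.arr 6 w = 0 ∧ A u w ∧ ord w = 0 ∧
          call n t ord hp b g (S₅.arr 7) u w = T + 1) := by
      have hadj := Ex.holds_adj (v := 12) (u := 13) E₆ (by decide) (by rwa [hx₆]) (by rwa [hy₆])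
      have hdel := Ex.eval_delay (S := S₆) (v := 12) (x := 18) (by decide) (by decide) (by decide)
        (by decide) (by decide)
      rw [hx₆, hy₆] at hadj
      simp only [Ex.holds_and, Ex.holds_not, Ex.holds_ld, Ex.holds_eq, hadj, Ex.eval, hx₆, hy₆, hT₆,
        hdel, ha₆, E₆.n_eq, hS₅a 1 (by simp), hS₅a 2 (by simp), hS₅a 3 (by simp), h1, h2, h3]
      rw [show S₆.var 2 = t by simp [hS₆, hS₅v 2 (by simp), ht],
        show S₆.var 18 = S₅.arr 7 u + g u w + 1 by simp [hS₆]]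
      simp only [ne_eq, not_not, call]
    have hQ : ∀ u' w', A u' w' → u' * n + w' < u * n + w + 1 →
        u' * n + w' < u * n + w ∨ u' = u ∧ w' = w := by
      intro u' w' hA hlt
      rcases Nat.lt_succ_iff_lt_or_eq.1 hlt with h | h
      · exact Or.inl h
      · exact Or.inr (cell_inj (lt_of_adj _ _ (symm _ _ hA)) hw h)
    by_cases hcall : S₅.arr 6 u ≠ 0 ∧ S₅.arr 6 w = 0 ∧ A u w ∧ ord w = 0 ∧
          call n t ord hp b g (S₅.arr 7) u w = T + 1
    · rw [St.run_ite_pos (hc.2 hcall)]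
      have := hI₅.do_call hQ hw hcall.1 hcall.2.1 hcall.2.2.1 hcall.2.2.2.1 hcall.2.2.2.2
      simpa [St.run, Ex.eval, hx₆, hy₆, hT₆, ha₆] using this
    · rw [St.run_ite_neg (hc.not.2 hcall)]
      exact hI₅.no_call hQ hcall
  exact key.1

theorem not_holds_rejects {S : State} (E : Env n s A S) : ¬ rejects.holds S ↔
    Accepts n s (S.var 2) (S.arr 1) (S.arr 2) (S.arr 3) (S.arr 6) (S.arr 7) (S.arr 8) := by
  rw [rejects, Ex.holds_or, not_or, Accepts]
  refine and_congr ?_ ?_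
  · simp only [Ex.holds_cnt, Ex.holds_and, Ex.holds_not, Ex.holds_or, Ex.holds_lt, Ex.holds_ld,
      Ex.eval, Ex.eval_need (show 19 ≠ 30 by decide) (show 19 ≠ 31 by decide), E.n_eq]
    simp [E.n_eq]
  · simp only [Ex.holds_cnt, Ex.holds_and, Ex.holds_not, Ex.holds_eq, Ex.holds_ld, Ex.eval, E.n_eq]
    simp [E.n_eq, E.s_eq]

/-! ### The next guess -/

/-- The odometer counts modulo `R ^ M`; the loop adds the carry in variable `6` cell by cell. -/
theorem run_increment {S : State} {d : ℕ → ℕ} {R : ℕ} (hn : S.var 0 = n) (hd : S.arr 4 = d)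
    (hR : S.var 3 = R) (hlt : ∀ q < n * n, d q ≠ 0 → S.arr 5 q < R) :
    let g' := (increment.run S).arr 5
    (∀ q < n * n, d q ≠ 0 → g' q < R) ∧ (∀ q, d q = 0 → g' q = S.arr 5 q) ∧
      ∃ c, numVal d R g' (n * n) + c * R ^ rank d (n * n) = numVal d R (S.arr 5) (n * n) + 1 := by
  set g := S.arr 5 with hg
  rw [increment, St.run_seq, St.run_assign]
  set S₁ := S.setVar 6 ((Ex.lit 1).eval S) with hS₁
  have key := St.run_each_each (S := S₁) (x := 12) (y := 13) (n := n)
    (s := .ite ((Ex.var 6).and (.ld 4 (Ex.cell 12 13))) <|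
      .seq (.assign 21 ((Ex.ld 5 (Ex.cell 12 13)).add (.lit 1))) <|
      .seq (.assign 6 (.cond ((Ex.var 21).eq (.var 3)) (.lit 1) (.lit 0))) <|
      .store 5 (Ex.cell 12 13) (.cond (.var 6) (.lit 0) (.var 21)))
    (by decide) (by decide) (by decide) (by simpa [hS₁] using hn)
    (fun k S' => S'.var 6 ≤ 1 ∧ (∀ q < n * n, d q ≠ 0 → S'.arr 5 q < R) ∧
      (∀ q, d q = 0 → S'.arr 5 q = g q) ∧ (∀ q ≥ k, S'.arr 5 q = g q) ∧
      numVal d R (S'.arr 5) k + S'.var 6 * R ^ rank d k = numVal d R g k + 1)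
    ⟨by simp [hS₁, Ex.eval], hlt, fun _ _ => rfl, fun _ _ => rfl,
      by simp [hS₁, Ex.eval, numVal, rank]⟩
    (fun k S' c h => ⟨by simpa using h, by simpa using h⟩) (by
      rintro v hv u hu S' ⟨i1, i2, i3, i4, i5⟩ hx hy hvar harr
      have hn' : S'.var 0 = n := by rw [hvar 0 (by decide)]; simpa [hS₁] using hn
      have hR' : S'.var 3 = R := by rw [hvar 3 (by decide)]; simpa [hS₁] using hR
      have h4 : S'.arr 4 = d := by rw [harr 4 (by decide)]; simpa [hS₁] using hd
      have hqn := cell_lt hv hu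
      have hcell : ∀ S'' : State, S''.var 0 = n → S''.var 12 = v → S''.var 13 = u →
          (Ex.cell 12 13).eval S'' = v * n + u := by
        intro S'' a1 a2 a3
        rw [Ex.eval_cell (by decide), a1, a2, a3]
      generalize v * n + u = q at *
      have hc : ((Ex.var 6).and (.ld 4 (Ex.cell 12 13))).holds S' ↔ S'.var 6 ≠ 0 ∧ d q ≠ 0 := by
        rw [Ex.holds_and, Ex.holds_var, Ex.holds_ld, hcell S' hn' hx hy, h4]
      have hsucc : ∀ f : ℕ → ℕ, numVal d R f (q + 1) =
          numVal d R f q + if d q ≠ 0 then f q * R ^ rank d q else 0 := fun f =>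
        Finset.sum_range_succ _ _
      have hrank : rank d (q + 1) = rank d q + if d q ≠ 0 then 1 else 0 :=
        Finset.sum_range_succ _ _
      by_cases hcond : S'.var 6 ≠ 0 ∧ d q ≠ 0
      · rw [St.run_ite_pos (hc.2 hcond)]
        have h6 : S'.var 6 = 1 := by omega
        rw [h6, one_mul] at i5
        rw [hrank, hsucc, hsucc, if_pos hcond.2, if_pos hcond.2, if_pos hcond.2, pow_succ]
        have hq := i4 q le_rfl
        have hqlt := i2 q hqn hcond.2
        have hupd : ∀ c, numVal d R (Function.update (S'.arr 5) q c) q = numVal d R (S'.arr 5) q := by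
          intro c
          refine Finset.sum_congr rfl fun i hi => ?_
          rw [Function.update_of_ne (Finset.mem_range.1 hi).ne]
        have h21 : Ex.eval ((Ex.ld 5 (Ex.cell 12 13)).add (.lit 1)) S' = g q + 1 := by
          simp only [Ex.eval, hcell S' hn' hx hy, hq]
        rw [St.run_seq, St.run_assign, h21, St.run_seq, St.run_assign, St.run_store]
        have heq : ((Ex.var 21).eq (.var 3)).holds (S'.setVar 21 (g q + 1)) ↔ g q + 1 = R := by
          rw [Ex.holds_eq]; simp [Ex.eval, hR']
        rw [hcell _ (by simpa using hn') (by simpa using hx) (by simpa using hy)]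
        by_cases hmax : g q + 1 = R
        · have h6' : Ex.eval (.cond ((Ex.var 21).eq (.var 3)) (.lit 1) (.lit 0))
              (S'.setVar 21 (g q + 1)) = 1 := if_pos (heq.2 hmax)
          rw [h6', show Ex.eval (.cond (.var 6) (.lit 0) (.var 21))
            ((S'.setVar 21 (g q + 1)).setVar 6 1) = 0 by simp [Ex.eval]]
          simp only [State.setArr_arr, State.setArr_var, State.setVar_arr, if_true]
          refine ⟨by simp, fun x hx hdx => ?_, fun x hdx => ?_, fun x hx => ?_, ?_⟩
          · by_cases h : x = q
            · subst h; rw [Function.update_self]; omega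
            · rw [Function.update_of_ne h]; exact i2 x hx hdx
          · rw [Function.update_of_ne (by rintro rfl; exact hcond.2 hdx)]; exact i3 x hdx
          · rw [Function.update_of_ne (by omega)]; exact i4 x (by omega)
          · rw [hupd, Function.update_self, zero_mul, add_zero]
            simp only [State.setVar_var, if_true, one_mul]
            rw [← hmax] at i5 ⊢
            linear_combination i5
        · have h6' : Ex.eval (.cond ((Ex.var 21).eq (.var 3)) (.lit 1) (.lit 0))
              (S'.setVar 21 (g q + 1)) = 0 := if_neg (heq.not.2 hmax)
          rw [h6', show Ex.eval (.cond (.var 6) (.lit 0) (.var 21))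
            ((S'.setVar 21 (g q + 1)).setVar 6 0) = g q + 1 by simp [Ex.eval]]
          simp only [State.setArr_arr, State.setArr_var, State.setVar_arr, if_true]
          refine ⟨by simp, fun x hx hdx => ?_, fun x hdx => ?_, fun x hx => ?_, ?_⟩
          · by_cases h : x = q
            · subst h; rw [Function.update_self]; omega
            · rw [Function.update_of_ne h]; exact i2 x hx hdx
          · rw [Function.update_of_ne (by rintro rfl; exact hcond.2 hdx)]; exact i3 x hdx
          · rw [Function.update_of_ne (by omega)]; exact i4 x (by omega)
          · rw [hupd, Function.update_self]
            simp only [State.setVar_var, if_true, zero_mul, add_zero]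
            linear_combination i5
      · rw [St.run_ite_neg (hc.not.2 hcond)]
        refine ⟨i1, i2, i3, fun x hx => i4 x (by omega), ?_⟩
        rw [hrank, hsucc, hsucc, i4 q le_rfl]
        by_cases hdq : d q = 0
        · simpa [hdq] using i5
        · have h6 : S'.var 6 = 0 := by
            by_contra h; exact hcond ⟨h, hdq⟩
          rw [h6, zero_mul, add_zero] at i5 ⊢
          rw [i5]; ring)
  exact ⟨key.2.1, key.2.2.1, _, key.2.2.2.2⟩

end

end RAM

namespace RAM

/-! ### The search -/

/-- `d` marks the digit cells: the pairs of adjacent core vertices the first of which is a branch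
vertex. -/
def IsDigitArray (n s : ℕ) (A : ℕ → ℕ → Prop) [DecidableRel A] (ord d : ℕ → ℕ) : Prop :=
  ∀ v < n, ∀ u < n, d (v * n + u) ≠ 0 ↔ A v u ∧ ord v = 0 ∧ ord u = 0 ∧ IsBranch n s A ord v

/-- The memory during the search. -/
structure Ready (n s t : ℕ) (A : ℕ → ℕ → Prop) (ord hp b d : ℕ → ℕ) (S : State) : Prop
    extends Env n s A S where
  t_eq : S.var 2 = t
  ord_eq : S.arr 1 = ord
  hp_eq : S.arr 2 = hp
  b_eq : S.arr 3 = b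
  d_eq : S.arr 4 = d
  radix_eq : S.var 3 = rank d (n * n)
  inf_eq : ∀ w ≥ n, S.arr 6 w = 0
  digit_lt : ∀ q < n * n, d q ≠ 0 → S.arr 5 q < rank d (n * n)
  digit_eq : ∀ q, d q = 0 → S.arr 5 q = 0

section
variable {n s t : ℕ} {A : ℕ → ℕ → Prop} {ord hp b d : ℕ → ℕ}

/-- Trying one guess is sound, and complete for the schedules that the guess fits; the guess is
incremented. -/
theorem run_tryGuess [DecidableRel A] {S : State} (h : Ready n s t A ord hp b d S)
    (hP : IsPeeling n s A ord hp b) (hs : s < n) (lt_of_adj : ∀ u v, A u v → u < n)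
    (symm : ∀ u v, A u v → A v u) (htn : t ≤ n) :
    let S' := tryGuess.run S
    Ready n s t A ord hp b d S' ∧ S'.var 4 = S.var 4 - 1 ∧
      (∃ c, numVal d (rank d (n * n)) (S'.arr 5) (n * n) + c * rank d (n * n) ^ rank d (n * n) =
        numVal d (rank d (n * n)) (S.arr 5) (n * n) + 1) ∧
      (S'.var 5 = 1 ∧ (∃ τ π, IsSchedule n s t A τ π) ∨ S'.var 5 = S.var 5) ∧
      ∀ τ π, IsSchedule n s t A τ π → Fits n s A ord τ π (fun v u => S.arr 5 (v * n + u)) →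
        S'.var 5 = 1 := by
  intro S'
  have hsim := run_simulate h.toEnv h.ord_eq h.hp_eq h.b_eq h.t_eq hs hP.ord_source lt_of_adj symm
    h.inf_eq
  set S₁ := simulate.run S with hS₁
  have hv₁ : ∀ z ∈ [0, 1, 2, 3, 4, 5], S₁.var z = S.var z := fun z hz => by
    refine St.run_var ?_ S
    revert z; decide
  have ha₁ : ∀ a ∈ [0, 1, 2, 3, 4, 5], S₁.arr a = S.arr a := fun a ha => by
    refine St.run_arr ?_ S
    revert a; decide
  have E₁ : Env n s A S₁ := h.toEnv.congr (hv₁ 0 (by simp)) (hv₁ 1 (by simp)) (ha₁ 0 (by simp))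
  have hrej := not_holds_rejects E₁
  rw [hv₁ 2 (by simp), h.t_eq, ha₁ 1 (by simp), h.ord_eq, ha₁ 2 (by simp), h.hp_eq, ha₁ 3 (by simp),
    h.b_eq] at hrej
  set S₂ := S₁.setVar 5 ((Ex.cond rejects (.var 5) (.lit 1)).eval S₁) with hS₂
  have hS' : S' = (increment.run S₂).setVar 4 (((Ex.var 4).sub (.lit 1)).eval (increment.run S₂)) :=
    rfl
  have hv₃ : ∀ z ∈ [0, 1, 2, 3, 4], (increment.run S₂).var z = S.var z := fun z hz => by
    rw [St.run_var (by revert z; decide), hS₂, State.setVar_var,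
      if_neg (by rintro rfl; simp at hz), hv₁ z (by revert z; decide)]
  have ha₃ : ∀ a ∈ [0, 1, 2, 3, 4], (increment.run S₂).arr a = S.arr a := fun a ha => by
    rw [St.run_arr (by revert a; decide), hS₂, State.setVar_arr, ha₁ a (by revert a; decide)]
  have ha₂ : S₂.arr 5 = S.arr 5 := ha₁ 5 (by simp)
  obtain ⟨i1, i2, i3⟩ := run_increment (S := S₂) (n := n) (d := d) (R := rank d (n * n))
    (by simpa [hS₂] using E₁.n_eq) ((ha₁ 4 (by simp)).trans h.d_eq)
    (by simpa [hS₂] using (hv₁ 3 (by simp)).trans h.radix_eq)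
    (by rw [ha₂]; exact h.digit_lt)
  rw [ha₂] at i2 i3
  have h5 : S'.var 5 = if rejects.holds S₁ then S.var 5 else 1 := by
    rw [hS', State.setVar_var, if_neg (by decide), St.run_var (by decide), hS₂, State.setVar_var,
      if_pos rfl, Ex.eval]
    simp only [Ex.eval, hv₁ 5 (by simp)]
  refine ⟨⟨h.toEnv.congr ?_ ?_ ?_, ?_, ?_, ?_, ?_, ?_, ?_, ?_, ?_, ?_⟩, ?_, i3, ?_, ?_⟩
  · rw [hS', State.setVar_var, if_neg (by decide), hv₃ 0 (by simp)]
  · rw [hS', State.setVar_var, if_neg (by decide), hv₃ 1 (by simp)]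
  · rw [hS', State.setVar_arr, ha₃ 0 (by simp)]
  · rw [hS', State.setVar_var, if_neg (by decide), hv₃ 2 (by simp), h.t_eq]
  · rw [hS', State.setVar_arr, ha₃ 1 (by simp), h.ord_eq]
  · rw [hS', State.setVar_arr, ha₃ 2 (by simp), h.hp_eq]
  · rw [hS', State.setVar_arr, ha₃ 3 (by simp), h.b_eq]
  · rw [hS', State.setVar_arr, ha₃ 4 (by simp), h.d_eq]
  · rw [hS', State.setVar_var, if_neg (by decide), hv₃ 3 (by simp), h.radix_eq]
  · intro w hw
    rw [hS', State.setVar_arr, St.run_arr (by decide), hS₂, State.setVar_arr]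
    by_contra hne
    have := (hsim.info w hne).1
    omega
  · exact i1
  · intro q hq
    exact (i2 q hq).trans (h.digit_eq q hq)
  · rw [hS', State.setVar_var, if_pos rfl]
    simp only [Ex.eval, hv₃ 4 (by simp)]
  · rw [h5]
    by_cases hr : rejects.holds S₁
    · rw [if_pos hr]; exact Or.inr rfl
    · rw [if_neg hr]
      exact Or.inl ⟨rfl, hsim.exists_schedule hP symm lt_of_adj (hrej.1 hr)⟩
  · intro τ π hS hfit
    rw [h5, if_neg (hrej.2 (hsim.accepts hP symm lt_of_adj htn hS hfit))]

/-- The number of digits is the sum of the core degrees of the branch vertices of the core. -/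
theorem rank_eq_sum [DecidableRel A] (hd : IsDigitArray n s A ord d) :
    ∃ f : ℕ → ℕ, rank d (n * n) = ∑ v ∈ Finset.range n, f v ∧
      ∀ v < n, (ord v = 0 → IsBranch n s A ord v → f v = coreDeg n A ord v) ∧
        (¬ (ord v = 0 ∧ IsBranch n s A ord v) → f v = 0) := by
  refine ⟨fun v => ∑ u ∈ Finset.range n, if d (v * n + u) ≠ 0 then 1 else 0, ?_, ?_⟩
  · rw [rank, ← sum_range_mul (fun q => if d q ≠ 0 then 1 else 0)]
  · refine fun v hv => ⟨fun h1 h2 => ?_, fun h => ?_⟩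
    · rw [coreDeg, Finset.card_filter]
      refine Finset.sum_congr rfl fun u hu => ?_
      simp only [hd v hv u (Finset.mem_range.1 hu), h1, h2, true_and, and_true]
    · refine Finset.sum_eq_zero fun u hu => if_neg fun h0 => h ?_
      have := (hd v hv u (Finset.mem_range.1 hu)).1 h0
      exact ⟨this.2.1, this.2.2.2⟩

/-- If there is a schedule, then some digit array fits it. The cells that are not digit cells hold
`0`, that is, a vertex that is not a branch vertex calls its child in the core first. -/
theorem exists_digits_fits [DecidableRel A] {τ π : ℕ → ℕ} (hS : IsSchedule n s t A τ π)
    (hP : IsPeeling n s A ord hp b) (lt_of_adj : ∀ u v, A u v → u < n)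
    (symm : ∀ u v, A u v → A v u) (hd : IsDigitArray n s A ord d) :
    ∃ f : ℕ → ℕ, (∀ q < n * n, d q ≠ 0 → f q < rank d (n * n)) ∧
      ∀ g : ℕ → ℕ, (∀ q < n * n, d q ≠ 0 → g q = f q) → (∀ q, d q = 0 → g q = 0) →
        Fits n s A ord τ π fun v u => g (v * n + u) := by
  obtain ⟨g₀, h1, h2, h3⟩ := hS.exists_positions ord
  obtain ⟨F, hF, hF'⟩ := rank_eq_sum hd
  have hdiv : ∀ v u, u < n → (v * n + u) / n = v ∧ (v * n + u) % n = u := by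
    intro v u hu
    rw [mul_comm, Nat.mul_add_div (by omega), Nat.div_eq_of_lt hu, Nat.mul_add_mod,
      Nat.mod_eq_of_lt hu]
    exact ⟨rfl, rfl⟩
  refine ⟨fun q => g₀ (q / n) (q % n), ?_, fun g hg hg0 => ?_⟩
  · intro q hq hdq
    have hn : 0 < n := Nat.pos_of_ne_zero (by rintro rfl; simp at hq)
    have hv : q / n < n := Nat.div_lt_of_lt_mul hq
    have hu : q % n < n := Nat.mod_lt _ hn
    have hq' : q / n * n + q % n = q := Nat.div_add_mod' q n
    obtain ⟨a1, a2, a3, a4⟩ := (hd _ hv _ hu).1 (by rwa [hq'])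
    calc g₀ (q / n) (q % n) < coreDeg n A ord (q / n) := h1 _ _ hu a1 a3
      _ = F (q / n) := ((hF' _ hv).1 a2 a4).symm
      _ ≤ ∑ v ∈ Finset.range n, F v :=
        Finset.single_le_sum (f := F) (fun _ _ => Nat.zero_le _) (Finset.mem_range.2 hv)
      _ = _ := hF.symm
  replace hg : ∀ q < n * n, d q ≠ 0 → g q = g₀ (q / n) (q % n) := hg
  refine ⟨?_, ?_⟩
  · intro v hv hbr hv0 u hu w hw au aw hu0 hw0 he
    simp only at he
    rw [hg _ (cell_lt hv hu) ((hd v hv u hu).2 ⟨au, hv0, hu0, hbr⟩),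
      hg _ (cell_lt hv hw) ((hd v hv w hw).2 ⟨aw, hv0, hw0, hbr⟩), (hdiv v u hu).1, (hdiv v u hu).2,
      (hdiv v w hw).1, (hdiv v w hw).2] at he
    exact h2 v u hu w hw au aw hu0 hw0 he
  · intro w hw hw0 hws
    have ha := hS.adj w hw hws
    have hp0 := hS.ord_parent hP symm hw hws hw0
    have hpn := lt_of_adj _ _ ha
    by_cases hdq : d (π w * n + w) = 0
    · simp only [hg0 _ hdq]
      exact Finset.card_pos.2 ⟨w, by simp [hw, hw0, hws]⟩
    · simp only
      rw [hg _ (cell_lt hpn hw) hdq, (hdiv (π w) w hw).1, (hdiv (π w) w hw).2]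
      exact h3 w hw hw0 hws

/-- The search loop tries all guesses. Once variable `5` is `1` it stays so, and if there is no
schedule it stays `0`. -/
theorem exec_search : ∃ C k, ∀ (n s t : ℕ) (A : ℕ → ℕ → Prop) [DecidableRel A] (ord hp b d : ℕ → ℕ)
    (S σ : State), (∀ y < 40, σ.var y = S.var y) → σ.arr = S.arr →
    Ready n s t A ord hp b d S → IsDigitArray n s A ord d → IsPeeling n s A ord hp b → s < n →
    (∀ u v, A u v → u < n) → (∀ u v, A u v → A v u) → t ≤ n →
    S.var 4 = rank d (n * n) ^ rank d (n * n) → S.var 5 = 0 → (∀ q, S.arr 5 q = 0) →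
    ∃ τ σ', Exec (.loop 4 (tryGuess.compile 40)) σ τ σ' ∧
      τ ≤ rank d (n * n) ^ rank d (n * n) * (C * (n + 1) ^ k + 1) + 1 ∧
      ((∃ τ π, IsSchedule n s t A τ π) → σ'.var 5 = 1) ∧
      ((¬ ∃ τ π, IsSchedule n s t A τ π) → σ'.var 5 = 0) := by
  obtain ⟨C, k, hexec⟩ := tryGuess.exec_compile tryGuess_ok
  refine ⟨C, k, ?_⟩
  intro n s t A _ ord hp b d S σ hσ hσ' hR hd hP hs lt_of_adj symm htn h4 h5 hg0
  set M := rank d (n * n) with hM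
  have hspec := fun S (h : Ready n s t A ord hp b d S) => run_tryGuess h hP hs lt_of_adj symm htn
  have hready : ∀ i, Ready n s t A ord hp b d (tryGuess.run^[i] S) := by
    intro i
    induction i with
    | zero => exact hR
    | succ i ih => rw [Function.iterate_succ_apply']; exact (hspec _ ih).1
  have hval : ∀ i, ∃ c, numVal d M ((tryGuess.run^[i + 1] S).arr 5) (n * n) + c * M ^ M =
      numVal d M ((tryGuess.run^[i] S).arr 5) (n * n) + 1 := by
    intro i
    rw [Function.iterate_succ_apply']
    exact (hspec _ (hready i)).2.2.1
  choose c hc using hval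
  have hone : ∀ i, (tryGuess.run^[i] S).var 5 = 1 → (tryGuess.run^[i + 1] S).var 5 = 1 := by
    intro i hi
    rw [Function.iterate_succ_apply']
    rcases (hspec _ (hready i)).2.2.2.1 with h | h
    · exact h.1
    · rw [h, hi]
  obtain ⟨τ, σ', e, ht, ⟨hv, ha⟩, -⟩ := exec_countdown (p := tryGuess.compile 40) (y := 4)
    (N := M ^ M) (K := C * (n + 1) ^ k)
    (fun i σ' => (∀ y < 40, σ'.var y = (tryGuess.run^[i] S).var y) ∧
      σ'.arr = (tryGuess.run^[i] S).arr) (by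
      rintro i σ₁ hi ⟨hv, ha⟩ h4
      obtain ⟨τ, σ₂, e, ht, hv', -, ha'⟩ := hexec 40 le_rfl _ σ₁ hv ha
      rw [(hready i).n_eq] at ht
      refine ⟨τ, σ₂, e, ht, ⟨?_, ?_⟩, ?_⟩
      · rw [Function.iterate_succ_apply']; exact hv'
      · rw [Function.iterate_succ_apply']; exact ha'
      · rw [hv' 4 (by decide), (hspec _ (hready i)).2.1, ← hv 4 (by decide), h4]
        omega) (σ := σ) ⟨hσ, hσ'⟩ (by rw [hσ 4 (by decide), h4])
  refine ⟨τ, σ', e, ht, ?_, ?_⟩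
  · rintro ⟨τ', π, hS⟩
    obtain ⟨f, hf, hfits⟩ := exists_digits_fits hS hP lt_of_adj symm hd
    obtain ⟨i, hi, heq⟩ := exists_eq_of_numVal_succ (d := d) (R := M) (N := n * n)
      (fun i => (tryGuess.run^[i] S).arr 5) c (fun i _ => (hready i).digit_lt)
      (Finset.sum_eq_zero fun q _ => by simp [hg0]) (fun i _ => hc i) f hf
    have h1 : (tryGuess.run^[i + 1] S).var 5 = 1 := by
      rw [Function.iterate_succ_apply']
      exact (hspec _ (hready i)).2.2.2.2 τ' π hS (hfits _ heq (hready i).digit_eq)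
    have h2 : ∀ j, i + 1 ≤ j → (tryGuess.run^[j] S).var 5 = 1 := by
      intro j hj
      induction j, hj using Nat.le_induction with
      | base => exact h1
      | succ j _ ih => exact hone j ih
    rw [hv 5 (by decide)]
    exact h2 _ hi
  · intro hno
    have h2 : ∀ j, (tryGuess.run^[j] S).var 5 = 0 := by
      intro j
      induction j with
      | zero => exact h5
      | succ j ih =>
        rw [Function.iterate_succ_apply']
        rcases (hspec _ (hready j)).2.2.2.1 with h | h
        · exact absurd h.2 hno
        · rw [h, ih]
    rw [hv 5 (by decide)]
    exact h2 _

/-- The program decides whether there is a schedule. The time bound is in terms of the number `M` of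
digits, which depends on the core only. -/
theorem exec_broadcastProg : ∃ C k, ∀ (n s t : ℕ) (A : ℕ → ℕ → Prop) [DecidableRel A] (δ : ℕ → ℕ)
    (S : State), Env n s A S → S.var 2 = t → S.var 5 = 0 → (∀ a ≠ 0, ∀ q, S.arr a q = 0) → s < n →
    (∀ u v, A u v → u < n) → (∀ u v, A u v → A v u) → (∀ v, ¬ A v v) →
    (∀ v < n, v ≠ s → ∃ u, A v u ∧ δ u < δ v) →
    ∃ τ σ', Exec broadcastProg S τ σ' ∧
      ((∃ τ π, IsSchedule n s (min t n) A τ π) → σ'.var 0 = 1) ∧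
      ((¬ ∃ τ π, IsSchedule n s (min t n) A τ π) → σ'.var 0 = 0) ∧
      ∃ ord d : ℕ → ℕ, IsDigitArray n s A ord d ∧ ord s = 0 ∧
        (∀ v < n, v ≠ s → ord v = 0 → 2 ≤ coreDeg n A ord v) ∧
        τ ≤ C * (n + 1) ^ k * (rank d (n * n) ^ rank d (n * n) + 1) := by
  obtain ⟨C₁, k₁, h₁⟩ := prepare.exec_compile prepare_ok
  obtain ⟨C₂, k₂, h₂⟩ := exec_search
  obtain ⟨C₃, k₃, h₃⟩ := exists_poly_bound C₁ k₁ C₂ k₂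
  obtain ⟨C₄, k₄, h₄⟩ := exists_poly_bound_add_const C₃ k₃ 10
  refine ⟨C₄, k₄, ?_⟩
  intro n s t A _ δ S E ht hv5 harr hs lt_of_adj symm irrefl hδ
  obtain ⟨τ₁, σ₁, e₁, t₁, v₁, -, a₁⟩ := h₁ 40 le_rfl S S (fun _ _ => rfl) rfl
  -- the four stages of the preparation
  set Sa := S.setVar 2 (((Ex.var 2).sub ((Ex.var 2).sub (.var 0))).eval S) with hSa
  have Ea : Env n s A Sa := E.setVar (by decide) (by decide)
  have hta : Sa.var 2 = min t n := by
    simp only [hSa, State.setVar_var, if_true, Ex.eval, ht, E.n_eq]; omega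
  obtain ⟨hP, hdeg⟩ := run_peel (S := Sa) (δ := δ) Ea hs lt_of_adj symm irrefl hδ
    (fun v => harr 1 (by decide) v)
  set Sb := peel.run Sa with hSb
  have hvb : ∀ z, z ∉ peel.vars → Sb.var z = Sa.var z := fun z hz => St.run_var hz Sa
  have hab : ∀ a, a ∉ peel.arrs → Sb.arr a = Sa.arr a := fun a ha => St.run_arr ha Sa
  have Eb : Env n s A Sb := Ea.congr (hvb 0 (by decide)) (hvb 1 (by decide)) (hab 0 (by decide))
  have hdig := run_markDigits Eb
  set Sc := markDigits.run Sb with hSc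
  have hvc : ∀ z, z ∉ markDigits.vars → Sc.var z = Sb.var z := fun z hz => St.run_var hz Sb
  have hac : ∀ a, a ∉ markDigits.arrs → Sc.arr a = Sb.arr a := fun a ha => St.run_arr ha Sb
  have Ec : Env n s A Sc := Eb.congr (hvc 0 (by decide)) (hvc 1 (by decide)) (hac 0 (by decide))
  obtain ⟨hR, hB⟩ := run_countGuesses (S := Sc) Ec.n_eq
  have hprep : prepare.run S = countGuesses.run Sc := rfl
  set Sd := countGuesses.run Sc with hSd
  have hvd : ∀ z, z ∉ countGuesses.vars → Sd.var z = Sc.var z := fun z hz => St.run_var hz Sc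
  have had : ∀ a, a ∉ countGuesses.arrs → Sd.arr a = Sc.arr a := fun a ha => St.run_arr ha Sc
  have h5 : ∀ q, Sd.arr 5 q = 0 := fun q => by
    rw [had 5 (by decide), hac 5 (by decide), hab 5 (by decide)]
    exact harr 5 (by decide) q
  have h6 : ∀ q, Sd.arr 6 q = 0 := fun q => by
    rw [had 6 (by decide), hac 6 (by decide), hab 6 (by decide)]
    exact harr 6 (by decide) q
  set d := Sc.arr 4 with hd
  set M := rank d (n * n) with hM
  have hready : Ready n s (min t n) A (Sb.arr 1) (Sb.arr 2) (Sb.arr 3) d Sd :=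
    { toEnv := Ec.congr (hvd 0 (by decide)) (hvd 1 (by decide)) (had 0 (by decide))
      t_eq := by rw [hvd 2 (by decide), hvc 2 (by decide), hvb 2 (by decide), hta]
      ord_eq := by rw [had 1 (by decide), hac 1 (by decide)]
      hp_eq := by rw [had 2 (by decide), hac 2 (by decide)]
      b_eq := by rw [had 3 (by decide), hac 3 (by decide)]
      d_eq := had 4 (by decide)
      radix_eq := hR
      inf_eq := fun w _ => h6 w
      digit_lt := fun q hq hdq => by
        rw [h5 q]
        refine Finset.sum_pos' (fun _ _ => Nat.zero_le _) ⟨q, Finset.mem_range.2 hq, ?_⟩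
        rw [if_pos hdq]; exact one_pos
      digit_eq := fun q _ => h5 q }
  rw [hprep] at v₁ a₁
  obtain ⟨τ₂, σ₂, e₂, t₂, hyes, hno⟩ := h₂ n s (min t n) A _ _ _ d Sd σ₁ v₁ a₁ hready hdig hP hs
    lt_of_adj symm (min_le_right _ _) hB (by
      rw [hvd 5 (by decide), hvc 5 (by decide), hvb 5 (by decide), hSa, State.setVar_var,
        if_neg (by decide), hv5]) h5
  have hfin : ∀ c, σ₂.var 5 = c → (((σ₂.setVar 40 0).setVar 0
      ((σ₂.setVar 40 0).var 5 + (σ₂.setVar 40 0).var 40)).var 0) = c := by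
    intro c hc; simp [hc]
  refine ⟨_, _, .seq e₁ (.seq e₂ (.seq .const .add)), fun h => hfin _ (hyes h),
    fun h => hfin _ (hno h), Sb.arr 1, d, hdig, hP.ord_source, hdeg, ?_⟩
  rw [E.n_eq] at t₁
  have hb3 := h₃ n
  have hb4 := h₄ n
  have hx : M ^ M * (C₂ * (n + 1) ^ k₂ + 1) ≤ M ^ M * (C₄ * (n + 1) ^ k₄) :=
    Nat.mul_le_mul_left _ (by omega)
  change τ₂ ≤ M ^ M * (C₂ * (n + 1) ^ k₂ + 1) + 1 at t₂
  change _ ≤ _ * (M ^ M + 1)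
  rw [Nat.mul_add, mul_one, mul_comm _ (M ^ M)]
  omega

end

end RAM

/-! ### Protocols and schedules -/

section
variable {V : Type*} {G : SimpleGraph V} {s : V}

theorem BroadcastProtocol.CompletesIn.mono {P : BroadcastProtocol G s} {t t' : ℕ}
    (h : P.CompletesIn t) (htt : t ≤ t') : P.CompletesIn t' := fun v =>
  let ⟨r, hr, hv⟩ := h v
  ⟨r, hr.trans htt, hv⟩

theorem broadcastTime_le_iff {t : ℕ} :
    broadcastTime G s ≤ t ↔ ∃ P : BroadcastProtocol G s, P.CompletesIn t := by
  constructor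
  · intro h
    have h' : broadcastTime G s < ((t + 1 : ℕ) : ℕ∞) :=
      lt_of_le_of_lt h (by exact_mod_cast Nat.lt_succ_self t)
    simp only [broadcastTime, iInf_lt_iff] at h'
    obtain ⟨t', ⟨P, hP⟩, ht'⟩ := h'
    exact ⟨P, hP.mono (Nat.lt_succ_iff.1 (by exact_mod_cast ht'))⟩
  · intro h
    exact iInf₂_le t h

/-- The times of first receipt in a protocol form a schedule. -/
theorem BroadcastProtocol.CompletesIn.exists_times {P : BroadcastProtocol G s} {t : ℕ}
    (h : P.CompletesIn t) : ∃ (τ : V → ℕ) (p : V → V), (∀ v, v ≠ s → G.Adj (p v) v) ∧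
      (∀ v, v ≠ s → τ (p v) < τ v) ∧
      (∀ u v, u ≠ s → v ≠ s → p u = p v → τ u = τ v → u = v) ∧ ∀ v, τ v ≤ t := by
  classical
  have hex : ∀ v, ∃ r, P.Receives v r := fun v => (h v).imp fun _ hr => hr.2
  -- The first receipt of `v` belongs to the first receipt of its caller; a later one would be slower.
  have key : ∀ v, v ≠ s → ∃ u i, (P.C u)[i]? = some v ∧
      Nat.find (hex v) = Nat.find (hex u) + i + 1 := by
    intro v hv
    have hr := Nat.find_spec (hex v)
    have hmin : ∀ m, P.Receives v m → Nat.find (hex v) ≤ m := fun m hm => Nat.find_min' _ hm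
    generalize Nat.find (hex v) = r at hr hmin ⊢
    cases hr with
    | source => exact absurd rfl hv
    | @send u _ r' i hu hi =>
      refine ⟨u, i, hi, ?_⟩
      have h1 := Nat.find_min' (hex u) hu
      have h2 := hmin _ (.send (Nat.find_spec (hex u)) hi)
      omega
  choose! p i hp hτ using key
  refine ⟨fun v => Nat.find (hex v), p, ?_, ?_, ?_, ?_⟩
  · intro v hv
    exact P.T_le ((P.mem_iff _ _).1 (List.mem_of_getElem? (hp v hv))).1
  · intro v hv
    have := hτ v hv
    dsimp only
    omega
  · intro u v hu hv hpp hτuv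
    dsimp only at hτuv
    have h1 := hτ u hu
    have h2 := hτ v hv
    rw [hpp] at h1
    have hi : i u = i v := by omega
    have e1 := hp u hu
    have e2 := hp v hv
    rw [hpp, hi, e2] at e1
    exact (Option.some.inj e1).symm
  · intro v
    obtain ⟨r, hr, hv⟩ := h v
    exact (Nat.find_min' _ hv).trans hr

/-- The graph of the edges between the vertices other than `s` and their parents. -/
def parentGraph (s : V) (p : V → V) : SimpleGraph V :=
  SimpleGraph.fromRel fun u v => v ≠ s ∧ p v = u

variable {τ : V → ℕ} {p : V → V}

theorem parentGraph_adj (hlt : ∀ v, v ≠ s → τ (p v) < τ v) {u v : V} :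
    (parentGraph s p).Adj u v ↔ (v ≠ s ∧ p v = u) ∨ (u ≠ s ∧ p u = v) := by
  rw [parentGraph, SimpleGraph.fromRel_adj]
  refine ⟨fun h => h.2, fun h => ⟨?_, h⟩⟩
  rintro rfl
  rcases h with ⟨h, hp⟩ | ⟨h, hp⟩ <;>
  · have := hlt u h
    rw [hp] at this
    exact this.false

theorem parentGraph_adj_parent (hlt : ∀ v, v ≠ s → τ (p v) < τ v) {v : V} (hv : v ≠ s) :
    (parentGraph s p).Adj (p v) v :=
  (parentGraph_adj hlt).2 (.inl ⟨hv, rfl⟩)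

theorem parentGraph_connected (hlt : ∀ v, v ≠ s → τ (p v) < τ v) :
    (parentGraph s p).Connected := by
  have key : ∀ m v, τ v = m → (parentGraph s p).Reachable s v := by
    intro m
    induction m using Nat.strong_induction_on with
    | _ m ih =>
      intro v hv
      by_cases h : v = s
      · rw [h]
      · exact (ih _ (hv ▸ hlt v h) _ rfl).trans (parentGraph_adj_parent hlt h).reachable
  have : Nonempty V := ⟨s⟩
  exact ⟨fun u v => (key _ u rfl).symm.trans (key _ v rfl)⟩

/-- The graph is connected, and it has at most one edge per vertex other than `s`. -/
theorem parentGraph_isTree [Finite V] (hlt : ∀ v, v ≠ s → τ (p v) < τ v) :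
    (parentGraph s p).IsTree := by
  have hc := parentGraph_connected hlt
  rw [SimpleGraph.isTree_iff_connected_and_card]
  refine ⟨hc, le_antisymm ?_ hc.card_vert_le_card_edgeSet_add_one⟩
  have hsub : (parentGraph s p).edgeSet ⊆ (fun v => s(p v, v)) '' {s}ᶜ := by
    intro e
    induction e using Sym2.ind with
    | _ u v =>
      intro he
      rcases (parentGraph_adj hlt).1 (SimpleGraph.mem_edgeSet _ |>.1 he) with ⟨h, hp⟩ | ⟨h, hp⟩
      · exact ⟨v, h, by simp [hp]⟩
      · exact ⟨u, h, by simp [hp, Sym2.eq_swap]⟩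
  have h1 : (parentGraph s p).edgeSet.ncard ≤ ({s}ᶜ : Set V).ncard :=
    (Set.ncard_le_ncard hsub (Set.toFinite _)).trans (Set.ncard_image_le (Set.toFinite _))
  have h2 := Set.ncard_add_ncard_compl ({s} : Set V)
  rw [Set.ncard_singleton] at h2
  rw [Nat.card_coe_set_eq]
  omega

/-- In the tree of a parent function, the distance to the root grows by one from a parent to a
child: the depth changes by one along every edge, so that no walk is shorter than the path of
parents. -/
theorem parentGraph_dist (hlt : ∀ v, v ≠ s → τ (p v) < τ v) {v : V} (hv : v ≠ s) :
    (parentGraph s p).dist s v = (parentGraph s p).dist s (p v) + 1 := by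
  classical
  have hex : ∀ v, ∃ k, p^[k] v = s := by
    have key : ∀ m v, τ v = m → ∃ k, p^[k] v = s := by
      intro m
      induction m using Nat.strong_induction_on with
      | _ m ih =>
        intro v hv
        by_cases h : v = s
        · exact ⟨0, h⟩
        · obtain ⟨k, hk⟩ := ih _ (hv ▸ hlt v h) _ rfl
          exact ⟨k + 1, hk⟩
    exact fun v => key _ v rfl
  obtain ⟨δ, hs, hδ⟩ : ∃ δ : V → ℕ, δ s = 0 ∧ ∀ v, v ≠ s → δ v = δ (p v) + 1 :=
    ⟨fun v => Nat.find (hex v), (Nat.find_eq_zero _).2 rfl, fun v h =>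
      Nat.find_comp_succ (hex v) (hex (p v)) h⟩
  have hwalk : ∀ {u v : V} (w : (parentGraph s p).Walk u v), δ v ≤ δ u + w.length := by
    intro u v w
    induction w with
    | nil => simp
    | @cons a b c hab w ih =>
      have : δ b ≤ δ a + 1 := by
        rcases (parentGraph_adj hlt).1 hab with ⟨h, hp⟩ | ⟨h, hp⟩
        · rw [hδ b h, hp]
        · rw [hδ a h, hp]
          omega
      rw [SimpleGraph.Walk.length_cons]
      omega
  have hc := parentGraph_connected hlt
  have hle : ∀ m v, δ v = m → (parentGraph s p).dist s v ≤ m := by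
    intro m
    induction m with
    | zero =>
      intro v hv
      by_cases h : v = s
      · simp [h]
      · have := hδ v h
        omega
    | succ m ih =>
      intro v hv
      by_cases h : v = s
      · simp [h]
      · have h1 := ih (p v) (by have := hδ v h; omega)
        have h2 := hc.dist_triangle (u := s) (v := p v) (w := v)
        have h3 := SimpleGraph.dist_eq_one_iff_adj.2 (parentGraph_adj_parent hlt h)
        omega
  have heq : ∀ v, (parentGraph s p).dist s v = δ v := by
    intro v
    obtain ⟨w, hw⟩ := hc.exists_walk_length_eq_dist s v
    have h1 := hwalk w
    have h2 := hle _ v rfl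
    omega
  rw [heq, heq, hδ v hv]

/-- Every schedule can be turned into a protocol that is at least as fast: each vertex calls its
children in the order of the schedule, but without pauses. -/
theorem exists_protocol [Fintype V] {t : ℕ} (hadj : ∀ v, v ≠ s → G.Adj (p v) v)
    (hlt : ∀ v, v ≠ s → τ (p v) < τ v)
    (hinj : ∀ u v, u ≠ s → v ≠ s → p u = p v → τ u = τ v → u = v) (hle : ∀ v, τ v ≤ t) :
    ∃ P : BroadcastProtocol G s, P.CompletesIn t := by
  classical
  let r : V → V → Prop := fun u v => τ u ≤ τ v
  have : Std.Total r := ⟨fun u v => le_total _ _⟩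
  have : IsTrans V r := ⟨fun _ _ _ h h' => le_trans h h'⟩
  let ch : V → Finset V := fun v => {u | u ≠ s ∧ p u = v}
  have hmem : ∀ v u, u ∈ (ch v).toList.insertionSort r ↔ u ≠ s ∧ p u = v := by
    intro v u
    rw [List.mem_insertionSort, Finset.mem_toList]
    simp [ch]
  have hnd : ∀ v, ((ch v).toList.insertionSort r).Nodup := fun v =>
    (List.perm_insertionSort r _).nodup_iff.2 (Finset.nodup_toList _)
  let P : BroadcastProtocol G s :=
    { T := parentGraph s p
      T_le := by
        intro u v h
        rcases (parentGraph_adj hlt).1 h with ⟨hv, rfl⟩ | ⟨hu, rfl⟩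
        · exact hadj v hv
        · exact (hadj u hu).symm
      isTree := parentGraph_isTree hlt
      C := fun v => (ch v).toList.insertionSort r
      nodup := hnd
      mem_iff := by
        intro v u
        rw [hmem, parentGraph_adj hlt]
        constructor
        · rintro ⟨h, rfl⟩
          exact ⟨.inl ⟨h, rfl⟩, parentGraph_dist hlt h⟩
        · rintro ⟨h | ⟨h, rfl⟩, hd⟩
          · exact h
          · have := parentGraph_dist hlt h
            omega }
  refine ⟨P, fun v => ?_⟩
  suffices h : ∀ m v, τ v = m → ∃ r ≤ m, P.Receives v r by
    obtain ⟨r, hr, hv⟩ := h _ v rfl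
    exact ⟨r, hr.trans (hle v), hv⟩
  intro m
  induction m using Nat.strong_induction_on with
  | _ m ih =>
    intro v hv
    by_cases hs : v = s
    · subst hs
      exact ⟨0, Nat.zero_le _, .source⟩
    obtain ⟨a, ha, hrec⟩ := ih _ (hv ▸ hlt v hs) (p v) rfl
    have hvm : v ∈ P.C (p v) := (hmem _ _).2 ⟨hs, rfl⟩
    obtain ⟨i, hi, hiv⟩ := List.getElem_of_mem hvm
    refine ⟨a + i + 1, ?_, .send hrec (List.getElem?_eq_some_iff.2 ⟨hi, hiv⟩)⟩
    -- The calls before that of `v` have distinct times after `τ (p v)`, so `i` of them fit.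
    have key : ∀ j (hj : j < (P.C (p v)).length), τ (p v) + j + 1 ≤ τ ((P.C (p v))[j]) := by
      intro j
      induction j with
      | zero =>
        intro hj
        have hm := (hmem _ _).1 (List.getElem_mem hj)
        have := hlt _ hm.1
        rw [hm.2] at this
        exact this
      | succ j ihj =>
        intro hj
        have h1 := ihj (by omega)
        have hm := (hmem _ _).1 (List.getElem_mem hj)
        have hm' := (hmem _ _).1 (List.getElem_mem (show j < (P.C (p v)).length by omega))
        have h2 : τ ((P.C (p v))[j]) ≤ τ ((P.C (p v))[j + 1]) :=
          List.pairwise_iff_getElem.1 (List.pairwise_insertionSort r (ch (p v)).toList)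
            j (j + 1) (by exact (by omega : j < (P.C (p v)).length)) hj (by omega)
        have h3 : τ ((P.C (p v))[j]) ≠ τ ((P.C (p v))[j + 1]) := by
          intro h
          have := hinj _ _ hm'.1 hm.1 (hm'.2.trans hm.2.symm) h
          have := (hnd (p v)).getElem_inj_iff.1 this
          omega
        omega
    have := key i hi
    rw [hiv] at this
    omega

end

/-! ### The size of the core -/

section
variable {V : Type*} {G : SimpleGraph V}

/-- A forest extends to a spanning tree of the complete graph. -/
theorem SimpleGraph.IsAcyclic.card_edgeSet_add_one_le {H : SimpleGraph V} [Finite V] [Nonempty V]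
    (h : H.IsAcyclic) : Nat.card H.edgeSet + 1 ≤ Nat.card V := by
  obtain ⟨T, hHT, -, hT⟩ :=
    SimpleGraph.connected_top.exists_isTree_le_of_le_of_isAcyclic (H := H) le_top h
  rw [← (SimpleGraph.isTree_iff_connected_and_card.1 hT).2]
  exact Nat.add_le_add_right
    (Nat.card_mono (Set.toFinite _) (SimpleGraph.edgeSet_mono hHT)) 1

/-- An induced subgraph on a nonempty vertex set `K` has at most `|K| - 1 + k` edges: apart from
the at most `k` edges of a feedback set it is a forest. -/
theorem card_edgeSet_induce_add_one_le [Finite V] {k : ℕ} (hk : cyclomaticNumber G ≤ k) (K : Set V)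
    (hK : K.Nonempty) : Nat.card (G.induce K).edgeSet + 1 ≤ K.ncard + k := by
  have h' : cyclomaticNumber G < ((k + 1 : ℕ) : ℕ∞) :=
    lt_of_le_of_lt hk (by exact_mod_cast Nat.lt_succ_self k)
  simp only [cyclomaticNumber, iInf_lt_iff] at h'
  obtain ⟨S, hS, hSk⟩ := h'
  have hfin : S.Finite := Set.toFinite S
  have hSk' : S.ncard ≤ k := by
    rw [← hfin.cast_ncard_eq] at hSk
    exact Nat.lt_succ_iff.1 (by exact_mod_cast hSk)
  have : Nonempty K := hK.to_subtype
  have hac := (hS.2.induce K).card_edgeSet_add_one_le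
  have hsub : (G.induce K).edgeSet ⊆ ((G.deleteEdges S).induce K).edgeSet ∪
      Sym2.map (Subtype.val : K → V) ⁻¹' S := by
    intro e
    induction e using Sym2.ind with
    | _ u v =>
      intro he
      by_cases hs : s((u : V), (v : V)) ∈ S
      · exact .inr hs
      · refine .inl ?_
        simp only [SimpleGraph.mem_edgeSet, SimpleGraph.comap_adj, SimpleGraph.deleteEdges_adj,
          Function.Embedding.subtype_apply] at he ⊢
        exact ⟨he, hs⟩
  have h1 := (Set.ncard_le_ncard hsub (Set.toFinite _)).trans (Set.ncard_union_le _ _)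
  have h2 : (Sym2.map (Subtype.val : K → V) ⁻¹' S).ncard ≤ S.ncard :=
    Set.ncard_le_ncard_of_injOn (Sym2.map Subtype.val) (fun _ h => h)
      (Sym2.map.injective Subtype.val_injective).injOn hfin
  rw [Nat.card_coe_set_eq, Nat.card_coe_set_eq] at hac
  rw [Nat.card_coe_set_eq]
  omega

end

section
variable {n : ℕ} {G : SimpleGraph (Fin n)} {s : Fin n}

/-- The adjacency relation of a graph on `Fin n`, as a relation on natural numbers. -/
def natAdj (G : SimpleGraph (Fin n)) (i j : ℕ) : Prop :=
  ∃ (hi : i < n) (hj : j < n), G.Adj ⟨i, hi⟩ ⟨j, hj⟩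

theorem natAdj_val {u v : Fin n} : natAdj G u v ↔ G.Adj u v :=
  ⟨fun ⟨_, _, h⟩ => h, fun h => ⟨u.2, v.2, h⟩⟩

theorem natAdj_symm {u v : ℕ} (h : natAdj G u v) : natAdj G v u :=
  ⟨h.2.1, h.1, h.2.2.symm⟩

theorem exists_isSchedule_iff {t : ℕ} :
    (∃ τ π, IsSchedule n s t (natAdj G) τ π) ↔
      ∃ P : BroadcastProtocol G s, P.CompletesIn t := by
  constructor
  · rintro ⟨τ, π, h⟩
    have hp : ∀ v : Fin n, v ≠ s → ∃ u : Fin n, (u : ℕ) = π v := fun v hv =>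
      ⟨⟨π v, (h.adj v v.2 (Fin.val_ne_of_ne hv)).1⟩, rfl⟩
    have : Nonempty (Fin n) := ⟨s⟩
    choose! p hp using hp
    refine exists_protocol (τ := fun v : Fin n => τ v) (p := p) ?_ ?_ ?_ fun v => h.le v v.2
    · intro v hv
      rw [← natAdj_val, hp v hv]
      exact h.adj v v.2 (Fin.val_ne_of_ne hv)
    · intro v hv
      rw [hp v hv]
      exact h.lt v v.2 (Fin.val_ne_of_ne hv)
    · intro u v hu hv hpp hτ
      refine Fin.ext (h.inj u u.2 v v.2 (Fin.val_ne_of_ne hu) (Fin.val_ne_of_ne hv) ?_ hτ)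
      rw [← hp u hu, ← hp v hv, hpp]
  · rintro ⟨P, hP⟩
    obtain ⟨τ, p, hadj, hlt, hinj, hle⟩ := hP.exists_times
    refine ⟨fun k => if h : k < n then τ ⟨k, h⟩ else 0,
      fun k => if h : k < n then p ⟨k, h⟩ else 0, ?_, ?_, ?_, ?_⟩
    · intro v hv hvs
      simp only [hv, dif_pos]
      exact natAdj_val.2 (hadj ⟨v, hv⟩ fun h => hvs (congrArg Fin.val h))
    · intro v hv hvs
      simp only [hv, dif_pos, Fin.is_lt]
      exact hlt ⟨v, hv⟩ fun h => hvs (congrArg Fin.val h)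
    · intro u hu v hv hus hvs
      simp only [hu, hv, dif_pos]
      intro hp hτ
      exact congrArg Fin.val (hinj _ _ (fun h => hus (congrArg Fin.val h))
        (fun h => hvs (congrArg Fin.val h)) (Fin.ext hp) hτ)
    · intro v hv
      simp only [hv, dif_pos]
      exact hle _

/-- In a connected graph, a deadline beyond the number of vertices is no restriction: informing
the vertices one by one, ordered by their distance `δ` to the source, takes fewer rounds. -/
theorem exists_isSchedule_min_iff {s t : ℕ} {adj : ℕ → ℕ → Prop} {δ : ℕ → ℕ}
    (hlt : ∀ u v, adj u v → u < n) (hsymm : ∀ u v, adj u v → adj v u)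
    (hδ : ∀ v < n, v ≠ s → ∃ u, adj v u ∧ δ u < δ v) :
    (∃ τ π, IsSchedule n s (min t n) adj τ π) ↔ ∃ τ π, IsSchedule n s t adj τ π := by
  constructor
  · rintro ⟨τ, π, h⟩
    exact ⟨τ, π, h.adj, h.lt, h.inj, fun v hv => (h.le v hv).trans (min_le_left _ _)⟩
  · rintro ⟨τ, π, h⟩
    rcases le_total t n with htn | hnt
    · rw [min_eq_left htn]
      exact ⟨τ, π, h⟩
    rw [min_eq_right hnt]
    choose! p hp hpd using hδ
    -- the position of `v` in the order by distance
    let pos : ℕ → ℕ := fun v => {u ∈ Finset.range n | δ u < δ v ∨ δ u = δ v ∧ u < v}.card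
    have hpos : ∀ a b, a < n → (δ a < δ b ∨ δ a = δ b ∧ a < b) → pos a < pos b := by
      intro a b ha hab
      refine Finset.card_lt_card ⟨fun u hu => ?_, fun hsub => ?_⟩
      · simp only [Finset.mem_filter] at hu ⊢
        refine ⟨hu.1, ?_⟩
        omega
      · have := hsub (Finset.mem_filter.2 ⟨Finset.mem_range.2 ha, hab⟩)
        simp at this
    refine ⟨pos, p, fun v hv hvs => hsymm _ _ (hp v hv hvs), fun v hv hvs => ?_, ?_, ?_⟩
    · exact hpos _ _ (hlt _ _ (hsymm _ _ (hp v hv hvs))) (.inl (hpd v hv hvs))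
    · intro u hu v hv _ _ _ huv
      by_contra hne
      rcases lt_trichotomy (δ u) (δ v) with hd | hd | hd
      · have := hpos u v hu (.inl hd)
        omega
      · rcases lt_or_gt_of_ne hne with hl | hl
        · have := hpos u v hu (.inr ⟨hd, hl⟩)
          omega
        · have := hpos v u hv (.inr ⟨hd.symm, hl⟩)
          omega
      · have := hpos v u hv (.inl hd)
        omega
    · intro v _
      exact (Finset.card_filter_le _ _).trans (Finset.card_range n).le

/-- Every vertex other than `s` has a neighbour nearer to `s`. -/
theorem exists_adj_dist_lt (hG : G.Connected) {v : Fin n} (hv : v ≠ s) :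
    ∃ u, G.Adj v u ∧ G.dist s u < G.dist s v := by
  obtain ⟨w, hw⟩ := hG.exists_walk_length_eq_dist v s
  cases w with
  | nil => exact absurd rfl hv
  | @cons _ u _ h w =>
    refine ⟨u, h, ?_⟩
    rw [SimpleGraph.Walk.length_cons] at hw
    have := SimpleGraph.dist_le w
    rw [SimpleGraph.dist_comm, SimpleGraph.dist_comm (u := s)]
    omega

open Classical in
theorem degree_induce_eq_coreDeg (ord : ℕ → ℕ) (v : {v : Fin n | ord v = 0}) :
    (G.induce {v : Fin n | ord v = 0}).degree v = coreDeg n (natAdj G) ord (v : Fin n) := by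
  rw [← SimpleGraph.card_neighborFinset_eq_degree, coreDeg]
  refine Finset.card_bij (fun u _ => ((u : Fin n) : ℕ)) ?_ ?_ ?_
  · intro u hu
    rw [SimpleGraph.mem_neighborFinset] at hu
    simp only [Finset.mem_filter, Finset.mem_range]
    exact ⟨u.1.2, natAdj_val.2 hu, u.2⟩
  · intro u _ w _ h
    exact Subtype.ext (Fin.ext h)
  · intro u hu
    simp only [Finset.mem_filter, Finset.mem_range] at hu
    refine ⟨⟨⟨u, hu.1⟩, hu.2.2⟩, ?_, rfl⟩
    rw [SimpleGraph.mem_neighborFinset]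
    exact natAdj_val.1 hu.2.1

open Classical in
/-- The degree sum of the core, which has at most `k - 1` more edges than vertices. -/
theorem sum_coreDeg_add_two_le {k : ℕ} (hk : cyclomaticNumber G ≤ k) {ord : ℕ → ℕ}
    (hs : ord s = 0) :
    ∑ v ∈ Finset.range n with ord v = 0, coreDeg n (natAdj G) ord v + 2 ≤
      2 * ({v ∈ Finset.range n | ord v = 0}.card + k) := by
  have h1 := card_edgeSet_induce_add_one_le hk {v : Fin n | ord v = 0} ⟨s, hs⟩
  have h2 := (G.induce {v : Fin n | ord v = 0}).sum_degrees_eq_twice_card_edges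
  simp_rw [degree_induce_eq_coreDeg] at h2
  have h3 : ∑ v ∈ Finset.range n with ord v = 0, coreDeg n (natAdj G) ord v =
      ∑ v : {v : Fin n | ord v = 0}, coreDeg n (natAdj G) ord (v : Fin n) := by
    symm
    refine Finset.sum_bij (fun v _ => ((v : Fin n) : ℕ)) ?_ ?_ ?_ fun _ _ => rfl
    · intro v _
      simp only [Finset.mem_filter, Finset.mem_range]
      exact ⟨v.1.2, v.2⟩
    · intro u _ w _ h
      exact Subtype.ext (Fin.ext h)
    · intro v hv
      simp only [Finset.mem_filter, Finset.mem_range] at hv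
      exact ⟨⟨⟨v, hv.1⟩, hv.2⟩, Finset.mem_univ _, rfl⟩
  have h4 : {v : Fin n | ord v = 0}.ncard = {v ∈ Finset.range n | ord v = 0}.card := by
    rw [← Set.ncard_coe_finset, ← Set.ncard_image_of_injective _ Fin.val_injective]
    congr 1
    ext v
    simp only [Set.mem_image, Set.mem_ofPred_eq, Finset.coe_filter, Finset.mem_range]
    exact ⟨fun ⟨u, hu, e⟩ => e ▸ ⟨u.2, hu⟩, fun ⟨hv, ho⟩ => ⟨⟨v, hv⟩, ho, rfl⟩⟩
  rw [h3, h2, ← h4]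
  rw [Nat.card_eq_fintype_card, ← SimpleGraph.edgeFinset_card] at h1
  omega

open Classical in
/-- There are at most `6 * k` positions of calls to guess. In the core every vertex other than `s`
has degree at least `2`, and the degrees exceed `2` only by `2 * k - 2` altogether. -/
theorem rank_le_of_cyclomaticNumber_le {k : ℕ} (hk : cyclomaticNumber G ≤ k) {ord d : ℕ → ℕ}
    (hd : RAM.IsDigitArray n s (natAdj G) ord d) (hs : ord s = 0)
    (h2 : ∀ v < n, v ≠ s → ord v = 0 → 2 ≤ coreDeg n (natAdj G) ord v) :
    rank d (n * n) ≤ 6 * k := by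
  obtain ⟨f, hf, hf'⟩ := RAM.rank_eq_sum hd
  have hsum := sum_coreDeg_add_two_le hk hs
  set c := {v ∈ Finset.range n | ord v = 0} with hc
  have hfc : ∑ v ∈ Finset.range n, f v = ∑ v ∈ c, f v := by
    symm
    refine Finset.sum_subset (Finset.filter_subset _ _) fun v hv hvc => ?_
    have hv' := Finset.mem_range.1 hv
    exact (hf' v hv').2 fun h => hvc (Finset.mem_filter.2 ⟨hv, h.1⟩)
  have hsc : (s : ℕ) ∈ c := Finset.mem_filter.2 ⟨Finset.mem_range.2 s.2, hs⟩
  -- `f v + 6 ≤ 3 * coreDeg v` for `v ≠ s`, as the degree is at least `3` if `f v ≠ 0`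
  have hle : ∑ v ∈ c, (f v + if v = s then 0 else 6) ≤
      ∑ v ∈ c, 3 * coreDeg n (natAdj G) ord v := by
    refine Finset.sum_le_sum fun v hv => ?_
    obtain ⟨hvn, hv0⟩ := Finset.mem_filter.1 hv
    have hvn := Finset.mem_range.1 hvn
    obtain ⟨hb, hnb⟩ := hf' v hvn
    by_cases hbr : IsBranch n s (natAdj G) ord v
    · rw [hb hv0 hbr]
      rcases hbr with h | h
      · rw [if_pos h]
        omega
      · split_ifs <;> omega
    · have hvs : v ≠ s := fun h => hbr (.inl h)
      rw [hnb fun h => hbr h.2, if_neg hvs]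
      have := h2 v hvn hvs hv0
      omega
  rw [Finset.sum_add_distrib, ← Finset.mul_sum, ← hfc, ← hf] at hle
  have h6 : ∑ v ∈ c, (if v = (s : ℕ) then 0 else 6) + 6 = 6 * c.card := by
    rw [← Finset.add_sum_erase _ _ hsc, if_pos rfl,
      Finset.sum_congr rfl fun v hv => if_neg (Finset.ne_of_mem_erase hv), Finset.sum_const,
      Finset.card_erase_of_mem hsc, smul_eq_mul]
    have : 0 < c.card := Finset.card_pos.2 ⟨_, hsc⟩
    omega
  omega

/-! ### The running time -/

/-- The number of guesses is `2 ^ O(k log k)`. For `k ≤ 1` the exponent on the right is `0`, and the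
constant covers `0 ^ 0 = 1` and `6 ^ 6`. -/
theorem pow_self_add_one_le {M k : ℕ} (h : M ≤ 6 * k) :
    ((M ^ M + 1 : ℕ) : ℝ) ≤ 2 * 6 ^ 6 * (2 : ℝ) ^ ((24 : ℝ) * (k * Real.logb 2 k)) := by
  rcases Nat.eq_zero_or_pos k with rfl | hk
  · obtain rfl : M = 0 := by omega
    norm_num
  have hMM : M ^ M ≤ (6 * k) ^ (6 * k) :=
    (Nat.pow_le_pow_left h M).trans (Nat.pow_le_pow_right (by omega) h)
  have hk0 : (0 : ℝ) < k := by exact_mod_cast hk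
  have hpow : (2 : ℝ) ^ ((24 : ℝ) * (k * Real.logb 2 k)) = ((k ^ (24 * k) : ℕ) : ℝ) := by
    rw [show (24 : ℝ) * (k * Real.logb 2 k) = Real.logb 2 k * ((24 * k : ℕ) : ℝ) by
      push_cast; ring, Real.rpow_mul (by norm_num),
      Real.rpow_logb (by norm_num) (by norm_num) hk0, Real.rpow_natCast]
    push_cast
    rfl
  rw [hpow]
  have hnat : (6 * k) ^ (6 * k) ≤ 6 ^ 6 * k ^ (24 * k) := by
    rcases Nat.lt_or_ge k 2 with h1 | h1
    · obtain rfl : k = 1 := by omega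
      norm_num
    · have h8 : 8 ≤ k ^ 3 := Nat.pow_le_pow_left h1 3
      have h4 : 6 * k ≤ k ^ 4 := by
        calc 6 * k ≤ k ^ 3 * k := Nat.mul_le_mul_right k (by omega)
          _ = k ^ 4 := by ring
      calc (6 * k) ^ (6 * k) ≤ (k ^ 4) ^ (6 * k) := Nat.pow_le_pow_left h4 _
        _ = k ^ (24 * k) := by rw [← pow_mul]; congr 1; ring
        _ ≤ 6 ^ 6 * k ^ (24 * k) := Nat.le_mul_of_pos_left _ (by norm_num)
  have h1 : 1 ≤ k ^ (24 * k) := Nat.one_le_pow _ _ hk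
  have : M ^ M + 1 ≤ 2 * 6 ^ 6 * k ^ (24 * k) := by
    have := hMM.trans hnat
    omega
  exact_mod_cast this

/-- A time bound with a polynomial factor and the factor `M ^ M` for `M = O(k)` is of the required
form. -/
theorem exists_time_bound (C d : ℕ) :
    ∃ C' : ℕ, ∀ n M k τ : ℕ, 1 ≤ n → M ≤ 6 * k → τ ≤ C * (n + 1) ^ d * (M ^ M + 1) →
      (τ : ℝ) ≤ C' * (2 : ℝ) ^ ((C' : ℝ) * (k * Real.logb 2 k)) * (n : ℝ) ^ C' := by
  refine ⟨C * 2 ^ d * (2 * 6 ^ 6) + d + 24, fun n M k τ hn hM hτ => ?_⟩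
  set C' := C * 2 ^ d * (2 * 6 ^ 6) + d + 24
  have hn' : (1 : ℝ) ≤ n := by exact_mod_cast hn
  have hlog : (0 : ℝ) ≤ k * Real.logb 2 k := by
    rcases Nat.eq_zero_or_pos k with rfl | hk
    · simp
    · exact mul_nonneg (Nat.cast_nonneg k)
        (Real.logb_nonneg (by norm_num) (by exact_mod_cast hk))
  have hC : ((C * 2 ^ d * (2 * 6 ^ 6) : ℕ) : ℝ) ≤ C' := by
    exact_mod_cast (by omega : C * 2 ^ d * (2 * 6 ^ 6) ≤ C')
  have h24 : (24 : ℝ) ≤ C' := by exact_mod_cast (by omega : 24 ≤ C')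
  have hpn : ((n : ℝ) + 1) ^ d ≤ 2 ^ d * (n : ℝ) ^ C' := by
    calc ((n : ℝ) + 1) ^ d ≤ (2 * n) ^ d := pow_le_pow_left₀ (by positivity) (by linarith) d
      _ = 2 ^ d * (n : ℝ) ^ d := mul_pow _ _ _
      _ ≤ 2 ^ d * (n : ℝ) ^ C' :=
        mul_le_mul_of_nonneg_left (pow_le_pow_right₀ hn' (by omega)) (by positivity)
  calc (τ : ℝ) ≤ ((C * (n + 1) ^ d * (M ^ M + 1) : ℕ) : ℝ) := by exact_mod_cast hτ
    _ = C * ((n : ℝ) + 1) ^ d * ((M ^ M + 1 : ℕ) : ℝ) := by push_cast; ring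
    _ ≤ C * (2 ^ d * (n : ℝ) ^ C') *
        (2 * 6 ^ 6 * (2 : ℝ) ^ ((24 : ℝ) * (k * Real.logb 2 k))) :=
      mul_le_mul (mul_le_mul_of_nonneg_left hpn (by positivity)) (pow_self_add_one_le hM)
        (by positivity) (by positivity)
    _ = ((C * 2 ^ d * (2 * 6 ^ 6) : ℕ) : ℝ) * (2 : ℝ) ^ ((24 : ℝ) * (k * Real.logb 2 k)) *
        (n : ℝ) ^ C' := by push_cast; ring
    _ ≤ C' * (2 : ℝ) ^ ((C' : ℝ) * (k * Real.logb 2 k)) * (n : ℝ) ^ C' := by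
      refine mul_le_mul_of_nonneg_right (mul_le_mul hC ?_ (by positivity) (by positivity))
        (by positivity)
      exact Real.rpow_le_rpow_of_exponent_le (by norm_num)
        (mul_le_mul_of_nonneg_right h24 hlog)

theorem RAM.env_broadcastInput (t : ℕ) :
    RAM.Env n s (natAdj G) (RAM.broadcastInput G s t) where
  n_eq := by simp [RAM.broadcastInput]
  s_eq := by simp [RAM.broadcastInput]
  adj_iff i hi j hj := by
    simp only [RAM.broadcastInput, true_and, ne_eq, ite_eq_right_iff, one_ne_zero, imp_false,
      not_not]
    constructor
    · rintro ⟨u, v, h, e⟩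
      obtain ⟨rfl, rfl⟩ := RAM.cell_inj hj v.2 e
      exact natAdj_val.2 h
    · rintro ⟨hi, hj, h⟩
      exact ⟨_, _, h, rfl⟩

end

/-- There is one random access machine program that, on every instance `(G, s, t)` with `G` a
connected graph on `n` vertices, decides whether `b(G, s) ≤ t` (variable `0` is `1` at the end if
so, and `0` otherwise), and whose running time is `2 ^ O(k log k) * n ^ O(1)` whenever the
cyclomatic number of `G` is at most `k`. -/
theorem theorem2 :
    ∃ (P : RAM.Prog) (C : ℕ),
      ∀ (n : ℕ) (G : SimpleGraph (Fin n)) (s : Fin n) (t : ℕ), G.Connected →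
        ∃ (τ : ℕ) (σ : RAM.State),
          RAM.Exec P (RAM.broadcastInput G s t) τ σ ∧
          (broadcastTime G s ≤ (t : ℕ∞) → σ.var 0 = 1) ∧
          (¬ broadcastTime G s ≤ (t : ℕ∞) → σ.var 0 = 0) ∧
          ∀ k : ℕ, cyclomaticNumber G ≤ (k : ℕ∞) →
            (τ : ℝ) ≤ C * (2 : ℝ) ^ ((C : ℝ) * (k * Real.logb 2 k)) * (n : ℝ) ^ C := by
  classical
  obtain ⟨C, d, hprog⟩ := RAM.exec_broadcastProg
  obtain ⟨C', hC'⟩ := exists_time_bound C d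
  refine ⟨RAM.broadcastProg, C', fun n G s t hG => ?_⟩
  -- the distance from `s`
  let δ : ℕ → ℕ := fun k => if h : k < n then G.dist s ⟨k, h⟩ else 0
  have hδ : ∀ v < n, v ≠ s → ∃ u, natAdj G v u ∧ δ u < δ v := by
    intro v hv hvs
    obtain ⟨u, hu, hd⟩ := exists_adj_dist_lt (s := s) hG (v := ⟨v, hv⟩)
      fun h => hvs (congrArg Fin.val h)
    exact ⟨u, ⟨hv, u.2, hu⟩, by simpa [δ, hv] using hd⟩
  have hlt : ∀ u v, natAdj G u v → u < n := fun u v h => h.1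
  have hsymm : ∀ u v, natAdj G u v → natAdj G v u := fun u v => natAdj_symm
  obtain ⟨τ, σ, hexec, hyes, hno, ord, e, hdig, hs, hdeg, hτ⟩ :=
    hprog n s t (natAdj G) δ (RAM.broadcastInput G s t) (RAM.env_broadcastInput t)
      (by simp [RAM.broadcastInput]) (by simp [RAM.broadcastInput])
      (fun a ha q => by simp [RAM.broadcastInput, ha]) s.2 hlt hsymm
      (fun v h => h.2.2.ne rfl) hδ
  rw [exists_isSchedule_min_iff hlt hsymm hδ, exists_isSchedule_iff, ← broadcastTime_le_iff]
    at hyes hno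
  exact ⟨τ, σ, hexec, hyes, hno, fun k hk => hC' n _ k τ (Nat.one_le_of_lt s.2)
    (rank_le_of_cyclomaticNumber_le hk hdig hs hdeg) hτ⟩
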